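/- **Setting.** Let $0<\alpha\le\beta<\infty$, $\gamma\in(0,\infty)$, $C_\Lambda>0$, and let $\Lambda\in\mathbb R^{2\times2}$ be invertible with $\frac1{C_\Lambda}I\le\Lambda^\top\Lambda\le C_\Lambda I$. A function of $y\in\mathbb R^2$ is $\Lambda$-periodic if it is invariant (a.e.) under translations by $\Lambda\mathbb Z^2$. Put $\Box_\Lambda=(-\frac12,\frac12)\times\Lambda[-\frac12,\frac12)^2$ with points $(x_3,y)$, write $A:B=\sum_{ij}A_{ij}B_{ij}$, $|A|^2=A:A$, $\operatorname{sym}A=\frac12(A+A^\top)$, let $\iota(G)\in\mathbb R^{3\times3}$ be the matrix with upper-left $2\times2$ block $G$ and vanishing third row and column, and let $\nabla_\gamma=(\nabla_y,\frac1\gamma\partial_3)$. Let $H^1_\gamma(\Box_\Lambda;\mathbb R^3)$ be the space of $\varphi\in H^1_{\rm loc}((-\frac12,\frac12)\times\mathbb R^2;\mathbb R^3)$ that are $\Lambda$-periodic in $y$ and satisfy $\sup_{z\in\mathbb R^2}\int_{(-\frac12,\frac12)^3}|\varphi(x_3,y+z)|^2+|\nabla_\gamma\varphi(x_3,y+z)|^2\,d(x_3,y)<\infty$.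 Let $Q:(-\frac12,\frac12)\times\mathbb R^2\times\mathbb R^{3\times3}\to\mathbb R$ be Borel, such that for a.e. $(x_3,y)$ the function $Q(x_3,y,\cdot)$ is a quadratic form with $\alpha|\operatorname{sym}G|^2\le Q(x_3,y,G)\le\beta|\operatorname{sym}G|^2$ for all $G$, and $Q(x_3,\cdot,G)$ is $\Lambda$-periodic for every $G$ and a.e. $x_3$. Let $B:(-\frac12,\frac12)\times\mathbb R^2\to\mathbb R^{3\times3}_{\rm sym}$ be Borel, $\Lambda$-periodic in $y$ for a.e. $x_3$, and square integrable on $\Box_\Lambda$. Write $\mathbb L F:G=\frac12(Q(F+G)-Q(F)-Q(G))$ (pointwise in $(x_3,y)$). Define $$Q^\gamma_{\hom}(G)=\inf\Big\{\frac{1}{|\Box_\Lambda|}\int_{\Box_\Lambda}Q\big(x_3,y,\iota(x_3G+M)+\operatorname{sym}\nabla_\gamma\varphi\big)\,d(x_3,y)\;:\;M\in\mathbb R^{2\times2}_{\rm sym},\ \varphi\in H^1_\gamma(\Box_\Lambda;\mathbb R^3)\Big\}.$$ On the space $\mathbf H_\Lambda$ of $\Lambda$-periodic fields $F:(-\frac12,\frac12)\times\mathbb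 R^2\to\mathbb R^{3\times3}_{\rm sym}$ that are square integrable on $\Box_\Lambda$, use the scalar product $(F,F')_\Lambda=\frac1{|\Box_\Lambda|}\int_{\Box_\Lambda}\mathbb LF:F'$. Let $\mathbf H_{\rm rel}=\{\iota(M)+\operatorname{sym}\nabla_\gamma\varphi: M\in\mathbb R^{2\times2}_{\rm sym},\ \varphi\in H^1_\gamma(\Box_\Lambda;\mathbb R^3)\}$, let $\mathbf H_{\rm rel}^\perp$ be the orthogonal complement of $\mathbf H_{\rm rel}$ in $\{\iota(x_3G)+\chi:G\in\mathbb R^{2\times2}_{\rm sym},\ \chi\in\mathbf H_{\rm rel}\}$, and let $P^\perp$ be the orthogonal projection of $\mathbf H_\Lambda$ onto $\mathbf H_{\rm rel}^\perp$. The effective prestrain $B^\gamma_{\rm eff}$ is the matrix $G\in\mathbb R^{2\times2}_{\rm sym}$ with $P^\perp(\iota(x_3G))=P^\perp(\operatorname{sym}B)$. **Correctors.** There is a constant $C=C(\alpha,\beta,\gamma,C_\Lambda)$ such that, for all $\Lambda$, $Q$ as above and every $G\in\mathbb R^{2\times2}_{\rm sym}$, there is a unique pair $M_G\in\mathbb R^{2\times2}_{\rm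 sym}$, $\varphi_G\in H^1_\gamma(\Box_\Lambda;\mathbb R^3)$ with $\int_{\Box_\Lambda}\varphi_G=0$ such that $$\int_{\Box_\Lambda}\mathbb L\big(\iota(x_3G+M_G)+\operatorname{sym}\nabla_\gamma\varphi_G\big):\big(\iota(M')+\operatorname{sym}\nabla_\gamma\varphi'\big)\,d(x_3,y)=0$$ for all $M'\in\mathbb R^{2\times2}_{\rm sym}$ and $\varphi'\in H^1_\gamma(\Box_\Lambda;\mathbb R^3)$, and $$|M_G|^2+\frac1{|\Box_\Lambda|}\int_{\Box_\Lambda}|\nabla_\gamma\varphi_G|^2\,d(x_3,y)\le C|G|^2.$$ **Representation.** Let $G_1,G_2,G_3$ be an orthonormal basis of $\mathbb R^{2\times2}_{\rm sym}$ with correctors $(M_{G_i},\varphi_{G_i})$. (a) The matrix $\widehat Q\in\mathbb R^{3\times3}$, $$\widehat Q_{ik}=\frac1{|\Box_\Lambda|}\int_{\Box_\Lambda}\mathbb L\big(\iota(x_3G_i+M_{G_i})+\operatorname{sym}\nabla_\gamma\varphi_{G_i}\big):\iota(x_3G_k)\,d(x_3,y),$$ is symmetric and positive definite with $\frac\alpha{12}I\le\widehat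 Q\le\frac\beta{12}I$, and $Q^\gamma_{\hom}(G)=\sum_{i,j=1}^3\widehat Q_{ij}\widehat G_i\widehat G_j$ for every $G=\sum_i\widehat G_iG_i\in\mathbb R^{2\times2}_{\rm sym}$. (b) The effective prestrain is well defined (the matrix $G$ in its definition exists and is unique), and with $$\widehat B_i=\frac1{|\Box_\Lambda|}\int_{\Box_\Lambda}\mathbb L\big(\iota(x_3G_i+M_{G_i})+\operatorname{sym}\nabla_\gamma\varphi_{G_i}\big):B\,d(x_3,y),\qquad i=1,2,3,$$ one has $B^\gamma_{\rm eff}=\sum_{i=1}^3(\widehat Q^{-1}\widehat B)_iG_i$. -/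

import Mathlib

open MeasureTheory Set
open scoped Matrix ContDiff NNReal

namespace PlateHom

noncomputable section

/-- Points `(x₃, y)` with `x₃ ∈ ℝ` and `y ∈ ℝ²`; the measure used is Lebesgue measure. -/
abbrev Pt : Type := ℝ × (Fin 2 → ℝ)

abbrev Mat2 : Type := Matrix (Fin 2) (Fin 2) ℝ

abbrev Mat3 : Type := Matrix (Fin 3) (Fin 3) ℝ

/-- The layer `(-1/2, 1/2) × ℝ²`. -/
def strip : Set Pt := Ioo (-(1 / 2) : ℝ) (1 / 2) ×ˢ univ

/-- The reference cell `Y_Λ = Λ [-1/2, 1/2)²`. -/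
def cell (Λ : Mat2) : Set (Fin 2 → ℝ) :=
  (fun v : Fin 2 → ℝ => Λ *ᵥ v) '' Set.pi univ (fun _ => Ico (-(1 / 2) : ℝ) (1 / 2))

/-- The representative volume element `□_Λ = (-1/2, 1/2) × Y_Λ`. -/
def box (Λ : Mat2) : Set Pt := Ioo (-(1 / 2) : ℝ) (1 / 2) ×ˢ cell Λ

/-! ### Matrices -/

/-- The scalar product `A : B = ∑ᵢⱼ Aᵢⱼ Bᵢⱼ`; thus `|A|² = A : A`. -/
def frob {n : ℕ} (A B : Matrix (Fin n) (Fin n) ℝ) : ℝ := ∑ i, ∑ j, A i j * B i j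

/-- The symmetric part of a matrix. -/
def symPart (A : Mat3) : Mat3 := (1 / 2 : ℝ) • (A + Aᵀ)

/-- The `3 × 3` matrix with upper-left block `G` and vanishing third row and column. -/
def iota (G : Mat2) : Mat3 :=
  !![G 0 0, G 0 1, 0;
     G 1 0, G 1 1, 0;
     0, 0, 0]

/-- `G₁, G₂, G₃` is an orthonormal basis of the symmetric `2 × 2` matrices. -/
structure IsSymOrthonormalBasis (Gb : Fin 3 → Mat2) : Prop where
  symm : ∀ i, (Gb i).IsSymm
  orthonormal : ∀ i j, frob (Gb i) (Gb j) = if i = j then 1 else 0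
  span : ∀ G : Mat2, G.IsSymm → ∃ c : Fin 3 → ℝ, G = ∑ i, c i • Gb i

/-! ### Admissible quadratic forms and prestrains -/

/-- The class `𝒬(α, β)` of quadratic forms on `ℝ^{3×3}` with
`α |sym G|² ≤ q G ≤ β |sym G|²`. -/
def MemQClass (α β : ℝ) (q : Mat3 → ℝ) : Prop :=
  (∃ q' : QuadraticForm ℝ Mat3, ∀ G, q' G = q G) ∧
    ∀ G, α * frob (symPart G) (symPart G) ≤ q G ∧ q G ≤ β * frob (symPart G) (symPart G)

/-- `𝕃 F : G`, where `𝕃` is the tensor associated with `q` by polarization. -/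
def pairing (q : Mat3 → ℝ) (F G : Mat3) : ℝ := (q (F + G) - q F - q G) / 2

/-- `Λ`-periodicity in the second variable of a function on the layer. -/
def LatticePeriodic {E : Type*} (Λ : Mat2) (u : Pt → E) : Prop :=
  ∀ k : Fin 2 → ℤ, ∀ᵐ x ∂(volume.restrict strip),
    u (x.1, x.2 + Λ *ᵥ (fun i => (k i : ℝ))) = u x

/-- `Λ`-periodic, admissible quadratic form (only the values on the layer matter). -/
structure AdmissibleForm (α β : ℝ) (Λ : Mat2) (Q : Pt → Mat3 → ℝ) : Prop where
  borel : Measurable (fun z : strip × (Fin 3 → Fin 3 → ℝ) => Q z.1 (Matrix.of z.2))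
  memClass : ∀ᵐ x ∂(volume.restrict strip), MemQClass α β (Q x)
  periodic : ∀ G : Mat3, LatticePeriodic Λ (fun x => Q x G)

/-- `Λ`-periodic, admissible prestrain (only the values on the layer matter). -/
structure AdmissiblePrestrain (Λ : Mat2) (B : Pt → Mat3) : Prop where
  borel : ∀ i j, Measurable (fun x : strip => B x i j)
  symm : ∀ x ∈ strip, (B x).IsSymm
  sqIntegrable : ∀ i j, MemLp (fun x => B x i j) 2 (volume.restrict (box Λ))
  periodic : LatticePeriodic Λ B

/-! ### Weak derivatives and the space `H¹_γ(□_Λ; ℝ³)` -/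

/-- `g` is the weak derivative of `u` in direction `v` on the layer. -/
structure HasWeakDeriv (v : Pt) (u g : Pt → ℝ) : Prop where
  locInt : LocallyIntegrableOn u strip
  locInt_deriv : LocallyIntegrableOn g strip
  integral_eq : ∀ ψ : Pt → ℝ, ContDiff ℝ ∞ ψ → HasCompactSupport ψ → tsupport ψ ⊆ strip →
    ∫ x in strip, u x * fderiv ℝ ψ x v = -∫ x in strip, g x * ψ x

open Classical in
/-- A representative of the weak derivative (unique a.e. on the layer); `0` if there is none. -/
def weakDeriv (v : Pt) (u : Pt → ℝ) : Pt → ℝ :=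
  if h : ∃ g, HasWeakDeriv v u g then h.choose else 0

/-- The coordinate directions in the order `y₁, y₂, x₃`. -/
def dir : Fin 3 → Pt := ![(0, Pi.single 0 1), (0, Pi.single 1 1), (1, 0)]

/-- The scaled gradient `∇_γ φ = (∇_y φ, γ⁻¹ ∂₃ φ)`; row `i` belongs to the component `φᵢ`. -/
def scaledGrad (γ : ℝ) (φ : Pt → Fin 3 → ℝ) (x : Pt) : Mat3 :=
  Matrix.of fun i j =>
    (if j = 2 then 1 / γ else 1) * weakDeriv (dir j) (fun x' => φ x' i) x

/-- Functions on the layer that are uniformly locally square integrable: the `L²`-norms over all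
columns `(-1/2, 1/2) × (z + (-1/2, 1/2)²)` are bounded by a common constant. -/
def MemUloc (u : Pt → ℝ) : Prop :=
  AEStronglyMeasurable u (volume.restrict strip) ∧
    ∃ K : ℝ≥0, ∀ z : Fin 2 → ℝ,
      eLpNorm u 2 (volume.restrict (Ioo (-(1 / 2) : ℝ) (1 / 2) ×ˢ
        Set.pi univ (fun i => Ioo (z i - 1 / 2) (z i + 1 / 2)))) ≤ K

/-- The space `H¹_γ(□_Λ; ℝ³)` of `Λ`-periodic functions in `H¹_{γ,uloc}`. As a set of functions it
does not depend on `γ ∈ (0, ∞)`. -/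
def H1per (Λ : Mat2) : Set (Pt → Fin 3 → ℝ) :=
  {φ | LatticePeriodic Λ φ ∧ ∀ i, MemUloc (fun x => φ x i) ∧
    ∀ j, ∃ g, MemUloc g ∧ HasWeakDeriv (dir j) (fun x => φ x i) g}

/-! ### The homogenized quadratic form -/

/-- The field `ι(x₃ G + M) + sym ∇_γ φ`. -/
def strain (γ : ℝ) (G M : Mat2) (φ : Pt → Fin 3 → ℝ) (x : Pt) : Mat3 :=
  iota (x.1 • G + M) + symPart (scaledGrad γ φ x)

/-- The homogenized quadratic form `Q^γ_hom`. -/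
def Qhom (γ : ℝ) (Λ : Mat2) (Q : Pt → Mat3 → ℝ) (G : Mat2) : ℝ :=
  sInf {e | ∃ (M : Mat2) (φ : Pt → Fin 3 → ℝ), M.IsSymm ∧ φ ∈ H1per Λ ∧
    e = ⨍ x in box Λ, Q x (strain γ G M φ x)}

/-! ### The effective prestrain -/

/-- The space `𝐇_Λ` of `Λ`-periodic, symmetric matrix fields, square integrable on `□_Λ`. -/
def HSpace (Λ : Mat2) : Set (Pt → Mat3) :=
  {F | LatticePeriodic Λ F ∧ (∀ᵐ x ∂(volume.restrict strip), (F x).IsSymm) ∧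
    ∀ i j, MemLp (fun x => F x i j) 2 (volume.restrict (box Λ))}

/-- The scalar product `(F, F')_Λ` of `𝐇_Λ`. -/
def innerH (Λ : Mat2) (Q : Pt → Mat3 → ℝ) (F F' : Pt → Mat3) : ℝ :=
  ⨍ x in box Λ, pairing (Q x) (F x) (F' x)

/-- The subspace `𝐇^γ_{rel,Λ}` of fields `ι(M) + sym ∇_γ φ`. -/
def HRel (γ : ℝ) (Λ : Mat2) : Set (Pt → Mat3) :=
  {F | ∃ (M : Mat2) (φ : Pt → Fin 3 → ℝ), M.IsSymm ∧ φ ∈ H1per Λ ∧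
    F =ᵐ[volume.restrict strip] fun x => iota M + symPart (scaledGrad γ φ x)}

/-- The subspace `𝐇^γ_Λ` of fields `ι(x₃ G) + χ` with `χ ∈ 𝐇^γ_{rel,Λ}`. -/
def HGamma (γ : ℝ) (Λ : Mat2) : Set (Pt → Mat3) :=
  {F | ∃ (G : Mat2) (χ : Pt → Mat3), G.IsSymm ∧ χ ∈ HRel γ Λ ∧
    F =ᵐ[volume.restrict strip] fun x => iota (x.1 • G) + χ x}

/-- The orthogonal complement `𝐇^{γ,⊥}_{rel,Λ}` of `𝐇^γ_{rel,Λ}` in `𝐇^γ_Λ`. -/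
def HRelPerp (γ : ℝ) (Λ : Mat2) (Q : Pt → Mat3 → ℝ) : Set (Pt → Mat3) :=
  {F | F ∈ HGamma γ Λ ∧ ∀ χ ∈ HRel γ Λ, innerH Λ Q F χ = 0}

/-- `P` is (a representative of) the orthogonal projection of `F ∈ 𝐇_Λ` onto
`𝐇^{γ,⊥}_{rel,Λ}`. -/
def IsRelPerpProj (γ : ℝ) (Λ : Mat2) (Q : Pt → Mat3 → ℝ) (F P : Pt → Mat3) : Prop :=
  F ∈ HSpace Λ ∧ P ∈ HRelPerp γ Λ Q ∧
    ∀ χ ∈ HRelPerp γ Λ Q, innerH Λ Q (fun x => F x - P x) χ = 0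

/-- `G` is a symmetric matrix with `𝐄^γ_Λ(G) = P^{γ,⊥}_{rel,Λ}(sym B)`, where
`𝐄^γ_Λ(G) = P^{γ,⊥}_{rel,Λ}(ι(x₃ G))`. -/
def IsEffPrestrain (γ : ℝ) (Λ : Mat2) (Q : Pt → Mat3 → ℝ) (B : Pt → Mat3) (G : Mat2) : Prop :=
  G.IsSymm ∧ ∃ P : Pt → Mat3,
    IsRelPerpProj γ Λ Q (fun x => iota (x.1 • G)) P ∧
    IsRelPerpProj γ Λ Q (fun x => symPart (B x)) P

open Classical in
/-- The effective prestrain `B^γ_eff = (𝐄^γ_Λ)⁻¹ (P^{γ,⊥}_{rel,Λ}(sym B))`. -/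
def effPrestrain (γ : ℝ) (Λ : Mat2) (Q : Pt → Mat3 → ℝ) (B : Pt → Mat3) : Mat2 :=
  if h : ∃ G, IsEffPrestrain γ Λ Q B G then h.choose else 0

/-! ### Correctors -/

/-- `(M, φ)` solves the corrector problem associated with `G`. -/
structure IsCorrector (γ : ℝ) (Λ : Mat2) (Q : Pt → Mat3 → ℝ) (G M : Mat2)
    (φ : Pt → Fin 3 → ℝ) : Prop where
  symm : M.IsSymm
  mem : φ ∈ H1per Λ
  mean_zero : ∀ i, ∫ x in box Λ, φ x i = 0
  equation : ∀ (M' : Mat2) (φ' : Pt → Fin 3 → ℝ), M'.IsSymm → φ' ∈ H1per Λ →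
    ∫ x in box Λ, pairing (Q x) (strain γ G M φ x)
      (iota M' + symPart (scaledGrad γ φ' x)) = 0

/-- The matrix `Q̂` computed from the basis `Gᵢ` and the pairs `(Mᵢ, φᵢ)`. -/
def Qhat (γ : ℝ) (Λ : Mat2) (Q : Pt → Mat3 → ℝ) (Gb M : Fin 3 → Mat2)
    (φ : Fin 3 → Pt → Fin 3 → ℝ) : Mat3 :=
  Matrix.of fun i k =>
    ⨍ x in box Λ, pairing (Q x) (strain γ (Gb i) (M i) (φ i) x) (iota (x.1 • Gb k))

/-- The vector `B̂` computed from the basis `Gᵢ` and the pairs `(Mᵢ, φᵢ)`. -/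
def Bhat (γ : ℝ) (Λ : Mat2) (Q : Pt → Mat3 → ℝ) (B : Pt → Mat3) (Gb M : Fin 3 → Mat2)
    (φ : Fin 3 → Pt → Fin 3 → ℝ) : Fin 3 → ℝ :=
  fun i => ⨍ x in box Λ, pairing (Q x) (strain γ (Gb i) (M i) (φ i) x) (B x)

end

end PlateHom

open PlateHom

/-! Everything rests on one coercivity estimate for the energy of the fields `ι(x₃G + M) + sym ∇_γ
φ`. In-plane derivatives of periodic functions integrate to zero against functions of `x₃`, and `∫
x₃ = 0`, `∫ x₃² = 1/12` over the thickness. So the squared norm of such a field splits into `|det Λ|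
(|G|²/12 + |M|²) + ∫ |sym ∇_γ φ|²` (`integral_frob_strain`). Korn's inequality (`korn`) recovers the
full gradient from the last term, and `poincare` recovers `φ` itself when its mean vanishes.

Both inequalities are proved by Fourier expansion in `y`. Parseval's identity (`hasSum_box`) reduces
them to estimates, one per lattice frequency, for functions of `x₃` alone. Weak derivatives pass to
the coefficients by testing with periodic modes that are cut off by a lattice partition of unity
(`HasWeakDeriv.integral_box`). In-plane shear is handled by algebra (`grad_le_of_mode`). The
out-of-plane component needs an integration by parts on `(-1/2, 1/2)` with free ends, whose boundary
terms are absorbed by a multiplier `x₃ (p²/δ + δ q²)` (`integral_mode_le`). The constants are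
uniform because nonzero frequencies are bounded below by `CΛ^{-1/2}` (`freq_lower`).

Pairs `(M, φ)` with mean-zero `φ` form a closed subspace of a product of `L²` spaces
(`isClosed_corrSubmodule`), so Lax–Milgram yields correctors (`exists_isCorrector`). Coercivity
yields their uniqueness and, compared with the competitor `M = 0`, `φ = 0`, their bound.

A corrector minimizes the energy for its `G`, and linear combinations of correctors are correctors.
Hence the strains of three basis correctors span `HRelPerp` up to null sets on the box
(`exists_ae_eq_combStrain`), and `Qhat` is their Gram matrix. Its quadratic form is therefore
`Qhom`, and equality of the two projections that define the effective prestrain is the linear system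
`Q̂ c = B̂` (`isEffPrestrain_sum_iff`). -/

namespace PlateHom

noncomputable section

section

/-! ### Lattice geometry -/

/-- Translation of the layer by the lattice vector `Λ k`. -/
def shift (Λ : Mat2) (k : Fin 2 → ℤ) (x : Pt) : Pt :=
  (x.1, x.2 + Λ *ᵥ (fun i => (k i : ℝ)))

/-- The index of the lattice cell containing `y`. -/
def latIdx (Λ : Mat2) (y : Fin 2 → ℝ) : Fin 2 → ℤ := fun i => ⌊(Λ⁻¹ *ᵥ y) i + 1 / 2⌋

/-- Reduction of a point of the layer to the reference cell. -/
def red (Λ : Mat2) (x : Pt) : Pt := shift Λ (-latIdx Λ x.2) x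

/-- Periodic extension. -/
def perExt {E : Type*} (Λ : Mat2) (u : Pt → E) (x : Pt) : E := u (red Λ x)

/-- The translate of `□_Λ` with index `k`. -/
def tile (Λ : Mat2) (k : Fin 2 → ℤ) : Set Pt := {x | x ∈ strip ∧ latIdx Λ x.2 = k}

variable {Λ : Mat2}

lemma shift_shift (k l : Fin 2 → ℤ) (x : Pt) : shift Λ k (shift Λ l x) = shift Λ (l + k) x := by
  have : (fun i => (((l + k) i : ℤ) : ℝ)) = (fun i => (l i : ℝ)) + fun i => (k i : ℝ) := by
    ext i; simp
  simp only [shift, this, Matrix.mulVec_add, add_assoc]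

lemma shift_zero (x : Pt) : shift Λ 0 x = x := by
  have : (fun i : Fin 2 => (((0 : Fin 2 → ℤ) i : ℤ) : ℝ)) = 0 := by ext i; simp
  simp only [shift, this, Matrix.mulVec_zero, add_zero]

lemma shift_mem_strip {k : Fin 2 → ℤ} {x : Pt} : shift Λ k x ∈ strip ↔ x ∈ strip := by
  simp [strip, shift]

lemma isOpen_strip : IsOpen strip := isOpen_Ioo.prod isOpen_univ

lemma measurableSet_strip : MeasurableSet strip := isOpen_strip.measurableSet

lemma mem_cell_iff (hΛ : IsUnit Λ.det) {y : Fin 2 → ℝ} :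
    y ∈ cell Λ ↔ ∀ i, (Λ⁻¹ *ᵥ y) i ∈ Ico (-(1 / 2) : ℝ) (1 / 2) := by
  constructor
  · rintro ⟨v, hv, rfl⟩ i
    rw [Matrix.mulVec_mulVec, Matrix.nonsing_inv_mul _ hΛ, Matrix.one_mulVec]
    exact hv i (mem_univ i)
  · intro h
    refine ⟨Λ⁻¹ *ᵥ y, fun i _ => h i, ?_⟩
    simp only [Matrix.mulVec_mulVec, Matrix.mul_nonsing_inv _ hΛ, Matrix.one_mulVec]

lemma latIdx_eq_zero_iff (hΛ : IsUnit Λ.det) {y : Fin 2 → ℝ} :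
    latIdx Λ y = 0 ↔ y ∈ cell Λ := by
  rw [mem_cell_iff hΛ, funext_iff]
  refine forall_congr' fun i => ?_
  simp only [latIdx, Pi.zero_apply, Int.floor_eq_zero_iff, mem_Ico]
  constructor <;> rintro ⟨h1, h2⟩ <;> constructor <;> linarith

lemma latIdx_add (hΛ : IsUnit Λ.det) (k : Fin 2 → ℤ) (y : Fin 2 → ℝ) :
    latIdx Λ (y + Λ *ᵥ (fun i => (k i : ℝ))) = latIdx Λ y + k := by
  ext i
  simp only [latIdx, Matrix.mulVec_add, Matrix.mulVec_mulVec, Matrix.nonsing_inv_mul _ hΛ,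
    Matrix.one_mulVec, Pi.add_apply]
  rw [add_right_comm, Int.floor_add_intCast]

lemma latIdx_shift (hΛ : IsUnit Λ.det) (k : Fin 2 → ℤ) (x : Pt) :
    latIdx Λ (shift Λ k x).2 = latIdx Λ x.2 + k := latIdx_add hΛ k x.2

lemma mem_box_iff (hΛ : IsUnit Λ.det) {x : Pt} : x ∈ box Λ ↔ x ∈ strip ∧ latIdx Λ x.2 = 0 := by
  rw [latIdx_eq_zero_iff hΛ]; simp [box, strip]

lemma box_subset_strip : box Λ ⊆ strip := prod_mono_right (subset_univ _)

lemma tile_zero (hΛ : IsUnit Λ.det) : tile Λ 0 = box Λ := by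
  ext x; rw [mem_box_iff hΛ]; rfl

lemma shift_preimage_tile (hΛ : IsUnit Λ.det) (k : Fin 2 → ℤ) :
    shift Λ k ⁻¹' tile Λ k = box Λ := by
  ext x
  rw [mem_box_iff hΛ]
  simp [tile, shift_mem_strip, latIdx_shift hΛ]

lemma red_shift (hΛ : IsUnit Λ.det) (k : Fin 2 → ℤ) (x : Pt) :
    red Λ (shift Λ k x) = red Λ x := by
  simp only [red, latIdx_shift hΛ, shift_shift]
  congr 1; abel

lemma red_of_mem_box (hΛ : IsUnit Λ.det) {x : Pt} (hx : x ∈ box Λ) : red Λ x = x := by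
  rw [red, ((mem_box_iff hΛ).1 hx).2, neg_zero, shift_zero]

lemma perExt_shift {E : Type*} (hΛ : IsUnit Λ.det) (u : Pt → E) (k : Fin 2 → ℤ) (x : Pt) :
    perExt Λ u (shift Λ k x) = perExt Λ u x := by
  rw [perExt, red_shift hΛ, perExt]

lemma perExt_of_mem_box {E : Type*} (hΛ : IsUnit Λ.det) (u : Pt → E) {x : Pt} (hx : x ∈ box Λ) :
    perExt Λ u x = u x := by
  rw [perExt, red_of_mem_box hΛ hx]

lemma latticePeriodic_perExt {E : Type*} (hΛ : IsUnit Λ.det) (u : Pt → E) :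
    LatticePeriodic Λ (perExt Λ u) :=
  fun k => Filter.Eventually.of_forall fun x => perExt_shift hΛ u k x

lemma continuous_mulVec (A : Mat2) : Continuous fun y : Fin 2 → ℝ => A *ᵥ y :=
  Continuous.matrix_mulVec continuous_const continuous_id

lemma continuous_shift (k : Fin 2 → ℤ) : Continuous (shift Λ k) := by
  unfold shift; fun_prop

lemma measurable_latIdx : Measurable (latIdx Λ) := by
  refine measurable_pi_lambda _ fun i => ?_
  have : Measurable fun y : Fin 2 → ℝ => (Λ⁻¹ *ᵥ y) i :=
    ((continuous_apply i).comp (continuous_mulVec _)).measurable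
  exact (this.add_const _).floor

lemma measurableSet_tile (k : Fin 2 → ℤ) : MeasurableSet (tile Λ k) :=
  measurableSet_strip.inter
    ((measurable_latIdx.comp measurable_snd) (measurableSet_singleton k))

lemma measurableSet_box (hΛ : IsUnit Λ.det) : MeasurableSet (box Λ) := by
  rw [← tile_zero hΛ]; exact measurableSet_tile 0

lemma measurableSet_cell (hΛ : IsUnit Λ.det) : MeasurableSet (cell Λ) := by
  have : cell Λ = latIdx Λ ⁻¹' {0} := by
    ext y; rw [mem_preimage, mem_singleton_iff, latIdx_eq_zero_iff hΛ]
  rw [this]; exact measurable_latIdx (measurableSet_singleton _)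

lemma iUnion_tile : ⋃ k, tile Λ k = strip := by
  ext x; simp [tile]

lemma pairwise_disjoint_tile : Pairwise (Function.onFun Disjoint (tile Λ)) := by
  intro k l hkl
  refine Set.disjoint_left.2 fun x hx hx' => hkl ?_
  rw [← hx.2, ← hx'.2]

lemma measurePreserving_shift (k : Fin 2 → ℤ) :
    MeasurePreserving (shift Λ k) (volume : Measure Pt) volume :=
  (MeasurePreserving.id volume).prod (measurePreserving_add_right volume _)

lemma measurePreserving_shift_strip (k : Fin 2 → ℤ) :
    MeasurePreserving (shift Λ k) (volume.restrict strip) (volume.restrict strip) := by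
  have h := (measurePreserving_shift (Λ := Λ) k).restrict_preimage measurableSet_strip
  have : shift Λ k ⁻¹' strip = strip := by ext x; exact shift_mem_strip
  rwa [this] at h

lemma measurePreserving_shift_tile (hΛ : IsUnit Λ.det) (k : Fin 2 → ℤ) :
    MeasurePreserving (shift Λ k) (volume.restrict (box Λ)) (volume.restrict (tile Λ k)) := by
  have h := (measurePreserving_shift (Λ := Λ) k).restrict_preimage (measurableSet_tile (Λ := Λ) k)
  rwa [shift_preimage_tile hΛ] at h

/-- The translation by a lattice vector as a homeomorphism. -/
def shiftHomeo (Λ : Mat2) (k : Fin 2 → ℤ) : Pt ≃ₜ Pt where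
  toFun := shift Λ k
  invFun := shift Λ (-k)
  left_inv x := by rw [shift_shift, add_neg_cancel, shift_zero]
  right_inv x := by rw [shift_shift, neg_add_cancel, shift_zero]
  continuous_toFun := continuous_shift k
  continuous_invFun := continuous_shift (-k)

lemma measurableEmbedding_shift (k : Fin 2 → ℤ) : MeasurableEmbedding (shift Λ k) :=
  (shiftHomeo Λ k).measurableEmbedding

lemma ae_strip_of_forall_tile {p : Pt → Prop}
    (h : ∀ k, ∀ᵐ x ∂(volume.restrict (tile Λ k)), p x) : ∀ᵐ x ∂(volume.restrict strip), p x := by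
  rw [← iUnion_tile (Λ := Λ), ae_restrict_iUnion_iff]; exact h

lemma LatticePeriodic.ae_shift {E : Type*} {u : Pt → E} (hu : LatticePeriodic Λ u)
    (k : Fin 2 → ℤ) : ∀ᵐ x ∂(volume.restrict (box Λ)), u (shift Λ k x) = u x :=
  ae_restrict_of_ae_restrict_of_subset box_subset_strip (hu k)

/-- Each tile is the image of the box under a measure-preserving lattice translation that leaves
both functions invariant, and there are countably many tiles. Uniqueness of correctors on the whole
layer comes from this. -/
lemma LatticePeriodic.ae_eq_of_box {E : Type*} (hΛ : IsUnit Λ.det) {u v : Pt → E}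
    (hu : LatticePeriodic Λ u) (hv : LatticePeriodic Λ v)
    (h : u =ᵐ[volume.restrict (box Λ)] v) : u =ᵐ[volume.restrict strip] v := by
  refine ae_strip_of_forall_tile (Λ := Λ) fun k => ?_
  rw [← (measurePreserving_shift_tile hΛ k).map_eq, (measurableEmbedding_shift k).ae_map_iff]
  filter_upwards [hu.ae_shift k, hv.ae_shift k, h] with x h1 h2 h3
  rw [h1, h2, h3]

/-- `Λ⁻¹` maps balls to bounded sets, so a bounded region meets finitely many tiles. This keeps the
unfolding of compactly supported integrands a finite sum. -/
lemma exists_latIdx_mem (R : ℝ) : ∃ S : Finset (Fin 2 → ℤ), ∀ y : Fin 2 → ℝ, ‖y‖ ≤ R →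
    latIdx Λ y ∈ S := by
  have hc : IsCompact ((fun y : Fin 2 → ℝ => Λ⁻¹ *ᵥ y) '' Metric.closedBall 0 R) :=
    (isCompact_closedBall 0 R).image (continuous_mulVec _)
  obtain ⟨N, hN⟩ := hc.isBounded.exists_norm_le
  -- The extra unit on each side absorbs the shift by `1/2` and the rounding in `latIdx`.
  refine ⟨Fintype.piFinset fun _ => Finset.Icc (-⌈N⌉ - 1) (⌈N⌉ + 1), fun y hy => ?_⟩
  rw [Fintype.mem_piFinset]
  intro i
  have h1 : ‖(Λ⁻¹ *ᵥ y) i‖ ≤ N :=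
    (norm_le_pi_norm _ i).trans (hN _ ⟨y, by simpa using hy, rfl⟩)
  rw [Real.norm_eq_abs, abs_le] at h1
  have h2 := Int.le_ceil N
  rw [Finset.mem_Icc]
  constructor
  · refine Int.le_floor.2 ?_
    push_cast; linarith
  · refine Int.floor_le_iff.2 ?_
    push_cast; linarith

lemma exists_latIdx_of_hasCompactSupport {ζ : Pt → ℝ} (hζ : HasCompactSupport ζ) :
    ∃ S : Finset (Fin 2 → ℤ), ∀ x, latIdx Λ x.2 ∉ S → ζ x = 0 := by
  obtain ⟨R, hR⟩ := hζ.isBounded.exists_norm_le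
  obtain ⟨S, hS⟩ := exists_latIdx_mem (Λ := Λ) R
  refine ⟨S, fun x hx => ?_⟩
  by_contra h
  exact hx (hS _ ((norm_snd_le x).trans (hR x (subset_tsupport _ h))))

/-! ### Unfolding integrals over the layer -/

lemma setIntegral_tile (hΛ : IsUnit Λ.det) (k : Fin 2 → ℤ) (f : Pt → ℝ) :
    ∫ x in tile Λ k, f x = ∫ x in box Λ, f (shift Λ k x) :=
  ((measurePreserving_shift_tile hΛ k).integral_comp (measurableEmbedding_shift k) f).symm

lemma integrableOn_tile (hΛ : IsUnit Λ.det) (k : Fin 2 → ℤ) {f : Pt → ℝ} :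
    IntegrableOn f (tile Λ k) ↔ IntegrableOn (fun x => f (shift Λ k x)) (box Λ) :=
  ((measurePreserving_shift_tile hΛ k).integrable_comp_emb (measurableEmbedding_shift k)).symm

lemma LatticePeriodic.integrableOn_tile (hΛ : IsUnit Λ.det) {F : Pt → ℝ}
    (hF : LatticePeriodic Λ F) (hi : IntegrableOn F (box Λ)) (k : Fin 2 → ℤ) :
    IntegrableOn F (tile Λ k) := by
  rw [PlateHom.integrableOn_tile hΛ]
  refine hi.congr ?_
  filter_upwards [hF.ae_shift k] with x hx using hx.symm

lemma LatticePeriodic.integrableOn_bounded (hΛ : IsUnit Λ.det) {F : Pt → ℝ}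
    (hF : LatticePeriodic Λ F) (hi : IntegrableOn F (box Λ)) (R : ℝ) :
    IntegrableOn F (strip ∩ {x | ‖x.2‖ ≤ R}) := by
  obtain ⟨S, hS⟩ := exists_latIdx_mem (Λ := Λ) R
  have : IntegrableOn F (⋃ k ∈ S, tile Λ k) :=
    integrableOn_finset_iUnion.2 fun k _ => hF.integrableOn_tile hΛ hi k
  refine this.mono_set fun x hx => ?_
  simp only [mem_iUnion]
  exact ⟨_, hS _ hx.2, hx.1, rfl⟩

lemma LatticePeriodic.locallyIntegrableOn (hΛ : IsUnit Λ.det) {F : Pt → ℝ}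
    (hF : LatticePeriodic Λ F) (hi : IntegrableOn F (box Λ)) : LocallyIntegrableOn F strip := by
  intro x hx
  refine ⟨strip ∩ {z | ‖z.2‖ ≤ ‖x.2‖ + 1}, ?_, hF.integrableOn_bounded hΛ hi _⟩
  refine Filter.inter_mem self_mem_nhdsWithin (mem_nhdsWithin_of_mem_nhds ?_)
  have : IsOpen {z : Pt | ‖z.2‖ < ‖x.2‖ + 1} := isOpen_lt (by fun_prop) continuous_const
  refine Filter.mem_of_superset (this.mem_nhds (by simp)) fun z hz => ?_
  exact (show ‖z.2‖ < ‖x.2‖ + 1 from hz).le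

/-- The support of `ζ` may reach the faces `x₃ = ±1/2`: a periodic function integrable on the box is
integrable on bounded pieces of the layer up to these faces. -/
lemma LatticePeriodic.integrableOn_mul (hΛ : IsUnit Λ.det) {F ζ : Pt → ℝ}
    (hF : LatticePeriodic Λ F) (hi : IntegrableOn F (box Λ)) (hc : Continuous ζ)
    (hs : HasCompactSupport ζ) : IntegrableOn (fun x => F x * ζ x) strip := by
  obtain ⟨R, hR⟩ := hs.isBounded.exists_norm_le
  obtain ⟨C, hC⟩ := hs.exists_bound_of_continuous hc
  have h1 : IntegrableOn (fun x => F x * ζ x) (strip ∩ {x | ‖x.2‖ ≤ R}) :=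
    (hF.integrableOn_bounded hΛ hi R).mul_bdd (c := C) hc.aestronglyMeasurable
      (Filter.Eventually.of_forall hC)
  refine h1.of_forall_sdiff_eq_zero measurableSet_strip fun x hx => ?_
  by_contra h
  refine hx.2 ⟨hx.1, (norm_snd_le x).trans (hR x (subset_tsupport _ ?_))⟩
  exact right_ne_zero_of_mul h

/-- The integral over the layer of a periodic function against a compactly supported one. -/
lemma LatticePeriodic.setIntegral_strip_mul (hΛ : IsUnit Λ.det) {F ζ : Pt → ℝ}
    (hF : LatticePeriodic Λ F) (hi : IntegrableOn F (box Λ)) (hc : Continuous ζ)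
    (hs : HasCompactSupport ζ) {S : Finset (Fin 2 → ℤ)}
    (hS : ∀ x, latIdx Λ x.2 ∉ S → ζ x = 0) :
    ∫ x in strip, F x * ζ x = ∫ x in box Λ, F x * ∑ k ∈ S, ζ (shift Λ k x) := by
  obtain ⟨C, hC⟩ := hs.exists_bound_of_continuous hc
  have h1 := hF.integrableOn_mul hΛ hi hc hs
  rw [← iUnion_tile (Λ := Λ)] at h1 ⊢
  rw [integral_iUnion (fun k => measurableSet_tile k) pairwise_disjoint_tile h1,
    tsum_eq_sum (s := S)]
  · simp_rw [Finset.mul_sum]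
    rw [integral_finsetSum]
    · refine Finset.sum_congr rfl fun k _ => ?_
      rw [setIntegral_tile hΛ]
      refine integral_congr_ae ?_
      filter_upwards [hF.ae_shift k] with x hx
      rw [hx]
    · intro k _
      exact Integrable.mul_bdd (c := C) hi (hc.comp (continuous_shift k)).aestronglyMeasurable
        (Filter.Eventually.of_forall fun x => hC _)
  · intro k hk
    refine setIntegral_eq_zero_of_forall_eq_zero fun x hx => ?_
    rw [hS x (by rwa [hx.2]), mul_zero]

/-! ### Volume of the cell -/

lemma volume_cell (Λ : Mat2) : volume (cell Λ) = ENNReal.ofReal |Λ.det| := by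
  have h := Measure.addHaar_image_linearMap (volume : Measure (Fin 2 → ℝ)) (Matrix.toLin' Λ)
    (Set.pi univ (fun _ => Ico (-(1 / 2) : ℝ) (1 / 2)))
  have h2 : volume (Set.pi univ (fun _ : Fin 2 => Ico (-(1 / 2) : ℝ) (1 / 2))) = 1 := by
    rw [volume_pi_pi]; norm_num
  rw [h2, mul_one, LinearMap.det_toLin'] at h
  exact h

lemma volume_box (Λ : Mat2) : volume (box Λ) = ENNReal.ofReal |Λ.det| := by
  rw [box, Measure.volume_eq_prod, Measure.prod_prod, volume_cell, Real.volume_Ioo]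
  norm_num

instance : IsFiniteMeasure ((volume : Measure Pt).restrict (box Λ)) :=
  ⟨by rw [Measure.restrict_apply_univ, volume_box]; exact ENNReal.ofReal_lt_top⟩

lemma volume_real_box (Λ : Mat2) : volume.real (box Λ) = |Λ.det| := by
  rw [Measure.real, volume_box, ENNReal.toReal_ofReal (abs_nonneg _)]

lemma isBounded_cell (Λ : Mat2) : ∃ R, ∀ y ∈ cell Λ, ‖y‖ ≤ R := by
  have hc : IsCompact ((fun y : Fin 2 → ℝ => Λ *ᵥ y) '' Metric.closedBall 0 1) :=
    (isCompact_closedBall 0 1).image (continuous_mulVec _)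
  obtain ⟨N, hN⟩ := hc.isBounded.exists_norm_le
  refine ⟨N, ?_⟩
  rintro y ⟨v, hv, rfl⟩
  refine hN _ ⟨v, ?_, rfl⟩
  rw [mem_closedBall_zero_iff, pi_norm_le_iff_of_nonneg zero_le_one]
  intro i
  have := hv i (mem_univ i)
  rw [Real.norm_eq_abs, abs_le]
  constructor <;> linarith [this.1, this.2]

end

section

/-! ### Weak derivatives -/

/-- Local integrability in the open layer gives no control near the faces, so here the support of
`ψ` must lie inside `strip`. -/
lemma integrableOn_strip_mul {g ψ : Pt → ℝ} (hg : LocallyIntegrableOn g strip)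
    (hc : Continuous ψ) (hs : HasCompactSupport ψ) (hss : tsupport ψ ⊆ strip) :
    IntegrableOn (fun x => g x * ψ x) strip := by
  obtain ⟨C, hC⟩ := hs.exists_bound_of_continuous hc
  have h1 : IntegrableOn (fun x => g x * ψ x) (tsupport ψ) :=
    (hg.integrableOn_compact_subset hss hs).mul_bdd (c := C) hc.aestronglyMeasurable
      (Filter.Eventually.of_forall hC)
  refine h1.of_forall_sdiff_eq_zero measurableSet_strip fun x hx => ?_
  rw [image_eq_zero_of_notMem_tsupport hx.2, mul_zero]

lemma tsupport_fderiv_apply_subset (ψ : Pt → ℝ) (v : Pt) :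
    tsupport (fun x => fderiv ℝ ψ x v) ⊆ tsupport ψ := by
  refine closure_minimal (fun x hx => ?_) (isClosed_tsupport ψ)
  refine tsupport_fderiv_subset ℝ (subset_tsupport _ ?_)
  intro h
  exact hx (by simp [h])

lemma hasCompactSupport_fderiv_apply {ψ : Pt → ℝ} (h : HasCompactSupport ψ) (v : Pt) :
    HasCompactSupport (fun x => fderiv ℝ ψ x v) :=
  IsCompact.of_isClosed_subset h (isClosed_tsupport _) (tsupport_fderiv_apply_subset ψ v)

lemma continuous_fderiv_apply_const {ψ : Pt → ℝ} (h : ContDiff ℝ ∞ ψ) (v : Pt) :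
    Continuous (fun x => fderiv ℝ ψ x v) :=
  (h.continuous_fderiv (by simp)).clm_apply continuous_const

variable {v : Pt} {u u' g g' : Pt → ℝ}

/-- The fundamental lemma of the calculus of variations, applied to `g - g'`. It makes the choice in
`weakDeriv` irrelevant up to null sets. -/
lemma HasWeakDeriv.unique (h : HasWeakDeriv v u g) (h' : HasWeakDeriv v u g') :
    g =ᵐ[volume.restrict strip] g' := by
  have key := isOpen_strip.ae_eq_zero_of_integral_contDiff_smul_eq_zero
    (μ := (volume : Measure Pt)) (h.locInt_deriv.sub h'.locInt_deriv) ?_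
  · rw [Filter.EventuallyEq, ae_restrict_iff' measurableSet_strip]
    filter_upwards [key] with x hx hxs
    exact sub_eq_zero.1 (hx hxs)
  · intro ψ hψ hs hss
    rw [← setIntegral_eq_integral_of_forall_compl_eq_zero (s := strip)]
    · have e1 := h.integral_eq ψ hψ hs hss
      have e2 := h'.integral_eq ψ hψ hs hss
      have : ∀ x, ψ x • (g - g') x = g x * ψ x - g' x * ψ x := fun x => by
        simp only [smul_eq_mul, Pi.sub_apply]; ring
      simp_rw [this]
      rw [integral_sub (integrableOn_strip_mul h.locInt_deriv hψ.continuous hs hss)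
        (integrableOn_strip_mul h'.locInt_deriv hψ.continuous hs hss)]
      linarith
    · intro x hx
      rw [image_eq_zero_of_notMem_tsupport fun hx' => hx (hss hx'), zero_smul]

lemma LocallyIntegrableOn.congr_ae_strip (h : LocallyIntegrableOn u strip)
    (he : u =ᵐ[volume.restrict strip] u') : LocallyIntegrableOn u' strip := by
  intro x hx
  obtain ⟨s, hs, hi⟩ := h x hx
  refine ⟨s ∩ strip, Filter.inter_mem hs self_mem_nhdsWithin, ?_⟩
  refine IntegrableOn.congr_fun_ae (hi.mono_set inter_subset_left) ?_
  exact ae_restrict_of_ae_restrict_of_subset inter_subset_right he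

lemma HasWeakDeriv.congr (h : HasWeakDeriv v u g) (hu : u =ᵐ[volume.restrict strip] u')
    (hg : g =ᵐ[volume.restrict strip] g') : HasWeakDeriv v u' g' where
  locInt := LocallyIntegrableOn.congr_ae_strip h.locInt hu
  locInt_deriv := LocallyIntegrableOn.congr_ae_strip h.locInt_deriv hg
  integral_eq ψ hψ hs hss := by
    have e := h.integral_eq ψ hψ hs hss
    rw [integral_congr_ae (g := fun x => u' x * fderiv ℝ ψ x v)
        (by filter_upwards [hu] with x hx; rw [hx]),
      integral_congr_ae (f := fun x => g x * ψ x) (g := fun x => g' x * ψ x)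
        (by filter_upwards [hg] with x hx; rw [hx])] at e
    exact e

lemma HasWeakDeriv.add (h : HasWeakDeriv v u g) (h' : HasWeakDeriv v u' g') :
    HasWeakDeriv v (fun x => u x + u' x) (fun x => g x + g' x) where
  locInt := h.locInt.add h'.locInt
  locInt_deriv := h.locInt_deriv.add h'.locInt_deriv
  integral_eq ψ hψ hs hss := by
    have hd := continuous_fderiv_apply_const hψ v
    have hds := hasCompactSupport_fderiv_apply hs v
    have hdss := (tsupport_fderiv_apply_subset ψ v).trans hss
    simp_rw [add_mul]
    rw [integral_add (integrableOn_strip_mul h.locInt hd hds hdss)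
        (integrableOn_strip_mul h'.locInt hd hds hdss),
      integral_add (integrableOn_strip_mul h.locInt_deriv hψ.continuous hs hss)
        (integrableOn_strip_mul h'.locInt_deriv hψ.continuous hs hss),
      h.integral_eq ψ hψ hs hss, h'.integral_eq ψ hψ hs hss, neg_add]

lemma HasWeakDeriv.const_mul (h : HasWeakDeriv v u g) (c : ℝ) :
    HasWeakDeriv v (fun x => c * u x) (fun x => c * g x) where
  locInt := h.locInt.smul c
  locInt_deriv := h.locInt_deriv.smul c
  integral_eq ψ hψ hs hss := by
    simp_rw [mul_assoc]
    rw [integral_const_mul, integral_const_mul, h.integral_eq ψ hψ hs hss, mul_neg]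

lemma hasWeakDeriv_weakDeriv (h : ∃ g, HasWeakDeriv v u g) :
    HasWeakDeriv v u (weakDeriv v u) := by
  rw [weakDeriv, dif_pos h]; exact h.choose_spec

lemma HasWeakDeriv.weakDeriv_ae_eq (h : HasWeakDeriv v u g) :
    weakDeriv v u =ᵐ[volume.restrict strip] g :=
  (hasWeakDeriv_weakDeriv ⟨g, h⟩).unique h

variable {Λ : Mat2}

lemma LocallyIntegrableOn.comp_shift (h : LocallyIntegrableOn u strip) (k : Fin 2 → ℤ) :
    LocallyIntegrableOn (fun x => u (shift Λ k x)) strip := by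
  intro x hx
  obtain ⟨s, hs, hi⟩ := h (shift Λ k x) (shift_mem_strip.2 hx)
  refine ⟨shift Λ k ⁻¹' s, ?_, ?_⟩
  · have : Filter.Tendsto (shift Λ k) (nhdsWithin x strip)
        (nhdsWithin (shift Λ k x) strip) :=
      (continuous_shift k).continuousWithinAt.tendsto_nhdsWithin
        fun y hy => shift_mem_strip.2 hy
    exact this hs
  · exact ((measurePreserving_shift k).integrableOn_comp_preimage
      (measurableEmbedding_shift k)).2 hi

/-- The translation is moved onto the test function, which stays admissible because lattice
translations preserve the layer. -/
lemma HasWeakDeriv.comp_shift (h : HasWeakDeriv v u g) (k : Fin 2 → ℤ) :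
    HasWeakDeriv v (fun x => u (shift Λ k x)) (fun x => g (shift Λ k x)) where
  locInt := LocallyIntegrableOn.comp_shift h.locInt k
  locInt_deriv := LocallyIntegrableOn.comp_shift h.locInt_deriv k
  integral_eq ψ hψ hs hss := by
    set a : Pt := (0, Λ *ᵥ (fun i => ((-k) i : ℝ))) with ha
    have hsh : ∀ x, shift Λ (-k) x = x + a := fun x => by simp [shift, ha, Prod.ext_iff]
    have hinv : ∀ x, shift Λ (-k) (shift Λ k x) = x := fun x => by
      rw [shift_shift, add_neg_cancel, shift_zero]
    have hcont : ContDiff ℝ ∞ fun x => ψ (x + a) := hψ.comp (contDiff_id.add contDiff_const)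
    have hs' : HasCompactSupport fun x => ψ (x + a) :=
      hs.comp_homeomorph (Homeomorph.addRight a)
    have hss' : tsupport (fun x => ψ (x + a)) ⊆ strip := by
      have := tsupport_comp_eq_preimage ψ (Homeomorph.addRight a)
      intro x hx
      have hx' : x ∈ tsupport (ψ ∘ (Homeomorph.addRight a)) := hx
      rw [this] at hx'
      have h1 : x + a ∈ strip := hss hx'
      rw [← hsh, shift_mem_strip] at h1
      exact h1
    have e := h.integral_eq _ hcont hs' hss'
    have mp := measurePreserving_shift_strip (Λ := Λ) k
    simp only [fderiv_comp_add_right] at e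
    simp only [← hsh] at e
    rw [← mp.integral_comp (measurableEmbedding_shift k)
        (fun x => u x * fderiv ℝ ψ (shift Λ (-k) x) v),
      ← mp.integral_comp (measurableEmbedding_shift k)
        (fun x => g x * ψ (shift Λ (-k) x))] at e
    simpa only [hinv] using e

/-- The translate of `g` is a weak derivative of the translate of `u`, which is `u` a.e.; uniqueness
of weak derivatives concludes. -/
lemma HasWeakDeriv.periodic (h : HasWeakDeriv v u g) (hu : LatticePeriodic Λ u) :
    LatticePeriodic Λ g := fun k =>
  ((h.comp_shift k).congr (hu k) (Filter.EventuallyEq.refl _ _)).unique h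

/-! ### Uniformly locally square integrable periodic functions -/

/-- The cell lies in a closed ball, which by compactness is covered by the bases of finitely many
unit columns. -/
lemma MemUloc.memLp_box (hu : MemUloc u) : MemLp u 2 (volume.restrict (box Λ)) := by
  obtain ⟨hm, K, hK⟩ := hu
  have hmbox : AEStronglyMeasurable u (volume.restrict (box Λ)) :=
    hm.mono_measure (Measure.restrict_mono box_subset_strip le_rfl)
  rw [memLp_two_iff_integrable_sq hmbox]
  obtain ⟨R, hR⟩ := isBounded_cell Λ
  have key : IntegrableOn (fun x => u x ^ 2)
      (Ioo (-(1 / 2) : ℝ) (1 / 2) ×ˢ Metric.closedBall (0 : Fin 2 → ℝ) R) := by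
    refine (isCompact_closedBall (0 : Fin 2 → ℝ) R).induction_on
      (p := fun s => IntegrableOn (fun x => u x ^ 2) (Ioo (-(1 / 2) : ℝ) (1 / 2) ×ˢ s))
      (by simp) (fun s t hst ht => ht.mono_set (prod_mono_right hst)) ?_ ?_
    · intro s t hs ht
      rw [prod_union]; exact hs.union ht
    · intro z _
      refine ⟨Set.pi univ (fun i => Ioo (z i - 1 / 2) (z i + 1 / 2)), ?_, ?_⟩
      · refine mem_nhdsWithin_of_mem_nhds (set_pi_mem_nhds finite_univ fun i _ => ?_)
        exact Ioo_mem_nhds (by linarith) (by linarith)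
      · have hm' : AEStronglyMeasurable u (volume.restrict (Ioo (-(1 / 2) : ℝ) (1 / 2) ×ˢ
            Set.pi univ (fun i => Ioo (z i - 1 / 2) (z i + 1 / 2)))) :=
          hm.mono_measure (Measure.restrict_mono (prod_mono_right (subset_univ _)) le_rfl)
        exact (memLp_two_iff_integrable_sq hm').1
          ⟨hm', (hK z).trans_lt ENNReal.coe_lt_top⟩
  refine key.mono_set (prod_mono_right fun y hy => ?_)
  simpa using hR y hy

lemma LatticePeriodic.aestronglyMeasurable_strip (hΛ : IsUnit Λ.det) (hu : LatticePeriodic Λ u)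
    (hm : AEStronglyMeasurable u (volume.restrict (box Λ))) :
    AEStronglyMeasurable u (volume.restrict strip) := by
  rw [← iUnion_tile (Λ := Λ), aestronglyMeasurable_iUnion_iff]
  intro k
  rw [← (measurePreserving_shift_tile hΛ k).aestronglyMeasurable_comp_iff
    (measurableEmbedding_shift k)]
  refine hm.congr ?_
  filter_upwards [hu.ae_shift k] with x hx using hx.symm

/-- Every unit column is a lattice translate of one centred at a point `w` of the cell. Such columns
lie within distance `1` of the cell, so the norm over one bounded region serves as the common
constant. -/
lemma LatticePeriodic.memUloc (hΛ : IsUnit Λ.det) (hu : LatticePeriodic Λ u)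
    (hL : MemLp u 2 (volume.restrict (box Λ))) : MemUloc u := by
  have hm := hu.aestronglyMeasurable_strip hΛ hL.1
  refine ⟨hm, ?_⟩
  obtain ⟨R, hR⟩ := isBounded_cell Λ
  have hsq : LatticePeriodic Λ fun x => u x ^ 2 := fun k => by
    filter_upwards [hu k] with x hx
    exact congrArg (· ^ 2) hx
  have hi := hsq.integrableOn_bounded hΛ ((memLp_two_iff_integrable_sq hL.1).1 hL) (R + 1)
  have hm' : AEStronglyMeasurable u (volume.restrict (strip ∩ {x : Pt | ‖x.2‖ ≤ R + 1})) :=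
    hm.mono_measure (Measure.restrict_mono inter_subset_left le_rfl)
  have hL' := (memLp_two_iff_integrable_sq hm').2 hi
  refine ⟨(eLpNorm u 2 (volume.restrict (strip ∩ {x : Pt | ‖x.2‖ ≤ R + 1}))).toNNReal,
    fun z => ?_⟩
  rw [ENNReal.coe_toNNReal hL'.2.ne]
  set k := latIdx Λ z
  set w : Fin 2 → ℝ := z + Λ *ᵥ (fun i => ((-k) i : ℝ))
  have hw : ‖w‖ ≤ R := by
    refine hR _ ((latIdx_eq_zero_iff hΛ).1 ?_)
    rw [latIdx_add hΛ]; simp [k]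
  set colz : Set Pt := Ioo (-(1 / 2) : ℝ) (1 / 2) ×ˢ
    Set.pi univ (fun i => Ioo (z i - 1 / 2) (z i + 1 / 2))
  set colw : Set Pt := Ioo (-(1 / 2) : ℝ) (1 / 2) ×ˢ
    Set.pi univ (fun i => Ioo (w i - 1 / 2) (w i + 1 / 2))
  have hmcol : MeasurableSet colz :=
    measurableSet_Ioo.prod (MeasurableSet.univ_pi fun _ => measurableSet_Ioo)
  have hzw : z = w + Λ *ᵥ (fun i => (k i : ℝ)) := by
    have : (fun i => ((-k) i : ℝ)) = -(fun i => (k i : ℝ)) := by ext i; simp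
    simp only [w, this, Matrix.mulVec_neg]; abel
  have hpre : shift Λ k ⁻¹' colz = colw := by
    ext x
    simp only [colz, colw, mem_preimage, mem_prod, shift, mem_pi, mem_univ, true_implies, mem_Ioo]
    rw [hzw]
    refine and_congr Iff.rfl (forall_congr' fun i => ?_)
    simp only [Pi.add_apply]
    constructor <;> rintro ⟨h1, h2⟩ <;> constructor <;> linarith
  have mp := (measurePreserving_shift (Λ := Λ) k).restrict_preimage hmcol
  rw [hpre] at mp
  have hcolw : colw ⊆ strip := prod_mono_right (subset_univ _)
  have e1 : eLpNorm u 2 (volume.restrict colz) =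
      eLpNorm (u ∘ shift Λ k) 2 (volume.restrict colw) := by
    refine (eLpNorm_comp_measurePreserving (hm.mono_measure ?_) mp).symm
    exact Measure.restrict_mono (prod_mono_right (subset_univ _)) le_rfl
  have e2 : u ∘ shift Λ k =ᵐ[volume.restrict colw] u :=
    ae_restrict_of_ae_restrict_of_subset hcolw (hu k)
  rw [e1, eLpNorm_congr_ae e2]
  have hsub : colw ⊆ strip ∩ {x : Pt | ‖x.2‖ ≤ R + 1} := fun x hx => ⟨hcolw hx, ?_⟩
  · exact eLpNorm_mono_measure _ (Measure.restrict_mono hsub le_rfl)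
  have h2 : ‖x.2 - w‖ ≤ 1 := by
    rw [pi_norm_le_iff_of_nonneg zero_le_one]
    intro i
    have := hx.2 i (mem_univ i)
    rw [Pi.sub_apply, Real.norm_eq_abs, abs_le]
    constructor <;> linarith [this.1, this.2]
  calc ‖x.2‖ = ‖w + (x.2 - w)‖ := by rw [add_sub_cancel]
    _ ≤ ‖w‖ + ‖x.2 - w‖ := norm_add_le _ _
    _ ≤ R + 1 := add_le_add hw h2

/-! ### The space of periodic `H¹` functions -/

variable {φ φ' : Pt → Fin 3 → ℝ}

lemma LatticePeriodic.comp {E F : Type*} {w : Pt → E} (hw : LatticePeriodic Λ w) (f : E → F) :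
    LatticePeriodic Λ (fun x => f (w x)) := fun k => by
  filter_upwards [hw k] with x hx
  exact congrArg f hx

lemma LatticePeriodic.comp₂ {E F G : Type*} {w : Pt → E} {z : Pt → F}
    (hw : LatticePeriodic Λ w) (hz : LatticePeriodic Λ z) (f : E → F → G) :
    LatticePeriodic Λ (fun x => f (w x) (z x)) := fun k => by
  filter_upwards [hw k, hz k] with x hx hx'
  exact congrArg₂ f hx hx'

lemma latticePeriodic_pi {ι E : Type*} [Countable ι] {w : Pt → ι → E}
    (h : ∀ i, LatticePeriodic Λ (fun x => w x i)) : LatticePeriodic Λ w := fun k => by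
  filter_upwards [ae_all_iff.2 fun i => h i k] with x hx
  exact funext hx

lemma H1per.periodic (h : φ ∈ H1per Λ) (i : Fin 3) : LatticePeriodic Λ (fun x => φ x i) :=
  LatticePeriodic.comp h.1 (fun w => w i)

lemma H1per.memLp (h : φ ∈ H1per Λ) (i : Fin 3) :
    MemLp (fun x => φ x i) 2 (volume.restrict (box Λ)) := (h.2 i).1.memLp_box

lemma H1per.hasWeakDeriv (h : φ ∈ H1per Λ) (i j : Fin 3) :
    HasWeakDeriv (dir j) (fun x => φ x i) (weakDeriv (dir j) (fun x => φ x i)) := by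
  obtain ⟨g, _, hg⟩ := (h.2 i).2 j
  exact hasWeakDeriv_weakDeriv ⟨g, hg⟩

lemma H1per.periodic_weakDeriv (h : φ ∈ H1per Λ) (i j : Fin 3) :
    LatticePeriodic Λ (weakDeriv (dir j) (fun x => φ x i)) :=
  (H1per.hasWeakDeriv h i j).periodic (H1per.periodic h i)

lemma H1per.memLp_weakDeriv (h : φ ∈ H1per Λ) (i j : Fin 3) :
    MemLp (weakDeriv (dir j) (fun x => φ x i)) 2 (volume.restrict (box Λ)) := by
  obtain ⟨g, hg, hgd⟩ := (h.2 i).2 j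
  exact hg.memLp_box.ae_eq (ae_restrict_of_ae_restrict_of_subset box_subset_strip
    hgd.weakDeriv_ae_eq.symm)

/-- The uniform local bounds reduce to square integrability on the box. Periodicity of `g` is
inherited from `φ`. -/
lemma mem_H1per (hΛ : IsUnit Λ.det) {φ : Pt → Fin 3 → ℝ} {g : Fin 3 → Fin 3 → Pt → ℝ}
    (hφ : ∀ i, LatticePeriodic Λ (fun x => φ x i))
    (hL : ∀ i, MemLp (fun x => φ x i) 2 (volume.restrict (box Λ)))
    (hgL : ∀ i j, MemLp (g i j) 2 (volume.restrict (box Λ)))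
    (hg : ∀ i j, HasWeakDeriv (dir j) (fun x => φ x i) (g i j)) : φ ∈ H1per Λ :=
  ⟨latticePeriodic_pi hφ, fun i => ⟨(hφ i).memUloc hΛ (hL i), fun j =>
    ⟨g i j, ((hg i j).periodic (hφ i)).memUloc hΛ (hgL i j), hg i j⟩⟩⟩

lemma H1per.add_mem (hΛ : IsUnit Λ.det) (h : φ ∈ H1per Λ) (h' : φ' ∈ H1per Λ) :
    φ + φ' ∈ H1per Λ :=
  mem_H1per hΛ (fun i => (H1per.periodic h i).comp₂ (H1per.periodic h' i) (· + ·))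
    (fun i => (H1per.memLp h i).add (H1per.memLp h' i))
    (fun i j => (H1per.memLp_weakDeriv h i j).add (H1per.memLp_weakDeriv h' i j))
    (fun i j => (H1per.hasWeakDeriv h i j).add (H1per.hasWeakDeriv h' i j))

lemma H1per.smul_mem (hΛ : IsUnit Λ.det) (c : ℝ) (h : φ ∈ H1per Λ) : c • φ ∈ H1per Λ :=
  mem_H1per hΛ (fun i => (H1per.periodic h i).comp (c * ·))
    (fun i => (H1per.memLp h i).const_mul c)
    (fun i j => (H1per.memLp_weakDeriv h i j).const_mul c)
    (fun i j => (H1per.hasWeakDeriv h i j).const_mul c)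

lemma hasWeakDeriv_zero : HasWeakDeriv v (fun _ => 0) (fun _ => 0) where
  locInt := locallyIntegrableOn_zero
  locInt_deriv := locallyIntegrableOn_zero
  integral_eq ψ _ _ _ := by simp

lemma zero_mem_H1per (hΛ : IsUnit Λ.det) : (0 : Pt → Fin 3 → ℝ) ∈ H1per Λ :=
  mem_H1per hΛ (g := fun _ _ _ => 0)
    (fun _ => fun _ => Filter.Eventually.of_forall fun _ => rfl)
    (fun _ => MemLp.zero) (fun _ _ => MemLp.zero) (fun _ _ => hasWeakDeriv_zero)

/-- `scaledGrad` is built from chosen representatives. Any explicit weak derivatives compute it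
a.e., and linearity in `φ` is obtained this way. -/
lemma scaledGrad_ae_eq {γ : ℝ} {g : Fin 3 → Fin 3 → Pt → ℝ}
    (hg : ∀ i j, HasWeakDeriv (dir j) (fun x => φ x i) (g i j)) :
    scaledGrad γ φ =ᵐ[volume.restrict strip]
      fun x => Matrix.of fun i j => (if j = 2 then 1 / γ else 1) * g i j x := by
  have : ∀ᵐ x ∂(volume.restrict strip), ∀ i j,
      weakDeriv (dir j) (fun x => φ x i) x = g i j x :=
    ae_all_iff.2 fun i => ae_all_iff.2 fun j => (hg i j).weakDeriv_ae_eq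
  filter_upwards [this] with x hx
  ext i j
  simp only [scaledGrad, Matrix.of_apply, hx i j]

lemma scaledGrad_add {γ : ℝ} (h : φ ∈ H1per Λ) (h' : φ' ∈ H1per Λ) :
    scaledGrad γ (φ + φ') =ᵐ[volume.restrict strip]
      fun x => scaledGrad γ φ x + scaledGrad γ φ' x := by
  filter_upwards [scaledGrad_ae_eq (γ := γ) (φ := φ + φ')
    fun i j => (H1per.hasWeakDeriv h i j).add (H1per.hasWeakDeriv h' i j)] with x hx
  rw [hx]; ext i j
  simp only [scaledGrad, Matrix.of_apply, Matrix.add_apply, mul_add]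

lemma scaledGrad_smul {γ : ℝ} (c : ℝ) (h : φ ∈ H1per Λ) :
    scaledGrad γ (c • φ) =ᵐ[volume.restrict strip] fun x => c • scaledGrad γ φ x := by
  filter_upwards [scaledGrad_ae_eq (γ := γ) (φ := c • φ)
    fun i j => (H1per.hasWeakDeriv h i j).const_mul c] with x hx
  rw [hx]; ext i j
  simp only [scaledGrad, Matrix.of_apply, Matrix.smul_apply, smul_eq_mul]
  ring

lemma scaledGrad_zero {γ : ℝ} :
    scaledGrad γ (0 : Pt → Fin 3 → ℝ) =ᵐ[volume.restrict strip] fun _ => 0 := by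
  filter_upwards [scaledGrad_ae_eq (γ := γ) (φ := 0) (g := fun _ _ _ => 0)
    fun _ _ => hasWeakDeriv_zero] with x hx
  rw [hx]; ext i j; simp

lemma H1per.memLp_scaledGrad {γ : ℝ} (h : φ ∈ H1per Λ) (i j : Fin 3) :
    MemLp (fun x => scaledGrad γ φ x i j) 2 (volume.restrict (box Λ)) :=
  (H1per.memLp_weakDeriv h i j).const_mul _

end

section

/-! ### Weakly differentiable functions of one variable -/

/-- The interval `(-1/2, 1/2)`. -/
def thick : Set ℝ := Ioo (-(1 / 2) : ℝ) (1 / 2)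

/-- `u` is absolutely continuous on `[-1/2, 1/2]` with derivative `g`. -/
structure AbsContDeriv (u g : ℝ → ℝ) : Prop where
  ac : AbsolutelyContinuousOnInterval u (-(1 / 2)) (1 / 2)
  deriv_ae : ∀ᵐ t ∂(volume.restrict thick), HasDerivAt u (g t) t

lemma measurableSet_thick : MeasurableSet thick := measurableSet_Ioo

instance : IsFiniteMeasure ((volume : Measure ℝ).restrict thick) :=
  ⟨by rw [Measure.restrict_apply_univ, thick, Real.volume_Ioo]; exact ENNReal.ofReal_lt_top⟩

lemma volume_real_thick : (volume : Measure ℝ).real thick = 1 := by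
  rw [Measure.real, thick, Real.volume_Ioo]; norm_num

lemma setIntegral_thick (f : ℝ → ℝ) :
    ∫ t in thick, f t = ∫ t in (-(1 / 2) : ℝ)..(1 / 2), f t := by
  rw [intervalIntegral.integral_of_le (by norm_num), integral_Ioc_eq_integral_Ioo]; rfl

lemma integrableOn_thick_iff {f : ℝ → ℝ} :
    IntegrableOn f thick ↔ IntervalIntegrable f volume (-(1 / 2)) (1 / 2) := by
  rw [intervalIntegrable_iff_integrableOn_Ioo_of_le (by norm_num)]; rfl

lemma ae_thick_of_ae_uIcc {p : ℝ → Prop}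
    (h : ∀ᵐ t, t ∈ uIcc (-(1 / 2) : ℝ) (1 / 2) → p t) : ∀ᵐ t ∂(volume.restrict thick), p t := by
  rw [ae_restrict_iff' measurableSet_thick]
  filter_upwards [h] with t ht hts
  refine ht ?_
  rw [uIcc_of_le (by norm_num)]
  exact Ioo_subset_Icc_self hts

namespace AbsContDeriv

variable {u u' g g' : ℝ → ℝ}

lemma of_hasDerivAt (hu : ContDiff ℝ 1 u) (hg : ∀ t, HasDerivAt u (g t) t) : AbsContDeriv u g where
  ac := hu.contDiffOn.absolutelyContinuousOnInterval
  deriv_ae := Filter.Eventually.of_forall hg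

lemma const (c : ℝ) : AbsContDeriv (fun _ => c) (fun _ => 0) :=
  of_hasDerivAt contDiff_const fun t => hasDerivAt_const t c

lemma id : AbsContDeriv (fun t => t) (fun _ => 1) :=
  of_hasDerivAt contDiff_id fun t => hasDerivAt_id t

lemma add (h : AbsContDeriv u g) (h' : AbsContDeriv u' g') :
    AbsContDeriv (fun t => u t + u' t) (fun t => g t + g' t) where
  ac := h.ac.add h'.ac
  deriv_ae := by
    filter_upwards [h.deriv_ae, h'.deriv_ae] with t h1 h2 using h1.add h2

lemma mul (h : AbsContDeriv u g) (h' : AbsContDeriv u' g') :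
    AbsContDeriv (fun t => u t * u' t) (fun t => g t * u' t + u t * g' t) where
  ac := h.ac.mul h'.ac
  deriv_ae := by
    filter_upwards [h.deriv_ae, h'.deriv_ae] with t h1 h2 using h1.mul h2

lemma const_mul (h : AbsContDeriv u g) (c : ℝ) :
    AbsContDeriv (fun t => c * u t) (fun t => c * g t) where
  ac := h.ac.const_mul c
  deriv_ae := by
    filter_upwards [h.deriv_ae] with t h1 using h1.const_mul c

lemma integral_eq_sub (h : AbsContDeriv u g) :
    ∫ t in thick, g t = u (1 / 2) - u (-(1 / 2)) := by
  rw [← h.ac.integral_deriv_eq_sub, ← setIntegral_thick]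
  refine integral_congr_ae ?_
  filter_upwards [h.deriv_ae] with t ht using ht.deriv.symm

lemma memLp (h : AbsContDeriv u g) : MemLp u 2 (volume.restrict thick) := by
  have hc := h.ac.continuousOn
  rw [uIcc_of_le (by norm_num)] at hc
  have hm : AEStronglyMeasurable u (volume.restrict thick) :=
    (hc.mono Ioo_subset_Icc_self).aestronglyMeasurable measurableSet_Ioo
  obtain ⟨C, hC⟩ := isCompact_Icc.exists_bound_of_continuousOn hc
  refine MemLp.of_bound hm C ?_
  filter_upwards [ae_restrict_mem measurableSet_thick] with t ht
  exact hC t (Ioo_subset_Icc_self ht)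

end AbsContDeriv

lemma absContDeriv_primitive {g : ℝ → ℝ} (hg : IntegrableOn g thick) :
    AbsContDeriv (fun t => ∫ s in (-(1 / 2) : ℝ)..t, g s) g where
  ac := (integrableOn_thick_iff.1 hg).absolutelyContinuousOnInterval_intervalIntegral (by simp)
  deriv_ae := by
    refine ae_thick_of_ae_uIcc ?_
    filter_upwards [(integrableOn_thick_iff.1 hg).ae_hasDerivAt_integral] with t ht hts
    exact ht hts _ (by simp)

/-- Admissible one-dimensional test functions. -/
structure IsTest (θ : ℝ → ℝ) : Prop where
  contDiff : ContDiff ℝ ∞ θ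
  compact : HasCompactSupport θ
  supp : tsupport θ ⊆ thick

lemma IsTest.absContDeriv {θ : ℝ → ℝ} (h : IsTest θ) : AbsContDeriv θ (deriv θ) :=
  .of_hasDerivAt (h.contDiff.of_le (by simp)) fun t =>
    (h.contDiff.differentiable (by simp) t).hasDerivAt

lemma IsTest.integrableOn_mul {u θ : ℝ → ℝ} (hu : IntegrableOn u thick) (hθ : Continuous θ)
    (hs : HasCompactSupport θ) : IntegrableOn (fun t => u t * θ t) thick := by
  obtain ⟨C, hC⟩ := hs.exists_bound_of_continuous hθ
  exact Integrable.mul_bdd (c := C) hu hθ.aestronglyMeasurable (Filter.Eventually.of_forall hC)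

lemma IsTest.deriv_continuous {θ : ℝ → ℝ} (h : IsTest θ) : Continuous (deriv θ) :=
  h.contDiff.continuous_deriv (by simp)

lemma IsTest.zero_of_notMem {θ : ℝ → ℝ} (h : IsTest θ) {t : ℝ} (ht : t ∉ thick) : θ t = 0 :=
  image_eq_zero_of_notMem_tsupport fun h' => ht (h.supp h')

/-- A smooth function supported in the interval with vanishing integral has a test function as a
primitive. -/
lemma IsTest.exists_primitive {θ : ℝ → ℝ} (h : IsTest θ) (h0 : ∫ t in thick, θ t = 0) :
    ∃ Θ, IsTest Θ ∧ deriv Θ = θ := by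
  set Θ : ℝ → ℝ := fun t => ∫ s in (-(1 / 2) : ℝ)..t, θ s with hΘ
  have hd : ∀ t, HasDerivAt Θ (θ t) t := fun t =>
    intervalIntegral.integral_hasDerivAt_right
      (h.contDiff.continuous.intervalIntegrable _ _)
      h.contDiff.continuous.stronglyMeasurable.stronglyMeasurableAtFilter
      h.contDiff.continuous.continuousAt
  have hderiv : deriv Θ = θ := funext fun t => (hd t).deriv
  have hsm : ContDiff ℝ ∞ Θ := by
    rw [contDiff_infty_iff_deriv]
    exact ⟨fun t => (hd t).differentiableAt, by rw [hderiv]; exact h.contDiff⟩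
  obtain ⟨a, b, hab, hsub⟩ : ∃ a b : ℝ, Icc a b ⊆ thick ∧ tsupport θ ⊆ Icc a b := by
    by_cases hne : (tsupport θ).Nonempty
    · obtain ⟨a, ha, ha'⟩ := h.compact.exists_isLeast hne
      obtain ⟨b, hb, hb'⟩ := h.compact.exists_isGreatest hne
      exact ⟨a, b, fun t ht => ⟨(h.supp ha).1.trans_le ht.1, ht.2.trans_lt (h.supp hb).2⟩,
        fun t ht => ⟨ha' ht, hb' ht⟩⟩
    -- For empty support, the empty interval `Icc 1 0` is the enclosing one.
    · rw [not_nonempty_iff_eq_empty] at hne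
      exact ⟨1, 0, by simp, by simp [hne]⟩
  have hzero : ∀ t, t ∉ Icc a b → Θ t = 0 := by
    intro t ht
    have hθ0 : ∀ s, s ∉ Icc a b → θ s = 0 := fun s hs =>
      image_eq_zero_of_notMem_tsupport fun h' => hs (hsub h')
    have hr : (1 / 2 : ℝ) ∉ Icc a b := fun h' => lt_irrefl _ (hab h').2
    have hl : (-(1 / 2) : ℝ) ∉ Icc a b := fun h' => lt_irrefl _ (hab h').1
    have htot : Θ (1 / 2) = 0 := by rw [hΘ]; simp only; rw [← setIntegral_thick, h0]
    by_cases hta : t < a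
    · have : ∀ s ∈ uIcc (-(1 / 2)) t, θ s = 0 := by
        intro s hs
        refine hθ0 s fun hs' => ?_
        rcases le_total (-(1 / 2)) t with hle | hle
        · rw [uIcc_of_le hle] at hs; linarith [hs.2, hs'.1]
        · rw [uIcc_of_ge hle] at hs
          exact hl ⟨hs'.1.trans hs.2, (hab hs').1.le.trans hs'.2⟩
      rw [hΘ]; simp only
      rw [intervalIntegral.integral_congr (g := fun _ => 0) this]; simp
    · have htb : b < t := by
        by_contra hcon
        exact ht ⟨not_lt.1 hta, not_lt.1 hcon⟩
      -- To the right of the support `Θ` keeps its value at `1/2`, which is the total integral of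
      -- `θ` and hence zero.
      have h2 : Θ t = Θ (1 / 2) + ∫ s in (1 / 2 : ℝ)..t, θ s :=
        (intervalIntegral.integral_add_adjacent_intervals
          (h.contDiff.continuous.intervalIntegrable _ _)
          (h.contDiff.continuous.intervalIntegrable _ _)).symm
      have : ∀ s ∈ uIcc (1 / 2) t, θ s = 0 := by
        intro s hs
        refine hθ0 s fun hs' => ?_
        rcases le_total (1 / 2) t with hle | hle
        · rw [uIcc_of_le hle] at hs; exact absurd (hab hs').2 (not_lt.2 hs.1)
        · rw [uIcc_of_ge hle] at hs; linarith [hs.1, hs'.2]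
      rw [h2, htot, intervalIntegral.integral_congr (g := fun _ => 0) this]; simp
  have hts : tsupport Θ ⊆ Icc a b :=
    closure_minimal (fun t ht => by by_contra h'; exact ht (hzero t h')) isClosed_Icc
  exact ⟨Θ, ⟨hsm, isCompact_Icc.of_isClosed_subset (isClosed_tsupport _) hts, hts.trans hab⟩,
    hderiv⟩

lemma exists_isTest_integral_eq_one : ∃ θ, IsTest θ ∧ ∫ t in thick, θ t = 1 := by
  let f : ContDiffBump (0 : ℝ) := ⟨1 / 8, 1 / 4, by norm_num, by norm_num⟩
  have hsub : tsupport (f.normed volume) ⊆ thick := by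
    rw [f.tsupport_normed_eq]
    intro t ht
    rw [Metric.mem_closedBall, Real.dist_eq, sub_zero, abs_le] at ht
    have : f.rOut = 1 / 4 := rfl
    rw [this] at ht
    constructor <;> linarith [ht.1, ht.2]
  refine ⟨f.normed volume, ⟨f.contDiff_normed, f.hasCompactSupport_normed, hsub⟩, ?_⟩
  rw [setIntegral_eq_integral_of_forall_compl_eq_zero, f.integral_normed]
  intro t ht
  exact image_eq_zero_of_notMem_tsupport fun h' => ht (hsub h')

lemma ae_eq_zero_of_isTest {u : ℝ → ℝ} (hu : IntegrableOn u thick)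
    (h : ∀ θ, IsTest θ → ∫ t in thick, u t * θ t = 0) : ∀ᵐ t ∂(volume.restrict thick), u t = 0 := by
  have key := (isOpen_Ioo : IsOpen thick).ae_eq_zero_of_integral_contDiff_smul_eq_zero
    (μ := (volume : Measure ℝ)) hu.locallyIntegrableOn ?_
  · rwa [ae_restrict_iff' measurableSet_thick]
  · intro ψ hψ hs hss
    rw [← setIntegral_eq_integral_of_forall_compl_eq_zero (s := thick)]
    · simp_rw [smul_eq_mul, mul_comm (ψ _)]
      exact h ψ ⟨hψ, hs, hss⟩
    · intro x hx
      rw [image_eq_zero_of_notMem_tsupport fun hx' => hx (hss hx'), zero_smul]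

/-- A function with vanishing weak derivative is constant. -/
lemma exists_ae_eq_const {u : ℝ → ℝ} (hu : IntegrableOn u thick)
    (h : ∀ θ, IsTest θ → ∫ t in thick, u t * deriv θ t = 0) :
    ∃ c, ∀ᵐ t ∂(volume.restrict thick), u t = c := by
  obtain ⟨θ₀, hθ₀, h1⟩ := exists_isTest_integral_eq_one
  refine ⟨∫ t in thick, u t * θ₀ t, ?_⟩
  set c := ∫ t in thick, u t * θ₀ t with hc
  have := ae_eq_zero_of_isTest (u := fun t => u t - c) (hu.sub (integrable_const c)) ?_
  · filter_upwards [this] with t ht using sub_eq_zero.1 ht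
  intro ψ hψ
  set m := ∫ t in thick, ψ t with hm
  have hψi : IntegrableOn ψ thick := by
    simpa using IsTest.integrableOn_mul (integrable_const (1 : ℝ)) hψ.contDiff.continuous hψ.compact
  have hθi : IntegrableOn θ₀ thick := by
    simpa using
      IsTest.integrableOn_mul (integrable_const (1 : ℝ)) hθ₀.contDiff.continuous hθ₀.compact
  -- Subtracting `m θ₀` makes the integral vanish, so this function is the derivative of a test
  -- function and `u` annihilates it. Hence `∫ u ψ = c ∫ ψ`.
  have hη : IsTest fun t => ψ t - m * θ₀ t := by
    have hsub : tsupport (fun t => ψ t - m * θ₀ t) ⊆ tsupport ψ ∪ tsupport θ₀ := by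
      refine closure_minimal (fun t ht => ?_) ((isClosed_tsupport _).union (isClosed_tsupport _))
      by_contra hcon
      rw [mem_union, not_or] at hcon
      refine ht ?_
      simp [image_eq_zero_of_notMem_tsupport hcon.1, image_eq_zero_of_notMem_tsupport hcon.2]
    exact ⟨hψ.contDiff.sub (contDiff_const.mul hθ₀.contDiff),
      (hψ.compact.isCompact.union hθ₀.compact.isCompact).of_isClosed_subset (isClosed_tsupport _)
        hsub, hsub.trans (union_subset hψ.supp hθ₀.supp)⟩
  have h0 : ∫ t in thick, (ψ t - m * θ₀ t) = 0 := by
    rw [integral_sub hψi (hθi.const_mul m), integral_const_mul, h1]; simp [hm]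
  obtain ⟨Θ, hΘ, hd⟩ := hη.exists_primitive h0
  have e := h Θ hΘ
  rw [hd] at e
  have i1 := IsTest.integrableOn_mul hu hψ.contDiff.continuous hψ.compact
  have i2 := IsTest.integrableOn_mul hu hθ₀.contDiff.continuous hθ₀.compact
  have e2 : ∫ t in thick, u t * (ψ t - m * θ₀ t) = (∫ t in thick, u t * ψ t) - m * c := by
    rw [hc, ← integral_const_mul, ← integral_sub i1 (i2.const_mul m)]
    congr 1; ext t; ring
  have e3 : ∫ t in thick, (u t - c) * ψ t = (∫ t in thick, u t * ψ t) - c * m := by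
    rw [hm, ← integral_const_mul, ← integral_sub i1 (hψi.const_mul c)]
    congr 1; ext t; ring
  rw [e3]; rw [e2] at e; linarith

/-- A weakly differentiable function of one variable has an absolutely continuous
representative. -/
lemma exists_absContDeriv {u g : ℝ → ℝ} (hu : IntegrableOn u thick) (hg : IntegrableOn g thick)
    (h : ∀ θ, IsTest θ → ∫ t in thick, u t * deriv θ t = -∫ t in thick, g t * θ t) :
    ∃ w, AbsContDeriv w g ∧ u =ᵐ[volume.restrict thick] w := by
  have hU := absContDeriv_primitive hg
  set U : ℝ → ℝ := fun t => ∫ s in (-(1 / 2) : ℝ)..t, g s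
  have hUi : IntegrableOn U thick := hU.memLp.integrable (by norm_num)
  -- The product rule for `U θ` shows that `U` has weak derivative `g`; thus `u - U` has weak
  -- derivative zero and is constant.
  have hz : ∀ θ, IsTest θ → ∫ t in thick, (u t - U t) * deriv θ t = 0 := by
    intro θ hθ
    have hds : HasCompactSupport (deriv θ) := hθ.compact.deriv
    have e := (hU.mul hθ.absContDeriv).integral_eq_sub
    rw [hθ.zero_of_notMem (t := 1 / 2) (by simp [thick]),
      hθ.zero_of_notMem (t := -(1 / 2)) (by simp [thick]), integral_add
        (IsTest.integrableOn_mul hg hθ.contDiff.continuous hθ.compact)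
        (IsTest.integrableOn_mul hUi hθ.deriv_continuous hds)] at e
    simp_rw [sub_mul]
    rw [integral_sub (IsTest.integrableOn_mul hu hθ.deriv_continuous hds)
      (IsTest.integrableOn_mul hUi hθ.deriv_continuous hds), h θ hθ]
    linarith
  obtain ⟨c, hc⟩ := exists_ae_eq_const (u := fun t => u t - U t) (hu.sub hUi) hz
  refine ⟨fun t => U t + c, ?_, ?_⟩
  · simpa using hU.add (AbsContDeriv.const c)
  · filter_upwards [hc] with t ht
    exact eq_add_of_sub_eq' ht

/-- Nonnegativity of the left side stands in for the Cauchy–Schwarz inequality. For `f` of mean zero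
the formula shows that subtracting a constant cannot lower the `L²` norm. -/
lemma integral_sub_const_sq {X : Type*} [MeasurableSpace X] {μ : Measure X} [IsFiniteMeasure μ]
    {f : X → ℝ} (hf : MemLp f 2 μ) (m : ℝ) :
    ∫ x, (f x - m) ^ 2 ∂μ = (∫ x, f x ^ 2 ∂μ) - 2 * m * (∫ x, f x ∂μ) + m ^ 2 * μ.real univ := by
  have i1 : Integrable (fun x => 2 * m * f x) μ := (hf.integrable (by norm_num)).const_mul _
  have i2 : Integrable (fun x => f x ^ 2 - 2 * m * f x) μ := hf.integrable_sq.sub i1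
  have : ∀ x, (f x - m) ^ 2 = f x ^ 2 - 2 * m * f x + m ^ 2 := fun x => by ring
  simp_rw [this]
  rw [integral_add i2 (integrable_const _), integral_sub hf.integrable_sq i1,
    integral_const_mul, integral_const, smul_eq_mul, mul_comm (μ.real univ)]

/-- One-dimensional Poincaré inequality. -/
lemma AbsContDeriv.integral_sq_le {u g : ℝ → ℝ} (h : AbsContDeriv u g)
    (hg : MemLp g 2 (volume.restrict thick)) (h0 : ∫ t in thick, u t = 0) :
    ∫ t in thick, u t ^ 2 ≤ ∫ t in thick, g t ^ 2 := by
  have hgi : IntegrableOn g thick := hg.integrable (by norm_num)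
  have hg2 : IntegrableOn (fun t => g t ^ 2) thick := hg.integrable_sq
  have hui : IntegrableOn u thick := h.memLp.integrable (by norm_num)
  have hu2 : IntegrableOn (fun t => u t ^ 2) thick := h.memLp.integrable_sq
  set a := u (-(1 / 2))
  have hpt : ∀ t ∈ thick, (u t - a) ^ 2 ≤ ∫ s in thick, g s ^ 2 := by
    intro t ht
    have hsub : Ioo (-(1 / 2)) t ⊆ thick := Ioo_subset_Ioo_right ht.2.le
    have e : ∫ s in Ioo (-(1 / 2)) t, g s = u t - a := by
      have hle : (-(1 / 2) : ℝ) ≤ t := ht.1.le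
      have := (h.ac.mono (c := -(1 / 2)) (d := t) ?_).integral_deriv_eq_sub
      · rw [← this, intervalIntegral.integral_of_le hle, integral_Ioc_eq_integral_Ioo]
        refine integral_congr_ae ?_
        filter_upwards [ae_restrict_of_ae_restrict_of_subset hsub h.deriv_ae] with s hs
        exact hs.deriv.symm
      · rw [uIcc_of_le hle, uIcc_of_le (by norm_num)]
        exact Icc_subset_Icc_right ht.2.le
    set m := u t - a
    -- Here `m` is the integral of `g` over an interval of length `ℓ ≤ 1`. Expanding the square
    -- gives `m² (2 - ℓ) ≤ ∫ g²`, hence `m² ≤ ∫ g²`.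
    have hnn : 0 ≤ ∫ s in Ioo (-(1 / 2)) t, (g s - m) ^ 2 :=
      integral_nonneg fun s => sq_nonneg _
    have e2 := integral_sub_const_sq (hg.mono_measure (Measure.restrict_mono hsub le_rfl)) m
    rw [e, measureReal_restrict_apply_univ, Measure.real, Real.volume_Ioo,
      ENNReal.toReal_ofReal (by linarith [ht.1])] at e2
    have hmono : ∫ s in Ioo (-(1 / 2)) t, g s ^ 2 ≤ ∫ s in thick, g s ^ 2 :=
      setIntegral_mono_set hg2 (Filter.Eventually.of_forall fun s => sq_nonneg _)
        hsub.eventuallyLE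
    nlinarith [sq_nonneg m, ht.2]
  have hle : ∫ t in thick, (u t - a) ^ 2 ≤ ∫ s in thick, g s ^ 2 := by
    have := setIntegral_mono_on (μ := volume) (s := thick) (f := fun t => (u t - a) ^ 2)
      (g := fun _ => ∫ s in thick, g s ^ 2)
      ((h.add (AbsContDeriv.const (-a))).memLp.integrable_sq)
      (integrableOn_const (by simp [thick])) measurableSet_thick hpt
    rwa [setIntegral_const, volume_real_thick, one_smul] at this
  -- Since `u` has mean zero, `∫ (u - a)² = ∫ u² + a²`.
  have e3 := integral_sub_const_sq h.memLp a
  rw [h0, measureReal_restrict_apply_univ, volume_real_thick] at e3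
  nlinarith [sq_nonneg a]

/-- The constant in the Korn inequality for a single mode. -/
def modeConst (γ κ₀ : ℝ) : ℝ :=
  2 * (8 / (γ * κ₀) ^ 2 + 3 * (8 / (γ * κ₀)) ^ 2 + 2 * (γ * κ₀ / 8) ^ 2 + 5 / 2)

lemma mul_mul_le_of_abs_le_one {s : ℝ} (h1 : -1 ≤ s) (h2 : s ≤ 1) (a b : ℝ) :
    s * (a * b) ≤ (a ^ 2 + b ^ 2) / 2 := by
  nlinarith [mul_nonneg (sub_nonneg.2 h2) (sq_nonneg (a + b)),
    mul_nonneg (neg_le_iff_add_nonneg.1 h1) (sq_nonneg (a - b))]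

/-- The intended values are `P = κp`, `X = κq`, `T = q'/γ`, `U = p'/γ + κq` and `s = 2x₃`. The large
bracket is then `κ/γ` times the derivative of `x₃ (p²/δ + δ q²) + p q` with `δ = γκ₀/8`. The term
`(U - X) X` supplies `-X²`. The positive `X²` terms, `1/2` on the left and `1/8` from each of `a1`,
`b1`, `b3`, `b4`, add up to exactly `X²`; this dictates `δ` and the weights in the Young
inequalities. -/
lemma mode_pointwise {γ κ₀ κ : ℝ} (hγ : 0 < γ) (hκ₀ : 0 < κ₀) (hκ : κ₀ ≤ κ) {s : ℝ}
    (h1 : -1 ≤ s) (h2 : s ≤ 1) (P X T U : ℝ) :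
    X ^ 2 / 2 + (1 / (γ * κ) * (1 / (γ * κ₀ / 8) * P ^ 2 + γ * κ₀ / 8 * X ^ 2) +
      s * (1 / (γ * κ₀ / 8) * (P * (U - X)) + γ * κ₀ / 8 * (X * T)) + ((U - X) * X + P * T)) ≤
    modeConst γ κ₀ / 2 * (P ^ 2 + T ^ 2 + U ^ 2) := by
  have hκ0 : 0 < κ := hκ₀.trans_le hκ
  set δ := γ * κ₀ / 8 with hδ
  have hδ0 : 0 < δ := by positivity
  have a1 : 1 / (γ * κ) * (δ * X ^ 2) ≤ X ^ 2 / 8 := by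
    rw [one_div, inv_mul_le_iff₀ (by positivity), hδ]
    nlinarith [mul_nonneg (mul_nonneg hγ.le (sub_nonneg.2 hκ)) (sq_nonneg X)]
  have a2 : 1 / (γ * κ) * (1 / δ * P ^ 2) ≤ 8 / (γ * κ₀) ^ 2 * P ^ 2 := by
    have : 8 / (γ * κ₀) ^ 2 * P ^ 2 = 1 / (γ * κ₀) * (1 / δ * P ^ 2) := by
      rw [hδ]; field_simp
    rw [this]
    have : 1 / (γ * κ) ≤ 1 / (γ * κ₀) := by
      apply one_div_le_one_div_of_le (by positivity)
      gcongr
    gcongr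
  set Y := 1 / δ * P with hY
  have hYe : 1 / δ * (P * (U - X)) = Y * U - Y * X := by rw [hY]; ring
  have hY2 : Y ^ 2 = (8 / (γ * κ₀)) ^ 2 * P ^ 2 := by
    rw [hY, hδ]; field_simp
  have b1 := mul_mul_le_of_abs_le_one h1 h2 (2 * Y) (-X / 2)
  have b2 := mul_mul_le_of_abs_le_one h1 h2 Y U
  have b3 := mul_mul_le_of_abs_le_one h1 h2 (X / 2) (2 * δ * T)
  have b4 := mul_mul_le_of_abs_le_one (s := 1) (by norm_num) le_rfl (X / 2) (2 * U)
  have b5 := mul_mul_le_of_abs_le_one (s := 1) (by norm_num) le_rfl P T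
  rw [hYe, modeConst, ← hδ]
  set E := 8 / (γ * κ₀) ^ 2
  set D := (8 / (γ * κ₀)) ^ 2
  have hE : 0 ≤ E := by positivity
  have hD : 0 ≤ D := by positivity
  have n1 := mul_nonneg hE (sq_nonneg T)
  have n2 := mul_nonneg hE (sq_nonneg U)
  have n3 := mul_nonneg hD (sq_nonneg T)
  have n4 := mul_nonneg hD (sq_nonneg U)
  have n5 := mul_nonneg hD (sq_nonneg P)
  have n6 := mul_nonneg (sq_nonneg δ) (sq_nonneg P)
  have n7 := mul_nonneg (sq_nonneg δ) (sq_nonneg U)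
  nlinarith [sq_nonneg P, sq_nonneg T, sq_nonneg U]

/-- The Korn inequality for a single mode, with respect to the frequency `κ`. -/
lemma integral_mode_le {γ κ₀ κ : ℝ} (hγ : 0 < γ) (hκ₀ : 0 < κ₀) (hκ : κ₀ ≤ κ)
    {p p' q q' : ℝ → ℝ} (hp : AbsContDeriv p p') (hq : AbsContDeriv q q')
    (hp' : MemLp p' 2 (volume.restrict thick)) (hq' : MemLp q' 2 (volume.restrict thick)) :
    ∫ t in thick, (κ * q t) ^ 2 ≤ modeConst γ κ₀ *
      ∫ t in thick, ((κ * p t) ^ 2 + (q' t / γ) ^ 2 + (p' t / γ + κ * q t) ^ 2) := by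
  set δ := γ * κ₀ / 8 with hδ
  have hδ0 : 0 < δ := by positivity
  have hκ0 : 0 < κ := hκ₀.trans_le hκ
  -- The faces are free, so the boundary terms of `p q` have no sign. The multiplier `t` places
  -- weight `1/2` on `p²/δ + δ q²` at both ends, which dominates `|p q|` there; hence `∫ Φ' ≥ 0`.
  have hw := ((hp.mul hp).const_mul (1 / δ)).add ((hq.mul hq).const_mul δ)
  have hΦ := (AbsContDeriv.id.mul hw).add (hp.mul hq)
  have hbd := hΦ.integral_eq_sub
  set Φ' : ℝ → ℝ := fun t =>
    1 * (1 / δ * (p t * p t) + δ * (q t * q t)) +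
      t * (1 / δ * (p' t * p t + p t * p' t) + δ * (q' t * q t + q t * q' t)) +
      (p' t * q t + p t * q' t) with hΦ'
  have hge : 0 ≤ ∫ t in thick, Φ' t := by
    rw [hbd]
    have key : ∀ a b : ℝ, -(1 / δ * (a * a) + δ * (b * b)) / 2 ≤ a * b ∧
        a * b ≤ (1 / δ * (a * a) + δ * (b * b)) / 2 := by
      intro a b
      have h1 : 1 / δ * (a * a) + δ * (b * b) - 2 * (a * b) = (a - δ * b) ^ 2 / δ := by
        field_simp; ring
      have h2 : 1 / δ * (a * a) + δ * (b * b) + 2 * (a * b) = (a + δ * b) ^ 2 / δ := by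
        field_simp; ring
      have h3 : 0 ≤ (a - δ * b) ^ 2 / δ := by positivity
      have h4 : 0 ≤ (a + δ * b) ^ 2 / δ := by positivity
      constructor <;> linarith
    have k1 := (key (p (1 / 2)) (q (1 / 2))).1
    have k2 := (key (p (-(1 / 2))) (q (-(1 / 2)))).2
    linarith
  have hpL := hp.memLp
  have hqL := hq.memLp
  have i1 : IntegrableOn (fun t => (κ * q t) ^ 2) thick := (hqL.const_mul κ).integrable_sq
  have i2 : IntegrableOn (fun t => (κ * p t) ^ 2 + (q' t / γ) ^ 2 + (p' t / γ + κ * q t) ^ 2)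
      thick := by
    have hq'' : MemLp (fun t => q' t / γ) 2 (volume.restrict thick) := by
      simpa only [div_eq_inv_mul] using hq'.const_mul γ⁻¹
    have hp'' : MemLp (fun t => p' t / γ) 2 (volume.restrict thick) := by
      simpa only [div_eq_inv_mul] using hp'.const_mul γ⁻¹
    exact ((hpL.const_mul κ).integrable_sq.add hq''.integrable_sq).add
      (hp''.add (hqL.const_mul κ)).integrable_sq
  have i3 : IntegrableOn Φ' thick := by
    have e : ∀ f g : ℝ → ℝ, MemLp f 2 (volume.restrict thick) →
        MemLp g 2 (volume.restrict thick) → IntegrableOn (fun t => f t * g t) thick :=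
      fun f g hf hg => hf.integrable_mul hg
    have j1 : IntegrableOn
        (fun t => 1 / δ * (p' t * p t + p t * p' t) + δ * (q' t * q t + q t * q' t)) thick :=
      (((e _ _ hp' hpL).add (e _ _ hpL hp')).const_mul _).add
        (((e _ _ hq' hqL).add (e _ _ hqL hq')).const_mul _)
    have j2 : IntegrableOn (fun t =>
        t * (1 / δ * (p' t * p t + p t * p' t) + δ * (q' t * q t + q t * q' t))) thick := by
      refine Integrable.bdd_mul (c := 1 / 2) j1 measurable_id.aestronglyMeasurable ?_
      filter_upwards [ae_restrict_mem measurableSet_thick] with t ht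
      rw [Real.norm_eq_abs, abs_le]
      exact ⟨ht.1.le, ht.2.le⟩
    have j3 : IntegrableOn (fun t => 1 * (1 / δ * (p t * p t) + δ * (q t * q t))) thick :=
      (((e _ _ hpL hpL).const_mul _).add ((e _ _ hqL hqL).const_mul _)).const_mul _
    exact (j3.add j2).add ((e _ _ hp' hqL).add (e _ _ hpL hq'))
  have hpt : ∀ t ∈ thick, (κ * q t) ^ 2 / 2 + κ / γ * Φ' t ≤ modeConst γ κ₀ / 2 *
      ((κ * p t) ^ 2 + (q' t / γ) ^ 2 + (p' t / γ + κ * q t) ^ 2) := by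
    intro t ht
    refine le_trans (le_of_eq ?_) (mode_pointwise hγ hκ₀ hκ (s := 2 * t) (by linarith [ht.1])
      (by linarith [ht.2]) (κ * p t) (κ * q t) (q' t / γ) (p' t / γ + κ * q t))
    rw [hΦ', ← hδ]
    field_simp
    ring
  have hle := setIntegral_mono_on ((i1.div_const 2).add (i3.const_mul (κ / γ)))
    (i2.const_mul (modeConst γ κ₀ / 2)) measurableSet_thick hpt
  have e1 : ∫ t in thick, ((κ * q t) ^ 2 / 2 + κ / γ * Φ' t) =
      (∫ t in thick, (κ * q t) ^ 2) / 2 + κ / γ * ∫ t in thick, Φ' t := by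
    rw [integral_add (i1.div_const 2) (i3.const_mul (κ / γ)), integral_div, integral_const_mul]
  have hle' : ∫ t in thick, ((κ * q t) ^ 2 / 2 + κ / γ * Φ' t) ≤ _ := hle
  rw [e1, integral_const_mul] at hle'
  have : 0 ≤ κ / γ * ∫ t in thick, Φ' t := by positivity
  linarith

end

section

/-! ### Fourier coefficients in the in-plane variables -/

variable {Λ : Mat2}

/-- The coefficient function `t ↦ |Y_Λ|⁻¹ ∫_{Y_Λ} f(t, y) w(y) dy`. -/
def coef (Λ : Mat2) (w : (Fin 2 → ℝ) → ℝ) (f : Pt → ℝ) (t : ℝ) : ℝ :=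
  |Λ.det|⁻¹ * ∫ y in cell Λ, f (t, y) * w y

/-- The frequency vector `2π Λ^{-⊤} k`. -/
def freq (Λ : Mat2) (k : Fin 2 → ℤ) (a : Fin 2) : ℝ :=
  2 * Real.pi * ∑ i, (k i : ℝ) * Λ⁻¹ i a

/-- The phase `2π k · Λ⁻¹ y`. -/
def phase (Λ : Mat2) (k : Fin 2 → ℤ) (y : Fin 2 → ℝ) : ℝ := ∑ a, freq Λ k a * y a

/-- The cosine modes. -/
def cosMode (Λ : Mat2) (k : Fin 2 → ℤ) (y : Fin 2 → ℝ) : ℝ := Real.cos (phase Λ k y)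

/-- The sine modes. -/
def sinMode (Λ : Mat2) (k : Fin 2 → ℤ) (y : Fin 2 → ℝ) : ℝ := Real.sin (phase Λ k y)

lemma phase_mulVec (hΛ : IsUnit Λ.det) (k : Fin 2 → ℤ) (s : Fin 2 → ℝ) :
    phase Λ k (Λ *ᵥ s) = 2 * Real.pi * ∑ i, (k i : ℝ) * s i := by
  have h : Λ⁻¹ *ᵥ (Λ *ᵥ s) = s := by
    rw [Matrix.mulVec_mulVec, Matrix.nonsing_inv_mul _ hΛ, Matrix.one_mulVec]
  conv_rhs => rw [← h]
  generalize Λ *ᵥ s = y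
  simp only [phase, freq, Fin.sum_univ_two, Matrix.mulVec, dotProduct]
  ring

lemma phase_add (k : Fin 2 → ℤ) (y z : Fin 2 → ℝ) :
    phase Λ k (y + z) = phase Λ k y + phase Λ k z := by
  simp only [phase, Fin.sum_univ_two, Pi.add_apply]; ring

lemma phase_lattice (hΛ : IsUnit Λ.det) (k l : Fin 2 → ℤ) :
    phase Λ k (Λ *ᵥ (fun i => (l i : ℝ))) = ((∑ i, k i * l i : ℤ) : ℝ) * (2 * Real.pi) := by
  rw [phase_mulVec hΛ]; push_cast; ring

lemma cosMode_add (hΛ : IsUnit Λ.det) (k l : Fin 2 → ℤ) (y : Fin 2 → ℝ) :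
    cosMode Λ k (y + Λ *ᵥ (fun i => (l i : ℝ))) = cosMode Λ k y := by
  rw [cosMode, phase_add, phase_lattice hΛ, Real.cos_add_int_mul_two_pi, cosMode]

lemma sinMode_add (hΛ : IsUnit Λ.det) (k l : Fin 2 → ℤ) (y : Fin 2 → ℝ) :
    sinMode Λ k (y + Λ *ᵥ (fun i => (l i : ℝ))) = sinMode Λ k y := by
  rw [sinMode, phase_add, phase_lattice hΛ, Real.sin_add_int_mul_two_pi, sinMode]

lemma contDiff_phase (k : Fin 2 → ℤ) : ContDiff ℝ ∞ (phase Λ k) := by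
  unfold phase
  exact ContDiff.sum fun a _ => contDiff_const.mul (contDiff_apply ℝ ℝ a)

lemma contDiff_cosMode (k : Fin 2 → ℤ) : ContDiff ℝ ∞ (cosMode Λ k) :=
  Real.contDiff_cos.comp (contDiff_phase k)

lemma contDiff_sinMode (k : Fin 2 → ℤ) : ContDiff ℝ ∞ (sinMode Λ k) :=
  Real.contDiff_sin.comp (contDiff_phase k)

lemma fderiv_phase (k : Fin 2 → ℤ) (y : Fin 2 → ℝ) (a : Fin 2) :
    fderiv ℝ (phase Λ k) y (Pi.single a 1) = freq Λ k a := by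
  have h : ∀ b : Fin 2, HasFDerivAt (fun y : Fin 2 → ℝ => freq Λ k b * y b)
      (freq Λ k b • ContinuousLinearMap.proj (R := ℝ) (φ := fun _ : Fin 2 => ℝ) b) y := fun b =>
    (hasFDerivAt_apply b y).const_mul (freq Λ k b)
  have h2 := HasFDerivAt.fun_sum (u := Finset.univ) fun b _ => h b
  have h3 : HasFDerivAt (phase Λ k) _ y := h2
  rw [h3.fderiv]
  fin_cases a <;> simp

lemma fderiv_cosMode (k : Fin 2 → ℤ) (y : Fin 2 → ℝ) (a : Fin 2) :
    fderiv ℝ (cosMode Λ k) y (Pi.single a 1) = -(freq Λ k a * sinMode Λ k y) := by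
  have h := ((contDiff_phase (Λ := Λ) k).differentiable (by simp) y).hasFDerivAt.cos
  have h' : HasFDerivAt (cosMode Λ k) _ y := h
  rw [h'.fderiv]
  simp only [smul_apply, fderiv_phase, smul_eq_mul, sinMode]
  ring

lemma fderiv_sinMode (k : Fin 2 → ℤ) (y : Fin 2 → ℝ) (a : Fin 2) :
    fderiv ℝ (sinMode Λ k) y (Pi.single a 1) = freq Λ k a * cosMode Λ k y := by
  have h := ((contDiff_phase (Λ := Λ) k).differentiable (by simp) y).hasFDerivAt.sin
  have h' : HasFDerivAt (sinMode Λ k) _ y := h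
  rw [h'.fderiv]
  simp only [smul_apply, fderiv_phase, smul_eq_mul, cosMode]
  ring

/-! ### Slices -/

lemma restrict_box : (volume : Measure Pt).restrict (box Λ) =
    ((volume : Measure ℝ).restrict thick).prod (volume.restrict (cell Λ)) := by
  rw [Measure.prod_restrict]; rfl

instance : IsFiniteMeasure ((volume : Measure (Fin 2 → ℝ)).restrict (cell Λ)) :=
  ⟨by rw [Measure.restrict_apply_univ, volume_cell]; exact ENNReal.ofReal_lt_top⟩

lemma bounded_on_cell {w : (Fin 2 → ℝ) → ℝ} (hw : Continuous w) : ∃ C, ∀ y ∈ cell Λ, ‖w y‖ ≤ C := by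
  obtain ⟨R, hR⟩ := isBounded_cell Λ
  obtain ⟨C, hC⟩ := (isCompact_closedBall (0 : Fin 2 → ℝ) R).exists_bound_of_continuousOn
    hw.continuousOn
  exact ⟨C, fun y hy => hC y (by simpa using hR y hy)⟩

lemma bounded_mode_on_box (hΛ : IsUnit Λ.det) {w : (Fin 2 → ℝ) → ℝ} (hw : Continuous w) :
    ∃ C, ∀ᵐ x ∂(volume.restrict (box Λ)), ‖w x.2‖ ≤ C := by
  obtain ⟨C, hC⟩ := bounded_on_cell (Λ := Λ) hw
  refine ⟨C, ?_⟩
  filter_upwards [ae_restrict_mem (measurableSet_box hΛ)] with x hx using hC _ hx.2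

lemma integrable_mul_mode (hΛ : IsUnit Λ.det) {f : Pt → ℝ} {w : (Fin 2 → ℝ) → ℝ}
    (hf : IntegrableOn f (box Λ)) (hw : Continuous w) :
    IntegrableOn (fun x => f x * w x.2) (box Λ) := by
  obtain ⟨C, hC⟩ := bounded_mode_on_box hΛ hw
  exact Integrable.mul_bdd (c := C) hf (hw.comp continuous_snd).aestronglyMeasurable hC

lemma integrableOn_coef (hΛ : IsUnit Λ.det) {f : Pt → ℝ} {w : (Fin 2 → ℝ) → ℝ}
    (hf : IntegrableOn f (box Λ)) (hw : Continuous w) : IntegrableOn (coef Λ w f) thick := by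
  have h := integrable_mul_mode hΛ hf hw
  rw [IntegrableOn, restrict_box] at h
  exact h.integral_prod_left.const_mul _

/-- Fubini's theorem; the factor `|det Λ|` undoes the normalisation in `coef`. -/
lemma setIntegral_box_coef (hΛ : IsUnit Λ.det) {f : Pt → ℝ} {w : (Fin 2 → ℝ) → ℝ} {b : ℝ → ℝ}
    (hf : IntegrableOn f (box Λ)) (hw : Continuous w) (hb : Continuous b) {C : ℝ}
    (hC : ∀ᵐ t ∂(volume.restrict thick), ‖b t‖ ≤ C) :
    ∫ x in box Λ, f x * w x.2 * b x.1 = |Λ.det| * ∫ t in thick, coef Λ w f t * b t := by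
  have h := integrable_mul_mode hΛ hf hw
  have hC' : ∀ᵐ x ∂(volume.restrict (box Λ)), ‖b x.1‖ ≤ C := by
    rw [restrict_box]
    exact Measure.quasiMeasurePreserving_fst.ae hC
  have h2 : IntegrableOn (fun x => f x * w x.2 * b x.1) (box Λ) :=
    Integrable.mul_bdd (c := C) h (hb.comp continuous_fst).aestronglyMeasurable hC'
  rw [IntegrableOn, restrict_box] at h2
  rw [restrict_box, integral_prod _ h2, ← integral_const_mul]
  refine integral_congr_ae (Filter.Eventually.of_forall fun t => ?_)
  have hne : |Λ.det| ≠ 0 := abs_ne_zero.2 hΛ.ne_zero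
  simp only [coef]
  rw [integral_mul_const]
  field_simp

lemma ae_slice {f : Pt → ℝ} (hf : MemLp f 2 (volume.restrict (box Λ))) :
    ∀ᵐ t ∂(volume.restrict thick),
      MemLp (fun y => f (t, y)) 2 (volume.restrict (cell Λ)) := by
  have h1 := hf.1
  have h2 := hf.integrable_sq
  rw [restrict_box] at h1 h2
  filter_upwards [h1.prodMk_left, h2.prod_right_ae] with t ht1 ht2
  exact (memLp_two_iff_integrable_sq ht1).2 ht2

lemma integrable_mul_mode_cell (hΛ : IsUnit Λ.det) {h : (Fin 2 → ℝ) → ℝ} {w : (Fin 2 → ℝ) → ℝ}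
    (hf : IntegrableOn h (cell Λ)) (hw : Continuous w) :
    IntegrableOn (fun y => h y * w y) (cell Λ) := by
  obtain ⟨C, hC⟩ := bounded_on_cell (Λ := Λ) hw
  refine Integrable.mul_bdd (c := C) hf hw.aestronglyMeasurable ?_
  filter_upwards [ae_restrict_mem (measurableSet_cell hΛ)] with x hx using hC _ hx

lemma coef_add (hΛ : IsUnit Λ.det) {f g : Pt → ℝ} {w : (Fin 2 → ℝ) → ℝ}
    (hf : MemLp f 2 (volume.restrict (box Λ))) (hg : MemLp g 2 (volume.restrict (box Λ)))
    (hw : Continuous w) : ∀ᵐ t ∂(volume.restrict thick),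
      coef Λ w (fun x => f x + g x) t = coef Λ w f t + coef Λ w g t := by
  filter_upwards [ae_slice hf, ae_slice hg] with t h1 h2
  simp only [coef, add_mul]
  rw [integral_add (integrable_mul_mode_cell hΛ (h1.integrable (by norm_num)) hw)
    (integrable_mul_mode_cell hΛ (h2.integrable (by norm_num)) hw), mul_add]

lemma coef_const_mul (c : ℝ) (f : Pt → ℝ) (w : (Fin 2 → ℝ) → ℝ) (t : ℝ) :
    coef Λ w (fun x => c * f x) t = c * coef Λ w f t := by
  simp only [coef, mul_assoc]
  rw [integral_const_mul]; ring

/-! ### Parseval's identity -/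

section Parseval

-- Parseval's identity on the torus refers to the normalised Haar measure; within this section
-- `volume` denotes it.
local instance : MeasureSpace UnitAddCircle := ⟨AddCircle.haarAddCircle⟩

/-- The centred representative of a point of the torus. -/
def torusLift (z : UnitAddTorus (Fin 2)) : Fin 2 → ℝ :=
  (UnitAddTorus.measurableEquivPiIoc (fun _ : Fin 2 => (-(1 / 2) : ℝ)) z).1

lemma coe_torusLift (z : UnitAddTorus (Fin 2)) :
    (fun i => (torusLift z i : UnitAddCircle)) = z :=
  (UnitAddTorus.measurableEquivPiIoc (fun _ : Fin 2 => (-(1 / 2) : ℝ))).symm_apply_apply z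

lemma measurableSet_piIoc :
    MeasurableSet {x : Fin 2 → ℝ | ∀ i, x i ∈ Ioc (-(1 / 2) : ℝ) (-(1 / 2) + 1)} :=
  MeasurableSet.univ_pi' fun _ => measurableSet_Ioc

/-- The torus lift takes values in a cube containing its upper faces, whereas the cell contains the
lower ones. Both cubes agree with the closed cube up to a null set. -/
lemma restrict_piIoc :
    (volume : Measure (Fin 2 → ℝ)).restrict
      {x : Fin 2 → ℝ | ∀ i, x i ∈ Ioc (-(1 / 2) : ℝ) (-(1 / 2) + 1)} =
    volume.restrict (Set.pi univ (fun _ => Ico (-(1 / 2) : ℝ) (1 / 2))) := by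
  refine Measure.restrict_congr_set ?_
  have h1 : {x : Fin 2 → ℝ | ∀ i, x i ∈ Ioc (-(1 / 2) : ℝ) (-(1 / 2) + 1)} =
      Set.pi univ (fun _ => Ioc (-(1 / 2) : ℝ) (1 / 2)) := by
    ext x; norm_num [mem_pi]
  rw [h1]
  exact (Measure.univ_pi_Ioc_ae_eq_Icc (μ := fun _ : Fin 2 => (volume : Measure ℝ))).trans
    (Measure.univ_pi_Ico_ae_eq_Icc (μ := fun _ : Fin 2 => (volume : Measure ℝ))).symm

lemma measurePreserving_torusLift : MeasurePreserving torusLift volume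
    (volume.restrict (Set.pi univ (fun _ : Fin 2 => Ico (-(1 / 2) : ℝ) (1 / 2)))) := by
  rw [← restrict_piIoc]
  exact (measurePreserving_subtype_coe measurableSet_piIoc).comp
    (UnitAddTorus.measurePreserving_equivPiIoc (fun _ : Fin 2 => (-(1 / 2) : ℝ)))

lemma measurableEmbedding_torusLift : MeasurableEmbedding torusLift :=
  (MeasurableEmbedding.subtype_coe measurableSet_piIoc).comp
    (UnitAddTorus.measurableEquivPiIoc (fun _ : Fin 2 => (-(1 / 2) : ℝ))).measurableEmbedding

lemma mFourier_neg_coe (k : Fin 2 → ℤ) (s : Fin 2 → ℝ) :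
    UnitAddTorus.mFourier (-k) (fun i => (s i : UnitAddCircle)) =
      ((Real.cos (2 * Real.pi * ∑ i, (k i : ℝ) * s i) : ℝ) : ℂ) -
        ((Real.sin (2 * Real.pi * ∑ i, (k i : ℝ) * s i) : ℝ) : ℂ) * Complex.I := by
  have : UnitAddTorus.mFourier (-k) (fun i => (s i : UnitAddCircle)) =
      Complex.exp (-((2 * Real.pi * ∑ i, (k i : ℝ) * s i : ℝ) : ℂ) * Complex.I) := by
    simp only [UnitAddTorus.mFourier, ContinuousMap.coe_mk, fourier_coe_apply, Fin.prod_univ_two,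
      Fin.sum_univ_two, ← Complex.exp_add]
    congr 1
    push_cast
    simp
    ring
  rw [this, Complex.exp_mul_I, Complex.cos_neg, Complex.sin_neg]
  push_cast
  ring

/-- For real `h` the complex coefficient at `k` is `∫ h cos - i ∫ h sin`, and its squared modulus is
the sum of the two squares. The sum runs over all of `ℤ²`, with `k` and `-k` contributing equally,
so no factor `2` appears. -/
lemma hasSum_unitCell {h : (Fin 2 → ℝ) → ℝ}
    (hh : MemLp h 2 (volume.restrict (Set.pi univ (fun _ : Fin 2 => Ico (-(1 / 2) : ℝ) (1 / 2))))) :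
    HasSum (fun k : Fin 2 → ℤ =>
      (∫ s in Set.pi univ (fun _ : Fin 2 => Ico (-(1 / 2) : ℝ) (1 / 2)),
        h s * Real.cos (2 * Real.pi * ∑ i, (k i : ℝ) * s i)) ^ 2 +
      (∫ s in Set.pi univ (fun _ : Fin 2 => Ico (-(1 / 2) : ℝ) (1 / 2)),
        h s * Real.sin (2 * Real.pi * ∑ i, (k i : ℝ) * s i)) ^ 2)
      (∫ s in Set.pi univ (fun _ : Fin 2 => Ico (-(1 / 2) : ℝ) (1 / 2)), h s ^ 2) := by
  set ν := (volume : Measure (Fin 2 → ℝ)).restrict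
    (Set.pi univ (fun _ : Fin 2 => Ico (-(1 / 2) : ℝ) (1 / 2))) with hν
  have : IsFiniteMeasure ν := ⟨by
    rw [hν, Measure.restrict_apply_univ, volume_pi_pi]
    exact ENNReal.prod_lt_top fun _ _ => by simp⟩
  have hC : MemLp (fun s => (h s : ℂ)) 2 ν := hh.ofReal
  have hF : MemLp (fun z => (h (torusLift z) : ℂ)) 2 (volume : Measure (UnitAddTorus (Fin 2))) :=
    hC.comp_measurePreserving measurePreserving_torusLift
  have key := UnitAddTorus.hasSum_sq_mFourierCoeff hF.toLp
  have hco := hF.coeFn_toLp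
  have hi : Integrable h ν := hh.integrable (by norm_num)
  have hint : ∀ b : (Fin 2 → ℝ) → ℝ, Continuous b → (∀ s, |b s| ≤ 1) →
      Integrable (fun s => h s * b s) ν := fun b hb hb1 =>
    hi.mul_bdd (c := 1) hb.aestronglyMeasurable (Filter.Eventually.of_forall hb1)
  have e1 : ∫ z, ‖(hF.toLp : UnitAddTorus (Fin 2) → ℂ) z‖ ^ 2 = ∫ s, h s ^ 2 ∂ν := by
    rw [← measurePreserving_torusLift.integral_comp measurableEmbedding_torusLift]
    refine integral_congr_ae ?_
    filter_upwards [hco] with z hz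
    rw [hz]; simp
  have e2 : ∀ k : Fin 2 → ℤ, ‖UnitAddTorus.mFourierCoeff (hF.toLp) k‖ ^ 2 =
      (∫ s, h s * Real.cos (2 * Real.pi * ∑ i, (k i : ℝ) * s i) ∂ν) ^ 2 +
      (∫ s, h s * Real.sin (2 * Real.pi * ∑ i, (k i : ℝ) * s i) ∂ν) ^ 2 := by
    intro k
    have e3 : UnitAddTorus.mFourierCoeff (hF.toLp) k =
        ((∫ s, h s * Real.cos (2 * Real.pi * ∑ i, (k i : ℝ) * s i) ∂ν : ℝ) : ℂ) -
        ((∫ s, h s * Real.sin (2 * Real.pi * ∑ i, (k i : ℝ) * s i) ∂ν : ℝ) : ℂ) *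
          Complex.I := by
      rw [UnitAddTorus.mFourierCoeff, ← integral_complex_ofReal, ← integral_complex_ofReal,
        ← integral_mul_const, ← integral_sub]
      · rw [← measurePreserving_torusLift.integral_comp measurableEmbedding_torusLift]
        refine integral_congr_ae ?_
        filter_upwards [hco] with z hz
        rw [hz]
        conv_lhs => rw [← coe_torusLift z]
        rw [mFourier_neg_coe, coe_torusLift z]
        simp only [smul_eq_mul]
        push_cast
        ring
      · exact (hint _ (by fun_prop) fun s => Real.abs_cos_le_one _).ofReal
      · exact (hint _ (by fun_prop) fun s => Real.abs_sin_le_one _).ofReal.mul_const _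
    rw [e3, Complex.sq_norm, Complex.normSq_apply]
    simp [pow_two]
  rw [e1] at key
  simpa only [e2] using key

end Parseval

lemma mulVec_injective (hΛ : IsUnit Λ.det) :
    Function.Injective fun v : Fin 2 → ℝ => Λ *ᵥ v := fun a b hab => by
  have := congrArg (fun v => Λ⁻¹ *ᵥ v) hab
  simpa only [Matrix.mulVec_mulVec, Matrix.nonsing_inv_mul _ hΛ, Matrix.one_mulVec] using this

lemma setIntegral_cell (hΛ : IsUnit Λ.det) (F : (Fin 2 → ℝ) → ℝ) :
    ∫ y in cell Λ, F y =
      |Λ.det| * ∫ s in Set.pi univ (fun _ => Ico (-(1 / 2) : ℝ) (1 / 2)), F (Λ *ᵥ s) := by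
  have hinj := mulVec_injective hΛ
  have h := integral_image_eq_integral_abs_det_fderiv_smul (volume : Measure (Fin 2 → ℝ))
    (s := Set.pi univ (fun _ => Ico (-(1 / 2) : ℝ) (1 / 2)))
    (MeasurableSet.univ_pi fun _ => measurableSet_Ico)
    (f := fun v => Λ *ᵥ v) (f' := fun _ => LinearMap.toContinuousLinearMap (Matrix.toLin' Λ))
    (fun x _ => (LinearMap.toContinuousLinearMap (Matrix.toLin' Λ)).hasFDerivWithinAt)
    hinj.injOn F
  rw [cell, h, ← integral_const_mul]
  simp [LinearMap.toContinuousLinearMap, ContinuousLinearMap.det]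

lemma memLp_comp_mulVec (hΛ : IsUnit Λ.det) {h : (Fin 2 → ℝ) → ℝ}
    (hh : MemLp h 2 (volume.restrict (cell Λ))) :
    MemLp (fun s => h (Λ *ᵥ s)) 2
      (volume.restrict (Set.pi univ (fun _ => Ico (-(1 / 2) : ℝ) (1 / 2)))) := by
  have hm : Measurable fun v : Fin 2 → ℝ => Λ *ᵥ v := (continuous_mulVec Λ).measurable
  have h1 : Measure.map (fun v : Fin 2 → ℝ => Λ *ᵥ v) volume =
      ENNReal.ofReal |(Λ.det)⁻¹| • (volume : Measure (Fin 2 → ℝ)) :=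
    Real.map_matrix_volume_pi_eq_smul_volume_pi hΛ.ne_zero
  have h2 := Measure.restrict_map hm (measurableSet_cell hΛ) (μ := volume)
  have h3 : (fun v : Fin 2 → ℝ => Λ *ᵥ v) ⁻¹' cell Λ =
      Set.pi univ (fun _ => Ico (-(1 / 2) : ℝ) (1 / 2)) :=
    (mulVec_injective hΛ).preimage_image _
  rw [h1, h3, Measure.restrict_smul] at h2
  refine MemLp.comp_of_map (f := fun v : Fin 2 → ℝ => Λ *ᵥ v) ?_ hm.aemeasurable
  rw [← h2]
  exact hh.smul_measure ENNReal.ofReal_ne_top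

lemma hasSum_cell (hΛ : IsUnit Λ.det) {h : (Fin 2 → ℝ) → ℝ}
    (hh : MemLp h 2 (volume.restrict (cell Λ))) :
    HasSum (fun k : Fin 2 → ℤ =>
      (|Λ.det|⁻¹ * ∫ y in cell Λ, h y * cosMode Λ k y) ^ 2 +
      (|Λ.det|⁻¹ * ∫ y in cell Λ, h y * sinMode Λ k y) ^ 2)
      (|Λ.det|⁻¹ * ∫ y in cell Λ, h y ^ 2) := by
  have hne : |Λ.det| ≠ 0 := abs_ne_zero.2 hΛ.ne_zero
  simp only [setIntegral_cell hΛ, ← mul_assoc, inv_mul_cancel₀ hne, one_mul, cosMode, sinMode,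
    phase_mulVec hΛ]
  exact hasSum_unitCell (memLp_comp_mulVec hΛ hh)

lemma aestronglyMeasurable_coef {f : Pt → ℝ} (hf : MemLp f 2 (volume.restrict (box Λ)))
    {w : (Fin 2 → ℝ) → ℝ} (hw : Continuous w) :
    AEStronglyMeasurable (coef Λ w f) (volume.restrict thick) := by
  have h : AEStronglyMeasurable (fun x : Pt => f x * w x.2) (volume.restrict (box Λ)) :=
    hf.1.mul (hw.comp continuous_snd).aestronglyMeasurable
  rw [restrict_box] at h
  exact h.integral_prod_right'.const_mul _

lemma integrable_slice_sq {f : Pt → ℝ} (hf : MemLp f 2 (volume.restrict (box Λ))) :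
    IntegrableOn (fun t => |Λ.det|⁻¹ * ∫ y in cell Λ, f (t, y) ^ 2) thick := by
  have h := hf.integrable_sq
  rw [restrict_box] at h
  exact h.integral_prod_left.const_mul _

lemma hasSum_slice (hΛ : IsUnit Λ.det) {f : Pt → ℝ} (hf : MemLp f 2 (volume.restrict (box Λ))) :
    ∀ᵐ t ∂(volume.restrict thick), HasSum (fun k : Fin 2 → ℤ =>
      coef Λ (cosMode Λ k) f t ^ 2 + coef Λ (sinMode Λ k) f t ^ 2)
      (|Λ.det|⁻¹ * ∫ y in cell Λ, f (t, y) ^ 2) := by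
  filter_upwards [ae_slice hf] with t ht using hasSum_cell hΛ ht

/-- A single term of the Parseval sum is at most the whole sum, so each squared coefficient is
dominated by the squared norm of the slice, which is integrable in `t`. -/
lemma memLp_coef_modes (hΛ : IsUnit Λ.det) {f : Pt → ℝ}
    (hf : MemLp f 2 (volume.restrict (box Λ))) (k : Fin 2 → ℤ) :
    MemLp (coef Λ (cosMode Λ k) f) 2 (volume.restrict thick) ∧
      MemLp (coef Λ (sinMode Λ k) f) 2 (volume.restrict thick) := by
  have hc := aestronglyMeasurable_coef hf (contDiff_cosMode (Λ := Λ) k).continuous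
  have hs := aestronglyMeasurable_coef hf (contDiff_sinMode (Λ := Λ) k).continuous
  rw [memLp_two_iff_integrable_sq hc, memLp_two_iff_integrable_sq hs]
  have hle : ∀ᵐ t ∂(volume.restrict thick),
      coef Λ (cosMode Λ k) f t ^ 2 + coef Λ (sinMode Λ k) f t ^ 2 ≤
        |Λ.det|⁻¹ * ∫ y in cell Λ, f (t, y) ^ 2 := by
    filter_upwards [hasSum_slice hΛ hf] with t ht
    exact le_hasSum ht k fun _ _ => by positivity
  constructor
  · refine (integrable_slice_sq hf).mono' (hc.pow 2) ?_
    filter_upwards [hle] with t ht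
    rw [Real.norm_of_nonneg (sq_nonneg _)]
    linarith [sq_nonneg (coef Λ (sinMode Λ k) f t)]
  · refine (integrable_slice_sq hf).mono' (hs.pow 2) ?_
    filter_upwards [hle] with t ht
    rw [Real.norm_of_nonneg (sq_nonneg _)]
    linarith [sq_nonneg (coef Λ (cosMode Λ k) f t)]

/-- **Parseval's identity** on the representative volume element. -/
lemma hasSum_box (hΛ : IsUnit Λ.det) {f : Pt → ℝ} (hf : MemLp f 2 (volume.restrict (box Λ))) :
    HasSum (fun k : Fin 2 → ℤ =>
      ∫ t in thick, (coef Λ (cosMode Λ k) f t ^ 2 + coef Λ (sinMode Λ k) f t ^ 2))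
      (|Λ.det|⁻¹ * ∫ x in box Λ, f x ^ 2) := by
  set F : (Fin 2 → ℤ) → ℝ → ℝ := fun k t =>
    coef Λ (cosMode Λ k) f t ^ 2 + coef Λ (sinMode Λ k) f t ^ 2 with hF
  have hFnn : ∀ k t, 0 ≤ F k t := fun k t => by positivity
  have hFi : ∀ k, Integrable (F k) (volume.restrict thick) := fun k =>
    (memLp_coef_modes hΛ hf k).1.integrable_sq.add (memLp_coef_modes hΛ hf k).2.integrable_sq
  have hsl := hasSum_slice hΛ hf
  -- Partial sums are bounded by the integrated slice norms; this permits exchanging the sum over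
  -- `k` with the integral over `t`.
  have hsum : Summable fun k => ∫ t in thick, ‖F k t‖ := by
    refine summable_of_sum_le (c := ∫ t in thick, |Λ.det|⁻¹ * ∫ y in cell Λ, f (t, y) ^ 2)
      (fun k => integral_nonneg fun t => norm_nonneg _) fun S => ?_
    rw [← integral_finsetSum _ fun k _ => (hFi k).norm]
    refine integral_mono_ae (integrable_finsetSum _ fun k _ => (hFi k).norm)
      (integrable_slice_sq hf) ?_
    filter_upwards [hsl] with t ht
    simp only [Real.norm_of_nonneg (hFnn _ _)]
    exact sum_le_hasSum S (fun k _ => hFnn k t) ht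
  have key := hasSum_integral_of_summable_integral_norm hFi hsum
  have e : ∫ t in thick, ∑' k, F k t = |Λ.det|⁻¹ * ∫ x in box Λ, f x ^ 2 := by
    have h := hf.integrable_sq
    rw [restrict_box] at h ⊢
    rw [integral_prod _ h, ← integral_const_mul]
    refine integral_congr_ae ?_
    filter_upwards [hsl] with t ht using ht.tsum_eq
  rwa [e] at key

end

section

/-! ### A partition of unity subordinate to the lattice -/

variable {Λ : Mat2}

/-- A smooth hat function on `[-1, 1]` whose integer translates sum up to one. -/
def hat (s : ℝ) : ℝ := Real.smoothTransition (s + 1) - Real.smoothTransition s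

lemma contDiff_hat : ContDiff ℝ ∞ hat :=
  (Real.smoothTransition.contDiff.comp (contDiff_id.add contDiff_const)).sub
    Real.smoothTransition.contDiff

lemma hat_eq_zero {s : ℝ} (h : s < -1 ∨ 1 < s) : hat s = 0 := by
  rcases h with h | h
  · rw [hat, Real.smoothTransition.zero_of_nonpos (by linarith),
      Real.smoothTransition.zero_of_nonpos (by linarith), sub_zero]
  · rw [hat, Real.smoothTransition.one_of_one_le (by linarith),
      Real.smoothTransition.one_of_one_le (by linarith), sub_self]

/-- The sum telescopes to the difference of `Real.smoothTransition` at `s + 2` and `s - 1`, where it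
has reached its final values `1` and `0`. -/
lemma sum_hat {s : ℝ} (h1 : -1 ≤ s) (h2 : s ≤ 1) :
    ∑ n ∈ Finset.Icc (-1 : ℤ) 1, hat (s + n) = 1 := by
  have : Finset.Icc (-1 : ℤ) 1 = {-1, 0, 1} := by decide
  rw [this, Finset.sum_insert (by decide), Finset.sum_insert (by decide), Finset.sum_singleton]
  simp only [hat]
  push_cast
  rw [Real.smoothTransition.one_of_one_le (x := s + 1 + 1) (by linarith),
    Real.smoothTransition.zero_of_nonpos (x := s + -1) (by linarith)]
  ring_nf

/-- The lattice indices of the cells meeting the support of the partition function. -/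
def nbIdx : Finset (Fin 2 → ℤ) := Fintype.piFinset fun _ => Finset.Icc (-1 : ℤ) 1

/-- A smooth compactly supported function whose lattice translates sum up to one. -/
def part (Λ : Mat2) (y : Fin 2 → ℝ) : ℝ := ∏ i, hat ((Λ⁻¹ *ᵥ y) i)

lemma contDiff_mulVec_apply (A : Mat2) (i : Fin 2) :
    ContDiff ℝ ∞ fun y : Fin 2 → ℝ => (A *ᵥ y) i := by
  simp only [Matrix.mulVec, dotProduct]
  exact ContDiff.sum fun a _ => contDiff_const.mul (contDiff_apply ℝ ℝ a)

lemma contDiff_part : ContDiff ℝ ∞ (part Λ) :=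
  contDiff_prod fun i _ => contDiff_hat.comp (contDiff_mulVec_apply _ i)

lemma tsupport_part_subset :
    tsupport (part Λ) ⊆ {y | ∀ i, (Λ⁻¹ *ᵥ y) i ∈ Icc (-1 : ℝ) 1} := by
  refine closure_minimal (fun y hy i => ?_) ?_
  · by_contra hcon
    refine hy (Finset.prod_eq_zero (Finset.mem_univ i) (hat_eq_zero ?_))
    rw [mem_Icc, not_and_or, not_le, not_le] at hcon
    exact hcon
  · have : {y | ∀ i, (Λ⁻¹ *ᵥ y) i ∈ Icc (-1 : ℝ) 1} =
        ⋂ i, (fun y : Fin 2 → ℝ => (Λ⁻¹ *ᵥ y) i) ⁻¹' Icc (-1 : ℝ) 1 := by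
      ext y; simp
    rw [this]
    exact isClosed_iInter fun i =>
      isClosed_Icc.preimage (contDiff_mulVec_apply _ i).continuous

lemma hasCompactSupport_part (hΛ : IsUnit Λ.det) : HasCompactSupport (part Λ) := by
  have hc : IsCompact ((fun v : Fin 2 → ℝ => Λ *ᵥ v) '' Metric.closedBall 0 1) :=
    (isCompact_closedBall 0 1).image (continuous_mulVec _)
  refine hc.of_isClosed_subset (isClosed_tsupport _) fun y hy => ?_
  refine ⟨Λ⁻¹ *ᵥ y, ?_, ?_⟩
  · rw [mem_closedBall_zero_iff, pi_norm_le_iff_of_nonneg zero_le_one]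
    exact fun i => abs_le.2 (tsupport_part_subset hy i)
  · simp only [Matrix.mulVec_mulVec, Matrix.mul_nonsing_inv _ hΛ, Matrix.one_mulVec]

lemma latIdx_mem_of_mem_tsupport {y : Fin 2 → ℝ} (hy : y ∈ tsupport (part Λ)) :
    latIdx Λ y ∈ nbIdx := by
  rw [nbIdx, Fintype.mem_piFinset]
  intro i
  have h := tsupport_part_subset hy i
  rw [Finset.mem_Icc]
  constructor
  · refine Int.le_floor.2 ?_
    push_cast; linarith [h.1]
  · refine Int.floor_le_iff.2 ?_
    push_cast; linarith [h.2]

/-- Needed on a neighbourhood, not just at `y`, so that it can be differentiated at boundary points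
of the cell. The product form of `part` factors the sum over the nine translates into two
one-dimensional sums. -/
lemma sum_part (hΛ : IsUnit Λ.det) {y : Fin 2 → ℝ} (hy : y ∈ cell Λ) :
    ∀ᶠ z in nhds y, ∑ k ∈ nbIdx, part Λ (z + Λ *ᵥ (fun i => (k i : ℝ))) = 1 := by
  have hopen : IsOpen (⋂ i, (fun y : Fin 2 → ℝ => (Λ⁻¹ *ᵥ y) i) ⁻¹' Ioo (-1 : ℝ) 1) :=
    isOpen_iInter_of_finite fun i => isOpen_Ioo.preimage (contDiff_mulVec_apply _ i).continuous
  have hmem : y ∈ ⋂ i, (fun y : Fin 2 → ℝ => (Λ⁻¹ *ᵥ y) i) ⁻¹' Ioo (-1 : ℝ) 1 := by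
    rw [mem_iInter]
    intro i
    have := (mem_cell_iff hΛ).1 hy i
    constructor <;> linarith [this.1, this.2]
  filter_upwards [hopen.mem_nhds hmem] with z hz
  rw [mem_iInter] at hz
  have : ∀ k : Fin 2 → ℤ, part Λ (z + Λ *ᵥ (fun i => (k i : ℝ))) =
      ∏ i, hat ((Λ⁻¹ *ᵥ z) i + k i) := fun k => by
    simp only [part, Matrix.mulVec_add, Matrix.mulVec_mulVec, Matrix.nonsing_inv_mul _ hΛ,
      Matrix.one_mulVec, Pi.add_apply]
  simp only [this]
  rw [nbIdx, ← Finset.prod_univ_sum (fun _ : Fin 2 => Finset.Icc (-1 : ℤ) 1)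
    (fun i n => hat ((Λ⁻¹ *ᵥ z) i + n))]
  exact Finset.prod_eq_one fun i _ => sum_hat (hz i).1.le (hz i).2.le

/-- These terms appear when the cut-off is differentiated; together they form the derivative of a
locally constant function. -/
lemma sum_fderiv_part (hΛ : IsUnit Λ.det) {y : Fin 2 → ℝ} (hy : y ∈ cell Λ) (e : Fin 2 → ℝ) :
    ∑ k ∈ nbIdx, fderiv ℝ (part Λ) (y + Λ *ᵥ (fun i => (k i : ℝ))) e = 0 := by
  have h1 : HasFDerivAt (fun z => ∑ k ∈ nbIdx, part Λ (z + Λ *ᵥ (fun i => (k i : ℝ))))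
      (∑ k ∈ nbIdx, fderiv ℝ (part Λ) (y + Λ *ᵥ (fun i => (k i : ℝ)))) y := by
    refine HasFDerivAt.fun_sum fun k _ => ?_
    exact (hasFDerivAt_comp_add_right _).2
      ((contDiff_part (Λ := Λ)).differentiable (by simp) _).hasFDerivAt
  have h2 : HasFDerivAt (fun z => ∑ k ∈ nbIdx, part Λ (z + Λ *ᵥ (fun i => (k i : ℝ))))
      (0 : (Fin 2 → ℝ) →L[ℝ] ℝ) y :=
    (hasFDerivAt_const (1 : ℝ) y).congr_of_eventuallyEq (sum_part hΛ hy)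
  have := congrArg (fun L : (Fin 2 → ℝ) →L[ℝ] ℝ => L e) (h1.unique h2)
  simpa using this

/-! ### Weak derivatives of the coefficients -/

/-- Unfolding replaces `r` by the sum of its lattice translates, which is the constant `m` on the
cell. The cases used are `r = part Λ` with `m = 1` and a derivative of `part Λ` with `m = 0`. -/
lemma LatticePeriodic.unfold_part (hΛ : IsUnit Λ.det) {F : Pt → ℝ} (hF : LatticePeriodic Λ F)
    (hi : IntegrableOn F (box Λ)) {b : ℝ → ℝ} (hb : Continuous b) (hbs : HasCompactSupport b)
    {r : (Fin 2 → ℝ) → ℝ} (hr : Continuous r) (hrs : tsupport r ⊆ tsupport (part Λ)) {m : ℝ}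
    (hm : ∀ y ∈ cell Λ, ∑ k ∈ nbIdx, r (y + Λ *ᵥ (fun i => (k i : ℝ))) = m) :
    IntegrableOn (fun x => F x * (b x.1 * r x.2)) strip ∧
    ∫ x in strip, F x * (b x.1 * r x.2) = ∫ x in box Λ, F x * (b x.1 * m) := by
  have hc : Continuous fun x : Pt => b x.1 * r x.2 := by fun_prop
  have hs : HasCompactSupport fun x : Pt => b x.1 * r x.2 := by
    have hrc : HasCompactSupport r :=
      (hasCompactSupport_part hΛ).of_isClosed_subset (isClosed_tsupport _) hrs
    refine HasCompactSupport.of_support_subset_isCompact (hbs.isCompact.prod hrc.isCompact)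
      fun x hx => ⟨subset_tsupport _ (left_ne_zero_of_mul hx),
        subset_tsupport _ (right_ne_zero_of_mul hx)⟩
  refine ⟨hF.integrableOn_mul hΛ hi hc hs, ?_⟩
  rw [hF.setIntegral_strip_mul hΛ hi hc hs (S := nbIdx)]
  · refine setIntegral_congr_fun (measurableSet_box hΛ) fun x hx => ?_
    simp only [shift, ← Finset.mul_sum]
    rw [hm _ hx.2]
  · intro x hx
    rw [image_eq_zero_of_notMem_tsupport fun h => hx (latIdx_mem_of_mem_tsupport (hrs h)),
      mul_zero]

lemma fderiv_tensor {θ : ℝ → ℝ} {r w : (Fin 2 → ℝ) → ℝ} (hθ : ContDiff ℝ ∞ θ)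
    (hr : ContDiff ℝ ∞ r) (hw : ContDiff ℝ ∞ w) (x v : Pt) :
    fderiv ℝ (fun x : Pt => θ x.1 * r x.2 * w x.2) x v =
      w x.2 * (deriv θ x.1 * v.1 * r x.2) + w x.2 * (θ x.1 * fderiv ℝ r x.2 v.2) +
        fderiv ℝ w x.2 v.2 * (θ x.1 * r x.2) := by
  have h1 : HasFDerivAt (fun x : Pt => θ x.1) _ x :=
    (hθ.differentiable (by simp) x.1).hasDerivAt.hasFDerivAt.comp x hasFDerivAt_fst
  have h2 : HasFDerivAt (fun x : Pt => r x.2) _ x :=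
    (hr.differentiable (by simp) x.2).hasFDerivAt.comp x hasFDerivAt_snd
  have h3 : HasFDerivAt (fun x : Pt => w x.2) _ x :=
    (hw.differentiable (by simp) x.2).hasFDerivAt.comp x hasFDerivAt_snd
  have h4 : HasFDerivAt (fun x : Pt => θ x.1 * r x.2 * w x.2) _ x := (h1.mul h2).mul h3
  rw [h4.fderiv]
  simp
  ring

/-- The weak derivative relation tested with a product of a function of `x₃` and a periodic
function of `y`. -/
lemma HasWeakDeriv.integral_box (hΛ : IsUnit Λ.det) {v : Pt} {u g : Pt → ℝ}
    (h : HasWeakDeriv v u g) (hu : LatticePeriodic Λ u) (hui : IntegrableOn u (box Λ))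
    (hgi : IntegrableOn g (box Λ)) {θ : ℝ → ℝ} (hθ : IsTest θ) {w : (Fin 2 → ℝ) → ℝ}
    (hw : ContDiff ℝ ∞ w)
    (hwp : ∀ (k : Fin 2 → ℤ) y, w (y + Λ *ᵥ (fun i => (k i : ℝ))) = w y)
    {w' : (Fin 2 → ℝ) → ℝ} (hw' : ∀ y, fderiv ℝ w y v.2 = w' y) :
    (∫ x in box Λ, u x * w x.2 * (v.1 * deriv θ x.1)) + ∫ x in box Λ, u x * w' x.2 * θ x.1 =
      -∫ x in box Λ, g x * w x.2 * θ x.1 := by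
  have hg := h.periodic hu
  have hwc := hw.continuous
  have hw'c : Continuous w' := by
    have := (hw.continuous_fderiv (by simp)).clm_apply (continuous_const (y := v.2))
    simpa only [hw'] using this
  have hw'p : ∀ (k : Fin 2 → ℤ) y, w' (y + Λ *ᵥ (fun i => (k i : ℝ))) = w' y := fun k y => by
    rw [← hw', ← hw', ← fderiv_comp_add_right]
    simp only [hwp]
  have hper : ∀ {f : Pt → ℝ} {z : (Fin 2 → ℝ) → ℝ}, LatticePeriodic Λ f →
      (∀ (k : Fin 2 → ℤ) y, z (y + Λ *ᵥ (fun i => (k i : ℝ))) = z y) →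
      LatticePeriodic Λ fun x => f x * z x.2 := fun hf hz k => by
    filter_upwards [hf k] with x hx
    simp only [hz] at hx ⊢
    rw [hx]
  have hρ := contDiff_part (Λ := Λ)
  -- A periodic `w` need not have compact support in `y`. The factor `part Λ` makes the product an
  -- admissible test function, and unfolding removes it again.
  set ψ : Pt → ℝ := fun x => θ x.1 * part Λ x.2 * w x.2 with hψ
  have hψs : tsupport ψ ⊆ tsupport θ ×ˢ tsupport (part Λ) := by
    refine closure_minimal (fun x hx => ?_) ((isClosed_tsupport _).prod (isClosed_tsupport _))
    have := left_ne_zero_of_mul hx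
    exact ⟨subset_tsupport _ (left_ne_zero_of_mul this),
      subset_tsupport _ (right_ne_zero_of_mul this)⟩
  have hψc : HasCompactSupport ψ :=
    (hθ.compact.isCompact.prod (hasCompactSupport_part hΛ).isCompact).of_isClosed_subset
      (isClosed_tsupport _) hψs
  have hψd : ContDiff ℝ ∞ ψ :=
    ((hθ.contDiff.comp contDiff_fst).mul (hρ.comp contDiff_snd)).mul (hw.comp contDiff_snd)
  have key := h.integral_eq ψ hψd hψc fun x hx => ⟨hθ.supp (hψs hx).1, mem_univ _⟩
  obtain ⟨i1, e1⟩ := (hper hu hwp).unfold_part hΛ (integrable_mul_mode hΛ hui hwc)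
    (b := fun t => deriv θ t * v.1) (hθ.deriv_continuous.mul continuous_const)
    hθ.compact.deriv.mul_right hρ.continuous subset_rfl
    fun y hy => (sum_part hΛ hy).self_of_nhds
  obtain ⟨i2, e2⟩ := (hper hu hwp).unfold_part hΛ (integrable_mul_mode hΛ hui hwc)
    hθ.contDiff.continuous hθ.compact
    (r := fun y => fderiv ℝ (part Λ) y v.2)
    ((hρ.continuous_fderiv (by simp)).clm_apply continuous_const)
    (closure_minimal (fun y hy => tsupport_fderiv_subset ℝ (subset_tsupport _
      fun h0 => hy (by simp [h0]))) (isClosed_tsupport _))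
    fun y hy => sum_fderiv_part hΛ hy v.2
  obtain ⟨i3, e3⟩ := (hper hu hw'p).unfold_part hΛ (integrable_mul_mode hΛ hui hw'c)
    hθ.contDiff.continuous hθ.compact hρ.continuous subset_rfl
    fun y hy => (sum_part hΛ hy).self_of_nhds
  obtain ⟨i4, e4⟩ := (hper hg hwp).unfold_part hΛ (integrable_mul_mode hΛ hgi hwc)
    hθ.contDiff.continuous hθ.compact hρ.continuous subset_rfl
    fun y hy => (sum_part hΛ hy).self_of_nhds
  have a1 : ∫ x in strip, u x * fderiv ℝ ψ x v =
      (∫ x in strip, u x * w x.2 * (deriv θ x.1 * v.1 * part Λ x.2)) +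
      (∫ x in strip, u x * w x.2 * (θ x.1 * fderiv ℝ (part Λ) x.2 v.2)) +
      ∫ x in strip, u x * w' x.2 * (θ x.1 * part Λ x.2) := by
    have i12 : IntegrableOn (fun x => u x * w x.2 * (deriv θ x.1 * v.1 * part Λ x.2) +
      u x * w x.2 * (θ x.1 * fderiv ℝ (part Λ) x.2 v.2)) strip := i1.add i2
    rw [← integral_add i1 i2, ← integral_add i12 i3]
    congr 1
    ext x
    rw [hψ, fderiv_tensor hθ.contDiff hρ hw, hw']
    ring
  have a2 : ∫ x in strip, g x * ψ x = ∫ x in strip, g x * w x.2 * (θ x.1 * part Λ x.2) := by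
    congr 1
    ext x
    rw [hψ]; ring
  rw [a1, a2, e1, e2, e3, e4] at key
  simp only [mul_one, mul_zero, integral_zero, add_zero] at key
  rw [← key]
  simp only [mul_comm (deriv θ _)]

lemma IsTest.bounded {θ : ℝ → ℝ} (h : IsTest θ) :
    ∃ C, ∀ᵐ t ∂(volume.restrict thick), ‖θ t‖ ≤ C := by
  obtain ⟨C, hC⟩ := h.compact.exists_bound_of_continuous h.contDiff.continuous
  exact ⟨C, Filter.Eventually.of_forall hC⟩

/-- In-plane weak derivatives act on the coefficients by differentiating the mode. -/
lemma HasWeakDeriv.coef_inplane (hΛ : IsUnit Λ.det) {a : Fin 2} {u g : Pt → ℝ}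
    (h : HasWeakDeriv (0, Pi.single a 1) u g) (hu : LatticePeriodic Λ u)
    (hui : IntegrableOn u (box Λ)) (hgi : IntegrableOn g (box Λ)) {w : (Fin 2 → ℝ) → ℝ}
    (hw : ContDiff ℝ ∞ w)
    (hwp : ∀ (k : Fin 2 → ℤ) y, w (y + Λ *ᵥ (fun i => (k i : ℝ))) = w y)
    {w' : (Fin 2 → ℝ) → ℝ} (hw' : ∀ y, fderiv ℝ w y (Pi.single a 1) = w' y) :
    ∀ᵐ t ∂(volume.restrict thick), coef Λ w g t = -coef Λ w' u t := by
  have hw'c : Continuous w' := by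
    have := (hw.continuous_fderiv (by simp)).clm_apply
      (continuous_const (y := (Pi.single a 1 : Fin 2 → ℝ)))
    simpa only [hw'] using this
  have hdet : |Λ.det| ≠ 0 := abs_ne_zero.2 hΛ.ne_zero
  have i1 := integrableOn_coef hΛ hgi hw.continuous
  have i2 := integrableOn_coef hΛ hui hw'c
  have := ae_eq_zero_of_isTest (i1.add i2) fun θ hθ => ?_
  · filter_upwards [this] with t ht
    simp only [Pi.add_apply] at ht
    linarith
  · obtain ⟨C, hC⟩ := hθ.bounded
    have key := h.integral_box hΛ hu hui hgi hθ hw hwp hw'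
    rw [setIntegral_box_coef hΛ hui hw'c hθ.contDiff.continuous hC,
      setIntegral_box_coef hΛ hgi hw.continuous hθ.contDiff.continuous hC] at key
    simp only [zero_mul, mul_zero, integral_zero, zero_add] at key
    simp only [Pi.add_apply, add_mul]
    rw [integral_add (IsTest.integrableOn_mul i1 hθ.contDiff.continuous hθ.compact)
      (IsTest.integrableOn_mul i2 hθ.contDiff.continuous hθ.compact)]
    have : |Λ.det| * ((∫ t in thick, coef Λ w g t * θ t) + ∫ t in thick, coef Λ w' u t * θ t) = 0 := by
      linarith
    exact (mul_eq_zero.1 this).resolve_left hdet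

/-- Transversal weak derivatives commute with taking coefficients. -/
lemma HasWeakDeriv.coef_transversal (hΛ : IsUnit Λ.det) {u g : Pt → ℝ}
    (h : HasWeakDeriv (1, 0) u g) (hu : LatticePeriodic Λ u)
    (hui : IntegrableOn u (box Λ)) (hgi : IntegrableOn g (box Λ)) {w : (Fin 2 → ℝ) → ℝ}
    (hw : ContDiff ℝ ∞ w)
    (hwp : ∀ (k : Fin 2 → ℤ) y, w (y + Λ *ᵥ (fun i => (k i : ℝ))) = w y) :
    ∃ f, AbsContDeriv f (coef Λ w g) ∧ coef Λ w u =ᵐ[volume.restrict thick] f := by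
  have hdet : |Λ.det| ≠ 0 := abs_ne_zero.2 hΛ.ne_zero
  refine exists_absContDeriv (integrableOn_coef hΛ hui hw.continuous)
    (integrableOn_coef hΛ hgi hw.continuous) fun θ hθ => ?_
  obtain ⟨C, hC⟩ := hθ.bounded
  obtain ⟨D, hD⟩ := hθ.compact.deriv.exists_bound_of_continuous hθ.deriv_continuous
  have key := h.integral_box hΛ hu hui hgi hθ hw hwp (w' := fun _ => 0) (fun y => by simp)
  simp only [one_mul, mul_zero, zero_mul, integral_zero, add_zero] at key
  rw [setIntegral_box_coef hΛ hui hw.continuous hθ.deriv_continuous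
      (Filter.Eventually.of_forall hD),
    setIntegral_box_coef hΛ hgi hw.continuous hθ.contDiff.continuous hC, ← mul_neg] at key
  exact mul_left_cancel₀ hdet key

end

section

/-! ### Korn's inequality -/

variable {Λ : Mat2}

lemma modeConst_nonneg (γ κ₀ : ℝ) : 0 ≤ modeConst γ κ₀ := by
  unfold modeConst; positivity

/-- Only the longitudinal component `p = (ξc + ηd)/κ` with `κ = |(ξ, η)|` couples to `q`. For it,
`p'/γ + κq` is the projection of the two shear entries onto `(ξ, η)/κ`, so its square is at most the
sum of their squares. At frequency zero the left side vanishes. -/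
lemma integral_mode_vec_le {γ κ₀ : ℝ} (hγ : 0 < γ) (hκ₀ : 0 < κ₀) {ξ η : ℝ}
    (hξ : ξ ^ 2 + η ^ 2 = 0 ∨ κ₀ ^ 2 ≤ ξ ^ 2 + η ^ 2)
    {c d c' d' q q' : ℝ → ℝ} (hc : AbsContDeriv c c') (hd : AbsContDeriv d d')
    (hq : AbsContDeriv q q') (hc' : MemLp c' 2 (volume.restrict thick))
    (hd' : MemLp d' 2 (volume.restrict thick)) (hq' : MemLp q' 2 (volume.restrict thick)) :
    ∫ t in thick, (ξ ^ 2 + η ^ 2) * q t ^ 2 ≤ modeConst γ κ₀ *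
      ∫ t in thick, ((ξ * c t + η * d t) ^ 2 + (1 / γ * q' t) ^ 2 +
        ((1 / γ * c' t + ξ * q t) ^ 2 + (1 / γ * d' t + η * q t) ^ 2)) := by
  rcases hξ with h0 | h1
  · simp only [h0, zero_mul, integral_zero]
    exact mul_nonneg (modeConst_nonneg _ _) (integral_nonneg fun t => by positivity)
  set κ := Real.sqrt (ξ ^ 2 + η ^ 2) with hκ
  have hκ2 : κ ^ 2 = ξ ^ 2 + η ^ 2 := Real.sq_sqrt (by positivity)
  have hle : κ₀ ≤ κ := Real.le_sqrt_of_sq_le h1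
  have hκ0 : 0 < κ := hκ₀.trans_le hle
  have hp := ((hc.const_mul (ξ / κ)).add (hd.const_mul (η / κ)))
  have hp' := (hc'.const_mul (ξ / κ)).add (hd'.const_mul (η / κ))
  have key := integral_mode_le hγ hκ₀ hle hp hq hp' hq'
  have e : ∀ t, (κ * q t) ^ 2 = (ξ ^ 2 + η ^ 2) * q t ^ 2 := fun t => by rw [mul_pow, hκ2]
  simp only [e] at key
  refine key.trans (mul_le_mul_of_nonneg_left ?_ (modeConst_nonneg _ _))
  have hcL := hc.memLp
  have hdL := hd.memLp
  have hqL := hq.memLp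
  have i1 : IntegrableOn (fun t => (ξ * c t + η * d t) ^ 2 + (1 / γ * q' t) ^ 2 +
        ((1 / γ * c' t + ξ * q t) ^ 2 + (1 / γ * d' t + η * q t) ^ 2)) thick :=
    (((hcL.const_mul ξ).add (hdL.const_mul η)).integrable_sq.add
      (hq'.const_mul (1 / γ)).integrable_sq).add
      (((hc'.const_mul (1 / γ)).add (hqL.const_mul ξ)).integrable_sq.add
        ((hd'.const_mul (1 / γ)).add (hqL.const_mul η)).integrable_sq)
  refine integral_mono_of_nonneg (Filter.Eventually.of_forall fun t => by positivity) i1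
    (Filter.Eventually.of_forall fun t => ?_)
  have e1 : κ * (ξ / κ * c t + η / κ * d t) = ξ * c t + η * d t := by field_simp
  have e2 : (ξ / κ * c' t + η / κ * d' t) / γ + κ * q t =
      (ξ * (1 / γ * c' t + ξ * q t) + η * (1 / γ * d' t + η * q t)) / κ := by
    field_simp
    rw [hκ2]; ring
  have e3 : q' t / γ = 1 / γ * q' t := by ring
  simp only [e1, e2, e3]
  gcongr
  rw [div_pow, div_le_iff₀ (by positivity), hκ2]
  set A := 1 / γ * c' t + ξ * q t
  set B := 1 / γ * d' t + η * q t
  nlinarith [sq_nonneg (ξ * B - η * A)]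

/-- The cross term in `(y s0 + x s1)²` equals `2 (x s0)(y s1)`, a product of diagonal strains, so
both in-plane shear entries are controlled individually. The cross terms of `x s2` with `d0` and of
`y s2` with `d1` have no such form, whence the extra multiple of `(x² + y²) s2²`. -/
lemma grad_le_of_mode (x y s0 s1 s2 d0 d1 d2 : ℝ) :
    (x * s0) ^ 2 + (y * s0) ^ 2 + d0 ^ 2 + ((x * s1) ^ 2 + (y * s1) ^ 2 + d1 ^ 2) +
      ((x * s2) ^ 2 + (y * s2) ^ 2 + d2 ^ 2) ≤
    8 * ((x * s0) ^ 2 + (y * s1) ^ 2 + d2 ^ 2 + 2 * ((y * s0 + x * s1) / 2) ^ 2 +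
      2 * ((x * s2 + d0) / 2) ^ 2 + 2 * ((y * s2 + d1) / 2) ^ 2) +
      3 * ((x ^ 2 + y ^ 2) * s2 ^ 2) := by
  have h1 : 0 ≤ 7 * (x * s0) ^ 2 + 7 * (y * s1) ^ 2 + 8 * ((x * s0) * (y * s1)) := by
    nlinarith [sq_nonneg (x * s0 + y * s1), sq_nonneg (x * s0), sq_nonneg (y * s1)]
  have h2 : ∀ a d : ℝ, 0 ≤ 6 * a ^ 2 + 8 * (a * d) + 3 * d ^ 2 := fun a d => by
    nlinarith [sq_nonneg (3 * a + 2 * d), sq_nonneg a, sq_nonneg d]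
  have h3 := h2 (x * s2) d0
  have h4 := h2 (y * s2) d1
  nlinarith [sq_nonneg (y * s0), sq_nonneg (x * s1), sq_nonneg d2]

/-- The frequencies of the non-constant modes are bounded below. -/
lemma freq_lower (hΛ : IsUnit Λ.det) {CΛ : ℝ} (hC : 0 < CΛ)
    (hub : ∀ ξ : Fin 2 → ℝ, ξ ⬝ᵥ ((Λᵀ * Λ) *ᵥ ξ) ≤ CΛ * (ξ ⬝ᵥ ξ)) {k : Fin 2 → ℤ} (hk : k ≠ 0) :
    (1 / Real.sqrt CΛ) ^ 2 ≤ freq Λ k 0 ^ 2 + freq Λ k 1 ^ 2 := by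
  set c : Fin 2 → ℝ := fun i => (k i : ℝ) with hc
  set z : Fin 2 → ℝ := c ᵥ* Λ⁻¹ with hz
  have hfreq : ∀ a, freq Λ k a = 2 * Real.pi * z a := fun a => rfl
  have hzΛ : z ᵥ* Λ = c := by
    rw [hz, Matrix.vecMul_vecMul, Matrix.nonsing_inv_mul _ hΛ, Matrix.vecMul_one]
  have h1 : z ⬝ᵥ (Λ *ᵥ c) = c ⬝ᵥ c := by rw [Matrix.dotProduct_mulVec, hzΛ]
  have h2 : (Λ *ᵥ c) ⬝ᵥ (Λ *ᵥ c) ≤ CΛ * (c ⬝ᵥ c) := by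
    have := hub c
    rwa [← Matrix.mulVec_mulVec, Matrix.dotProduct_mulVec, Matrix.vecMul_transpose] at this
  have h3 : 1 ≤ c ⬝ᵥ c := by
    have : (1 : ℤ) ≤ k 0 * k 0 + k 1 * k 1 := by
      by_contra hcon
      have a0 : k 0 = 0 := by nlinarith [mul_self_nonneg (k 0), mul_self_nonneg (k 1)]
      have a1 : k 1 = 0 := by nlinarith [mul_self_nonneg (k 0), mul_self_nonneg (k 1)]
      exact hk (by ext i; fin_cases i <;> simpa)
    have h' : ((1 : ℤ) : ℝ) ≤ ((k 0 * k 0 + k 1 * k 1 : ℤ) : ℝ) := by exact_mod_cast this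
    simpa [dotProduct, hc] using h'
  -- Cauchy–Schwarz gives `|c|² = z · Λc ≤ |z| √CΛ |c|`, and a nonzero integer vector has `|c| ≥ 1`.
  -- Of the factor `(2π)²` only that it is at least `1` is used.
  have h4 : (z ⬝ᵥ (Λ *ᵥ c)) ^ 2 ≤ (z ⬝ᵥ z) * ((Λ *ᵥ c) ⬝ᵥ (Λ *ᵥ c)) := by
    generalize Λ *ᵥ c = m
    simp only [dotProduct, Fin.sum_univ_two]
    nlinarith [sq_nonneg (z 0 * m 1 - z 1 * m 0)]
  have hzz : 0 ≤ z ⬝ᵥ z := by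
    simp only [dotProduct, Fin.sum_univ_two]
    exact add_nonneg (mul_self_nonneg _) (mul_self_nonneg _)
  rw [h1] at h4
  have h5 : 1 ≤ (z ⬝ᵥ z) * CΛ := by
    have h6 : (c ⬝ᵥ c) * (c ⬝ᵥ c) ≤ (z ⬝ᵥ z) * CΛ * (c ⬝ᵥ c) := by
      nlinarith [mul_le_mul_of_nonneg_left h2 hzz]
    have := le_of_mul_le_mul_right h6 (by linarith)
    linarith
  have hpi : 1 ≤ (2 * Real.pi) ^ 2 := by nlinarith [Real.pi_gt_three]
  have h7 : freq Λ k 0 ^ 2 + freq Λ k 1 ^ 2 = (2 * Real.pi) ^ 2 * (z ⬝ᵥ z) := by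
    rw [hfreq, hfreq]; simp only [dotProduct, Fin.sum_univ_two]; ring
  rw [h7, div_pow, Real.sq_sqrt hC.le, one_pow, div_le_iff₀ hC]
  nlinarith [mul_nonneg hzz hC.le]

lemma freq_zero (a : Fin 2) : freq Λ 0 a = 0 := by simp [freq]

lemma freq_alternative (hΛ : IsUnit Λ.det) {CΛ : ℝ} (hC : 0 < CΛ)
    (hub : ∀ ξ : Fin 2 → ℝ, ξ ⬝ᵥ ((Λᵀ * Λ) *ᵥ ξ) ≤ CΛ * (ξ ⬝ᵥ ξ)) (k : Fin 2 → ℤ) :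
    freq Λ k 0 ^ 2 + freq Λ k 1 ^ 2 = 0 ∨
      (1 / Real.sqrt CΛ) ^ 2 ≤ freq Λ k 0 ^ 2 + freq Λ k 1 ^ 2 := by
  by_cases hk : k = 0
  · left; subst hk; simp [freq_zero]
  · exact Or.inr (freq_lower hΛ hC hub hk)

/-- The coefficients of a field and its derivatives for one mode. -/
structure ModeData (γ : ℝ) (Λ : Mat2) (k : Fin 2 → ℤ) (φ : Pt → Fin 3 → ℝ)
    (c s : Fin 3 → ℝ → ℝ) : Prop where
  cos_ac : ∀ i, AbsContDeriv (c i) (coef Λ (cosMode Λ k) (weakDeriv (dir 2) fun x => φ x i))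
  sin_ac : ∀ i, AbsContDeriv (s i) (coef Λ (sinMode Λ k) (weakDeriv (dir 2) fun x => φ x i))
  cos_eq : ∀ i, coef Λ (cosMode Λ k) (fun x => φ x i) =ᵐ[volume.restrict thick] c i
  sin_eq : ∀ i, coef Λ (sinMode Λ k) (fun x => φ x i) =ᵐ[volume.restrict thick] s i
  grad_cos : ∀ᵐ t ∂(volume.restrict thick), ∀ i,
    coef Λ (cosMode Λ k) (fun x => scaledGrad γ φ x i 0) t = freq Λ k 0 * s i t ∧
    coef Λ (cosMode Λ k) (fun x => scaledGrad γ φ x i 1) t = freq Λ k 1 * s i t ∧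
    coef Λ (cosMode Λ k) (fun x => scaledGrad γ φ x i 2) t =
      1 / γ * coef Λ (cosMode Λ k) (weakDeriv (dir 2) fun x => φ x i) t
  grad_sin : ∀ᵐ t ∂(volume.restrict thick), ∀ i,
    coef Λ (sinMode Λ k) (fun x => scaledGrad γ φ x i 0) t = -freq Λ k 0 * c i t ∧
    coef Λ (sinMode Λ k) (fun x => scaledGrad γ φ x i 1) t = -freq Λ k 1 * c i t ∧
    coef Λ (sinMode Λ k) (fun x => scaledGrad γ φ x i 2) t =
      1 / γ * coef Λ (sinMode Λ k) (weakDeriv (dir 2) fun x => φ x i) t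

/-- The coefficients of `∂₃φ` are the derivatives of those of `φ`, which therefore have absolutely
continuous representatives `c` and `s`. In-plane derivatives exchange cosine and sine coefficients,
up to sign and a factor of frequency. -/
lemma exists_modeData (hΛ : IsUnit Λ.det) (γ : ℝ) (k : Fin 2 → ℤ) {φ : Pt → Fin 3 → ℝ}
    (h : φ ∈ H1per Λ) : ∃ c s, ModeData γ Λ k φ c s := by
  have hi : ∀ i, IntegrableOn (fun x => φ x i) (box Λ) := fun i =>
    (H1per.memLp h i).integrable (by norm_num)
  have hgi : ∀ i j, IntegrableOn (weakDeriv (dir j) fun x => φ x i) (box Λ) := fun i j =>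
    (H1per.memLp_weakDeriv h i j).integrable (by norm_num)
  have hcos := contDiff_cosMode (Λ := Λ) k
  have hsin := contDiff_sinMode (Λ := Λ) k
  have hcp : ∀ (l : Fin 2 → ℤ) y, cosMode Λ k (y + Λ *ᵥ (fun i => (l i : ℝ))) = cosMode Λ k y :=
    cosMode_add hΛ k
  have hsp : ∀ (l : Fin 2 → ℤ) y, sinMode Λ k (y + Λ *ᵥ (fun i => (l i : ℝ))) = sinMode Λ k y :=
    sinMode_add hΛ k
  choose c hc1 hc2 using fun i => HasWeakDeriv.coef_transversal hΛ (H1per.hasWeakDeriv h i 2)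
    (H1per.periodic h i) (hi i) (hgi i 2) hcos hcp
  choose s hs1 hs2 using fun i => HasWeakDeriv.coef_transversal hΛ (H1per.hasWeakDeriv h i 2)
    (H1per.periodic h i) (hi i) (hgi i 2) hsin hsp
  have d0 : dir 0 = (0, Pi.single 0 1) := rfl
  have d1 : dir 1 = (0, Pi.single 1 1) := rfl
  have g0 : ∀ i, (fun x => scaledGrad γ φ x i 0) = weakDeriv (dir 0) fun x => φ x i := fun i => by
    ext x; simp [scaledGrad]
  have g1 : ∀ i, (fun x => scaledGrad γ φ x i 1) = weakDeriv (dir 1) fun x => φ x i := fun i => by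
    ext x; simp [scaledGrad]
  have g2 : ∀ i, (fun x => scaledGrad γ φ x i 2) =
      fun x => 1 / γ * weakDeriv (dir 2) (fun x => φ x i) x := fun i => by
    ext x; simp [scaledGrad]
  have neg_mul_coef : ∀ (a : ℝ) (w : (Fin 2 → ℝ) → ℝ) (f : Pt → ℝ) (t : ℝ),
      coef Λ (fun y => a * w y) f t = a * coef Λ w f t := fun a w f t => by
    simp only [coef, mul_left_comm _ a]
    rw [integral_const_mul]; ring
  have r := fun i => (H1per.hasWeakDeriv h i 0).coef_inplane hΛ (H1per.periodic h i) (hi i)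
    (hgi i 0) hcos hcp (w' := fun y => (-freq Λ k 0) * sinMode Λ k y)
    fun y => by rw [fderiv_cosMode]; ring
  have r1 := fun i => (H1per.hasWeakDeriv h i 1).coef_inplane hΛ (H1per.periodic h i) (hi i)
    (hgi i 1) hcos hcp (w' := fun y => (-freq Λ k 1) * sinMode Λ k y)
    fun y => by rw [fderiv_cosMode]; ring
  have r2 := fun i => (H1per.hasWeakDeriv h i 0).coef_inplane hΛ (H1per.periodic h i) (hi i)
    (hgi i 0) hsin hsp (w' := fun y => freq Λ k 0 * cosMode Λ k y)
    fun y => by rw [fderiv_sinMode]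
  have r3 := fun i => (H1per.hasWeakDeriv h i 1).coef_inplane hΛ (H1per.periodic h i) (hi i)
    (hgi i 1) hsin hsp (w' := fun y => freq Λ k 1 * cosMode Λ k y)
    fun y => by rw [fderiv_sinMode]
  refine ⟨c, s, hc1, hs1, hc2, hs2, ?_, ?_⟩
  · filter_upwards [ae_all_iff.2 r, ae_all_iff.2 r1, ae_all_iff.2 hs2] with t h1 h2 h3 i
    rw [g0, g1, g2, h1 i, h2 i, neg_mul_coef, neg_mul_coef, coef_const_mul, h3 i]
    exact ⟨by ring, by ring, rfl⟩
  · filter_upwards [ae_all_iff.2 r2, ae_all_iff.2 r3, ae_all_iff.2 hc2] with t h1 h2 h3 i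
    rw [g0, g1, g2, h1 i, h2 i, neg_mul_coef, neg_mul_coef, coef_const_mul, h3 i]
    exact ⟨by ring, by ring, rfl⟩

/-- The squared coefficients of a matrix field for one mode. -/
def modeSq (Λ : Mat2) (k : Fin 2 → ℤ) (F : Pt → Mat3) (t : ℝ) : ℝ :=
  ∑ i, ∑ j, (coef Λ (cosMode Λ k) (fun x => F x i j) t ^ 2 +
    coef Λ (sinMode Λ k) (fun x => F x i j) t ^ 2)

lemma integrable_modeSq (hΛ : IsUnit Λ.det) {F : Pt → Mat3}
    (hF : ∀ i j, MemLp (fun x => F x i j) 2 (volume.restrict (box Λ))) (k : Fin 2 → ℤ) :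
    IntegrableOn (modeSq Λ k F) thick :=
  integrable_finsetSum _ fun i _ => integrable_finsetSum _ fun j _ =>
    (memLp_coef_modes hΛ (hF i j) k).1.integrable_sq.add
      (memLp_coef_modes hΛ (hF i j) k).2.integrable_sq

lemma hasSum_modeSq (hΛ : IsUnit Λ.det) {F : Pt → Mat3}
    (hF : ∀ i j, MemLp (fun x => F x i j) 2 (volume.restrict (box Λ))) :
    HasSum (fun k => ∫ t in thick, modeSq Λ k F t)
      (|Λ.det|⁻¹ * ∫ x in box Λ, frob (F x) (F x)) := by
  have h := hasSum_sum (s := (Finset.univ : Finset (Fin 3))) fun i _ =>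
    hasSum_sum (s := (Finset.univ : Finset (Fin 3))) fun j _ => hasSum_box hΛ (hF i j)
  have hi : ∀ k i j, IntegrableOn (fun t => coef Λ (cosMode Λ k) (fun x => F x i j) t ^ 2 +
    coef Λ (sinMode Λ k) (fun x => F x i j) t ^ 2) thick := fun k i j =>
    (memLp_coef_modes hΛ (hF i j) k).1.integrable_sq.add
      (memLp_coef_modes hΛ (hF i j) k).2.integrable_sq
  have e1 : ∀ k, ∫ t in thick, modeSq Λ k F t = ∑ i, ∑ j,
      ∫ t in thick, (coef Λ (cosMode Λ k) (fun x => F x i j) t ^ 2 +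
        coef Λ (sinMode Λ k) (fun x => F x i j) t ^ 2) := fun k => by
    simp only [modeSq]
    rw [integral_finsetSum _ fun i _ => integrable_finsetSum _ fun j _ => hi k i j]
    exact Finset.sum_congr rfl fun i _ => integral_finsetSum _ fun j _ => hi k i j
  have e2 : |Λ.det|⁻¹ * ∫ x in box Λ, frob (F x) (F x) =
      ∑ i, ∑ j, |Λ.det|⁻¹ * ∫ x in box Λ, (F x i j) ^ 2 := by
    simp only [frob, ← pow_two, ← Finset.mul_sum]
    rw [integral_finsetSum _ fun i _ => integrable_finsetSum _ fun j _ => (hF i j).integrable_sq]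
    congr 1
    exact Finset.sum_congr rfl fun i _ =>
      integral_finsetSum _ fun j _ => (hF i j).integrable_sq
  simp only [e1]
  rw [e2]; exact h

lemma memLp_symPart {F : Pt → Mat3}
    (hF : ∀ i j, MemLp (fun x => F x i j) 2 (volume.restrict (box Λ))) (i j : Fin 3) :
    MemLp (fun x => symPart (F x) i j) 2 (volume.restrict (box Λ)) :=
  ((hF i j).add (hF j i)).const_mul (1 / 2)

lemma coef_symPart (hΛ : IsUnit Λ.det) {F : Pt → Mat3}
    (hF : ∀ i j, MemLp (fun x => F x i j) 2 (volume.restrict (box Λ)))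
    {w : (Fin 2 → ℝ) → ℝ} (hw : Continuous w) :
    ∀ᵐ t ∂(volume.restrict thick), ∀ i j, coef Λ w (fun x => symPart (F x) i j) t =
      (coef Λ w (fun x => F x i j) t + coef Λ w (fun x => F x j i) t) / 2 := by
  refine ae_all_iff.2 fun i => ae_all_iff.2 fun j => ?_
  filter_upwards [coef_add hΛ (hF i j) (hF j i) hw] with t ht
  have : (fun x => symPart (F x) i j) = fun x => (1 / 2) * (F x i j + F x j i) := by
    ext x; simp [symPart]
  rw [this, coef_const_mul, ht]; ring

/-- The constant in Korn's inequality. -/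
def kornConst (γ CΛ : ℝ) : ℝ := 8 + 15 * modeConst γ (1 / Real.sqrt CΛ)

/-- `NC` and `NS` are the contributions of the cosine and sine coefficients of the strain. The
pointwise bound leaves `s 2` and `c 2`. The mode estimate couples `s 2` with `c 0`, `c 1`, and `c 2`
with `s 0`, `s 1`; each coupling draws on entries of both `NC` and `NS`, so the two are estimated
together. -/
lemma integral_modeSq_le (hΛ : IsUnit Λ.det) {γ CΛ : ℝ} (hγ : 0 < γ) (hC : 0 < CΛ)
    (hub : ∀ ξ : Fin 2 → ℝ, ξ ⬝ᵥ ((Λᵀ * Λ) *ᵥ ξ) ≤ CΛ * (ξ ⬝ᵥ ξ)) {φ : Pt → Fin 3 → ℝ}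
    (h : φ ∈ H1per Λ) (k : Fin 2 → ℤ) :
    ∫ t in thick, modeSq Λ k (scaledGrad γ φ) t ≤
      kornConst γ CΛ * ∫ t in thick, modeSq Λ k (fun x => symPart (scaledGrad γ φ x)) t := by
  obtain ⟨c, s, hM⟩ := exists_modeData hΛ γ k h
  have hG := fun i j => H1per.memLp_scaledGrad (γ := γ) h i j
  have hE := memLp_symPart hG
  set x := freq Λ k 0 with hx
  set y := freq Λ k 1 with hy
  set κ₀ := 1 / Real.sqrt CΛ with hκ₀
  have hκ₀pos : 0 < κ₀ := by positivity
  set N := modeSq Λ k (fun x => symPart (scaledGrad γ φ x)) with hN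
  have hNi : IntegrableOn N thick := integrable_modeSq hΛ hE k
  have hdc : ∀ i, MemLp (coef Λ (cosMode Λ k) (weakDeriv (dir 2) fun x => φ x i)) 2
      (volume.restrict thick) := fun i => (memLp_coef_modes hΛ (H1per.memLp_weakDeriv h i 2) k).1
  have hds : ∀ i, MemLp (coef Λ (sinMode Λ k) (weakDeriv (dir 2) fun x => φ x i)) 2
      (volume.restrict thick) := fun i => (memLp_coef_modes hΛ (H1per.memLp_weakDeriv h i 2) k).2
  set dc : Fin 3 → ℝ → ℝ := fun i => coef Λ (cosMode Λ k) (weakDeriv (dir 2) fun x => φ x i)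
  set ds : Fin 3 → ℝ → ℝ := fun i => coef Λ (sinMode Λ k) (weakDeriv (dir 2) fun x => φ x i)
  set NC : ℝ → ℝ := fun t => (x * s 0 t) ^ 2 + (y * s 1 t) ^ 2 + (1 / γ * dc 2 t) ^ 2 +
    2 * ((y * s 0 t + x * s 1 t) / 2) ^ 2 + 2 * ((x * s 2 t + 1 / γ * dc 0 t) / 2) ^ 2 +
    2 * ((y * s 2 t + 1 / γ * dc 1 t) / 2) ^ 2 with hNC
  set NS : ℝ → ℝ := fun t => (-x * c 0 t) ^ 2 + (-y * c 1 t) ^ 2 + (1 / γ * ds 2 t) ^ 2 +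
    2 * ((-y * c 0 t + -x * c 1 t) / 2) ^ 2 + 2 * ((-x * c 2 t + 1 / γ * ds 0 t) / 2) ^ 2 +
    2 * ((-y * c 2 t + 1 / γ * ds 1 t) / 2) ^ 2 with hNS
  have hNeq : ∀ᵐ t ∂(volume.restrict thick), N t = NC t + NS t := by
    filter_upwards [hM.grad_cos, hM.grad_sin,
      coef_symPart hΛ hG (contDiff_cosMode (Λ := Λ) k).continuous,
      coef_symPart hΛ hG (contDiff_sinMode (Λ := Λ) k).continuous] with t h1 h2 h3 h4
    simp only [hN, modeSq, h3, h4, Fin.sum_univ_three, (h1 _).1, (h1 _).2.1, (h1 _).2.2,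
      (h2 _).1, (h2 _).2.1, (h2 _).2.2, hNC, hNS, dc, ds, ← hx, ← hy]
    ring
  have hgrad : ∀ᵐ t ∂(volume.restrict thick), modeSq Λ k (scaledGrad γ φ) t ≤
      8 * N t + (3 * ((x ^ 2 + y ^ 2) * s 2 t ^ 2) + 3 * ((x ^ 2 + y ^ 2) * c 2 t ^ 2)) := by
    filter_upwards [hM.grad_cos, hM.grad_sin, hNeq] with t h1 h2 h3
    have k1 := grad_le_of_mode x y (s 0 t) (s 1 t) (s 2 t) (1 / γ * dc 0 t) (1 / γ * dc 1 t)
      (1 / γ * dc 2 t)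
    have k2 := grad_le_of_mode (-x) (-y) (c 0 t) (c 1 t) (c 2 t) (1 / γ * ds 0 t)
      (1 / γ * ds 1 t) (1 / γ * ds 2 t)
    rw [neg_sq, neg_sq] at k2
    rw [h3]
    simp only [modeSq, Fin.sum_univ_three, (h1 _).1, (h1 _).2.1, (h1 _).2.2,
      (h2 _).1, (h2 _).2.1, (h2 _).2.2]
    simp only [hNC, hNS]
    linarith
  have halt := freq_alternative hΛ hC hub k
  rw [← hx, ← hy, ← hκ₀] at halt
  have m1 := integral_mode_vec_le hγ hκ₀pos halt (hM.cos_ac 0) (hM.cos_ac 1) (hM.sin_ac 2)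
    (hdc 0) (hdc 1) (hds 2)
  have m2 := integral_mode_vec_le hγ hκ₀pos (ξ := -x) (η := -y) (by simpa only [neg_sq] using halt)
    (hM.sin_ac 0) (hM.sin_ac 1) (hM.cos_ac 2) (hds 0) (hds 1) (hdc 2)
  rw [neg_sq, neg_sq] at m2
  have L : ∀ {f f' : ℝ → ℝ}, AbsContDeriv f f' → MemLp f 2 (volume.restrict thick) :=
    fun hf => hf.memLp
  have i1 : IntegrableOn (fun t => (x * c 0 t + y * c 1 t) ^ 2 + (1 / γ * ds 2 t) ^ 2 +
      ((1 / γ * dc 0 t + x * s 2 t) ^ 2 + (1 / γ * dc 1 t + y * s 2 t) ^ 2)) thick :=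
    ((((L (hM.cos_ac 0)).const_mul x).add ((L (hM.cos_ac 1)).const_mul y)).integrable_sq.add
      ((hds 2).const_mul (1 / γ)).integrable_sq).add
      ((((hdc 0).const_mul (1 / γ)).add ((L (hM.sin_ac 2)).const_mul x)).integrable_sq.add
        (((hdc 1).const_mul (1 / γ)).add ((L (hM.sin_ac 2)).const_mul y)).integrable_sq)
  have i2 : IntegrableOn (fun t => (-x * s 0 t + -y * s 1 t) ^ 2 + (1 / γ * dc 2 t) ^ 2 +
      ((1 / γ * ds 0 t + -x * c 2 t) ^ 2 + (1 / γ * ds 1 t + -y * c 2 t) ^ 2)) thick :=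
    ((((L (hM.sin_ac 0)).const_mul (-x)).add
      ((L (hM.sin_ac 1)).const_mul (-y))).integrable_sq.add
      ((hdc 2).const_mul (1 / γ)).integrable_sq).add
      ((((hds 0).const_mul (1 / γ)).add ((L (hM.cos_ac 2)).const_mul (-x))).integrable_sq.add
        (((hds 1).const_mul (1 / γ)).add ((L (hM.cos_ac 2)).const_mul (-y))).integrable_sq)
  -- The `5` here and the `3` in `hgrad` make the `15` in `kornConst`.
  have m3 : (∫ t in thick, ((x * c 0 t + y * c 1 t) ^ 2 + (1 / γ * ds 2 t) ^ 2 +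
      ((1 / γ * dc 0 t + x * s 2 t) ^ 2 + (1 / γ * dc 1 t + y * s 2 t) ^ 2))) +
      (∫ t in thick, ((-x * s 0 t + -y * s 1 t) ^ 2 + (1 / γ * dc 2 t) ^ 2 +
      ((1 / γ * ds 0 t + -x * c 2 t) ^ 2 + (1 / γ * ds 1 t + -y * c 2 t) ^ 2))) ≤
      5 * ∫ t in thick, N t := by
    rw [← integral_add i1 i2, ← integral_const_mul]
    refine integral_mono_ae (i1.add i2) (hNi.const_mul 5) ?_
    filter_upwards [hNeq] with t ht
    rw [ht]
    simp only [hNC, hNS]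
    nlinarith [sq_nonneg (x * c 0 t - y * c 1 t), sq_nonneg (x * s 0 t - y * s 1 t),
      sq_nonneg (x * s 0 t), sq_nonneg (y * s 1 t), sq_nonneg (x * c 0 t), sq_nonneg (y * c 1 t),
      sq_nonneg (y * s 0 t + x * s 1 t), sq_nonneg (y * c 0 t + x * c 1 t),
      sq_nonneg (x * s 2 t + 1 / γ * dc 0 t), sq_nonneg (y * s 2 t + 1 / γ * dc 1 t),
      sq_nonneg (-x * c 2 t + 1 / γ * ds 0 t), sq_nonneg (-y * c 2 t + 1 / γ * ds 1 t),
      sq_nonneg (1 / γ * dc 2 t), sq_nonneg (1 / γ * ds 2 t)]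
  have j1 : IntegrableOn (fun t => 3 * ((x ^ 2 + y ^ 2) * s 2 t ^ 2)) thick :=
    ((L (hM.sin_ac 2)).integrable_sq.const_mul _).const_mul _
  have j2 : IntegrableOn (fun t => 3 * ((x ^ 2 + y ^ 2) * c 2 t ^ 2)) thick :=
    ((L (hM.cos_ac 2)).integrable_sq.const_mul _).const_mul _
  have j12 : IntegrableOn (fun t => 3 * ((x ^ 2 + y ^ 2) * s 2 t ^ 2) +
    3 * ((x ^ 2 + y ^ 2) * c 2 t ^ 2)) thick := j1.add j2
  have fin := integral_mono_ae (integrable_modeSq hΛ hG k) ((hNi.const_mul 8).add j12) hgrad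
  have e : ∫ t in thick, (8 * N t + (3 * ((x ^ 2 + y ^ 2) * s 2 t ^ 2) +
      3 * ((x ^ 2 + y ^ 2) * c 2 t ^ 2))) = 8 * (∫ t in thick, N t) +
      (3 * (∫ t in thick, (x ^ 2 + y ^ 2) * s 2 t ^ 2) +
        3 * ∫ t in thick, (x ^ 2 + y ^ 2) * c 2 t ^ 2) := by
    rw [integral_add (hNi.const_mul 8) j12, integral_add j1 j2, integral_const_mul 8 N,
      integral_const_mul 3 fun t => (x ^ 2 + y ^ 2) * s 2 t ^ 2,
      integral_const_mul 3 fun t => (x ^ 2 + y ^ 2) * c 2 t ^ 2]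
  have fin' := fin.trans_eq e
  have hmc := modeConst_nonneg γ κ₀
  have m4 := mul_le_mul_of_nonneg_left m3 hmc
  rw [mul_add] at m4
  rw [kornConst, ← hκ₀]
  linarith

/-- **Korn's inequality** for periodic functions on the layer. -/
lemma korn (hΛ : IsUnit Λ.det) {γ CΛ : ℝ} (hγ : 0 < γ) (hC : 0 < CΛ)
    (hub : ∀ ξ : Fin 2 → ℝ, ξ ⬝ᵥ ((Λᵀ * Λ) *ᵥ ξ) ≤ CΛ * (ξ ⬝ᵥ ξ)) {φ : Pt → Fin 3 → ℝ}
    (h : φ ∈ H1per Λ) :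
    ∫ x in box Λ, frob (scaledGrad γ φ x) (scaledGrad γ φ x) ≤ kornConst γ CΛ *
      ∫ x in box Λ, frob (symPart (scaledGrad γ φ x)) (symPart (scaledGrad γ φ x)) := by
  have hG := fun i j => H1per.memLp_scaledGrad (γ := γ) h i j
  have h1 := hasSum_modeSq hΛ hG
  have h2 := (hasSum_modeSq hΛ (memLp_symPart hG)).mul_left (kornConst γ CΛ)
  have h3 := hasSum_le (fun k => integral_modeSq_le hΛ hγ hC hub h k) h1 h2
  have hdet : 0 < |Λ.det|⁻¹ := inv_pos.2 (abs_pos.2 hΛ.ne_zero)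
  rw [mul_left_comm] at h3
  exact le_of_mul_le_mul_left h3 hdet

lemma cosMode_zero (y : Fin 2 → ℝ) : cosMode Λ 0 y = 1 := by
  simp [cosMode, phase, freq_zero]

lemma sinMode_zero (y : Fin 2 → ℝ) : sinMode Λ 0 y = 0 := by
  simp [sinMode, phase, freq_zero]

/-- **Poincaré's inequality** for periodic functions with vanishing mean. -/
lemma poincare (hΛ : IsUnit Λ.det) {γ CΛ : ℝ} (hγ : 0 < γ) (hC : 0 < CΛ)
    (hub : ∀ ξ : Fin 2 → ℝ, ξ ⬝ᵥ ((Λᵀ * Λ) *ᵥ ξ) ≤ CΛ * (ξ ⬝ᵥ ξ)) {φ : Pt → Fin 3 → ℝ}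
    (h : φ ∈ H1per Λ) (i : Fin 3) (h0 : ∫ x in box Λ, φ x i = 0) :
    ∫ x in box Λ, φ x i ^ 2 ≤ (CΛ + γ ^ 2) *
      ∫ x in box Λ, frob (scaledGrad γ φ x) (scaledGrad γ φ x) := by
  have hG := fun i j => H1per.memLp_scaledGrad (γ := γ) h i j
  have h1 := hasSum_box hΛ (H1per.memLp h i)
  have h2 := (hasSum_modeSq hΛ hG).mul_left (CΛ + γ ^ 2)
  have hdet : 0 < |Λ.det|⁻¹ := inv_pos.2 (abs_pos.2 hΛ.ne_zero)
  refine le_of_mul_le_mul_left ((hasSum_le (fun k => ?_) h1 h2).trans_eq (mul_left_comm _ _ _)) hdet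
  obtain ⟨c, s, hM⟩ := exists_modeData hΛ γ k h
  have hL := fun j => memLp_coef_modes hΛ (hG i j) k
  have hrow : ∀ t, coef Λ (cosMode Λ k) (fun x => scaledGrad γ φ x i 0) t ^ 2 +
      coef Λ (sinMode Λ k) (fun x => scaledGrad γ φ x i 0) t ^ 2 +
      (coef Λ (cosMode Λ k) (fun x => scaledGrad γ φ x i 1) t ^ 2 +
      coef Λ (sinMode Λ k) (fun x => scaledGrad γ φ x i 1) t ^ 2) +
      (coef Λ (cosMode Λ k) (fun x => scaledGrad γ φ x i 2) t ^ 2 +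
      coef Λ (sinMode Λ k) (fun x => scaledGrad γ φ x i 2) t ^ 2) ≤
      modeSq Λ k (scaledGrad γ φ) t := by
    intro t
    have := Finset.single_le_sum (s := (Finset.univ : Finset (Fin 3)))
      (f := fun i => ∑ j, (coef Λ (cosMode Λ k) (fun x => scaledGrad γ φ x i j) t ^ 2 +
      coef Λ (sinMode Λ k) (fun x => scaledGrad γ φ x i j) t ^ 2))
      (fun i _ => Finset.sum_nonneg fun j _ => by positivity) (Finset.mem_univ i)
    simp only [Fin.sum_univ_three] at this ⊢
    simpa only [modeSq, Fin.sum_univ_three] using this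
  have hMi := integrable_modeSq hΛ hG k
  have hi2 := (memLp_coef_modes hΛ (H1per.memLp h i) k).1.integrable_sq.add
    (memLp_coef_modes hΛ (H1per.memLp h i) k).2.integrable_sq
  have hMnn : 0 ≤ ∫ t in thick, modeSq Λ k (scaledGrad γ φ) t :=
    integral_nonneg fun t => le_trans (by positivity) (hrow t)
  -- For the constant mode the coefficient has mean zero, and the Poincaré inequality on the
  -- interval applies, with `γ²` from unscaling `∂₃`. For other modes the in-plane gradient carries
  -- the frequency, whose lower bound yields `CΛ`.
  by_cases hk : k = 0
  · subst hk
    have hmean : ∫ t in thick, c i t = 0 := by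
      rw [← integral_congr_ae (hM.cos_eq i)]
      have hb := setIntegral_box_coef hΛ ((H1per.memLp h i).integrable (by norm_num))
        (contDiff_cosMode (Λ := Λ) 0).continuous (b := fun _ => 1) continuous_const (C := 1)
        (Filter.Eventually.of_forall fun t => by simp)
      simp only [cosMode_zero, mul_one, h0] at hb
      have hdet' : |Λ.det| ≠ 0 := abs_ne_zero.2 hΛ.ne_zero
      rcases mul_eq_zero.1 hb.symm with h' | h'
      · exact absurd h' hdet'
      · simpa only [funext (cosMode_zero (Λ := Λ))] using h'
    have hdc := (memLp_coef_modes hΛ (H1per.memLp_weakDeriv h i 2) 0).1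
    have hp := (hM.cos_ac i).integral_sq_le hdc hmean
    have e1 : ∫ t in thick, (coef Λ (cosMode Λ 0) (fun x => φ x i) t ^ 2 +
        coef Λ (sinMode Λ 0) (fun x => φ x i) t ^ 2) = ∫ t in thick, c i t ^ 2 := by
      refine integral_congr_ae ?_
      filter_upwards [hM.cos_eq i] with t ht
      rw [ht]
      simp [coef, sinMode_zero]
    rw [e1]
    refine hp.trans ?_
    rw [← integral_const_mul]
    refine integral_mono_ae hdc.integrable_sq (hMi.const_mul _) ?_
    filter_upwards [hM.grad_cos] with t ht
    have h3 := hrow t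
    rw [(ht i).2.2] at h3
    set d := coef Λ (cosMode Λ 0) (weakDeriv (dir 2) fun x => φ x i) t
    have h4 : (1 / γ * d) ^ 2 ≤ modeSq Λ 0 (scaledGrad γ φ) t := by
      refine le_trans ?_ h3
      have : ∀ a b e f g z : ℝ, z ^ 2 ≤ a ^ 2 + b ^ 2 + (e ^ 2 + f ^ 2) + (z ^ 2 + g ^ 2) :=
        fun a b e f g z => by
          linarith [sq_nonneg a, sq_nonneg b, sq_nonneg e, sq_nonneg f, sq_nonneg g]
      exact this _ _ _ _ _ _
    have h5 : d ^ 2 = γ ^ 2 * (1 / γ * d) ^ 2 := by field_simp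
    have h6 : 0 ≤ (1 / γ * d) ^ 2 := sq_nonneg _
    rw [h5]
    nlinarith [mul_le_mul_of_nonneg_left h4 (sq_nonneg γ), mul_nonneg hC.le (h6.trans h4)]
  · have hlow := freq_lower hΛ hC hub hk
    rw [div_pow, Real.sq_sqrt hC.le, one_pow, div_le_iff₀ hC] at hlow
    rw [← integral_const_mul]
    refine integral_mono_ae hi2 (hMi.const_mul _) ?_
    filter_upwards [hM.grad_cos, hM.grad_sin, hM.cos_eq i, hM.sin_eq i] with t h1 h2 h3 h4
    have h5 := hrow t
    rw [(h1 i).1, (h1 i).2.1, (h2 i).1, (h2 i).2.1] at h5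
    rw [h3, h4]
    set x := freq Λ k 0
    set y := freq Λ k 1
    have h6 : (x ^ 2 + y ^ 2) * (c i t ^ 2 + s i t ^ 2) ≤ modeSq Λ k (scaledGrad γ φ) t := by
      refine le_trans ?_ h5
      have : ∀ a b : ℝ, (x ^ 2 + y ^ 2) * (c i t ^ 2 + s i t ^ 2) ≤ (x * s i t) ^ 2 +
          (-x * c i t) ^ 2 + ((y * s i t) ^ 2 + (-y * c i t) ^ 2) + (a ^ 2 + b ^ 2) :=
        fun a b => by nlinarith [sq_nonneg a, sq_nonneg b]
      exact this _ _
    have h7 : 0 ≤ c i t ^ 2 + s i t ^ 2 := by positivity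
    nlinarith [mul_le_mul_of_nonneg_left h6 hC.le, mul_le_mul_of_nonneg_right hlow h7,
      mul_nonneg (sq_nonneg γ) ((mul_nonneg (by positivity : 0 ≤ x ^ 2 + y ^ 2) h7).trans h6)]

/-- In-plane derivatives of periodic functions are orthogonal to functions of `x₃`. -/
lemma integral_inplane_mul (hΛ : IsUnit Λ.det) {γ : ℝ} {φ : Pt → Fin 3 → ℝ} (h : φ ∈ H1per Λ)
    (i : Fin 3) (a : Fin 2) {b : ℝ → ℝ} (hb : Continuous b) {C : ℝ}
    (hC : ∀ᵐ t ∂(volume.restrict thick), ‖b t‖ ≤ C) :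
    ∫ x in box Λ, scaledGrad γ φ x i a.castSucc * b x.1 = 0 := by
  have hi : IntegrableOn (fun x => φ x i) (box Λ) := (H1per.memLp h i).integrable (by norm_num)
  have hgi := (H1per.memLp_weakDeriv h i a.castSucc).integrable (by norm_num : (1 : ENNReal) ≤ 2)
  have hd : dir a.castSucc = (0, Pi.single a 1) := by fin_cases a <;> rfl
  have hw := H1per.hasWeakDeriv h i a.castSucc
  have e : ∀ x, scaledGrad γ φ x i a.castSucc =
      weakDeriv (dir a.castSucc) (fun x => φ x i) x * 1 := fun x => by
    have : a.castSucc ≠ (2 : Fin 3) := by fin_cases a <;> decide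
    simp [scaledGrad, this]
  -- The constant mode has derivative zero, so the corresponding coefficient of an in-plane
  -- derivative vanishes.
  have h0 : ∀ᵐ t ∂(volume.restrict thick),
      coef Λ (fun _ => 1) (weakDeriv (dir a.castSucc) fun x => φ x i) t =
        -coef Λ (fun _ => 0) (fun x => φ x i) t := by
    refine HasWeakDeriv.coef_inplane (a := a) hΛ ?_ (H1per.periodic h i) hi hgi contDiff_const
      (fun _ _ => rfl) fun y => by simp
    rw [← hd]; exact hw
  simp only [e]
  rw [setIntegral_box_coef hΛ (w := fun _ => 1) hgi continuous_const hb hC]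
  rw [integral_congr_ae (g := fun _ => 0)]
  · simp
  · filter_upwards [h0] with t ht
    rw [ht]; simp [coef]

end

section

/-! ### The quadratic form and its polarization -/

variable {Λ : Mat2} {α β : ℝ} {q : Mat3 → ℝ}

lemma frob_self_nonneg {n : ℕ} (A : Matrix (Fin n) (Fin n) ℝ) : 0 ≤ frob A A :=
  Finset.sum_nonneg fun _ _ => Finset.sum_nonneg fun _ _ => mul_self_nonneg _

lemma symPart_of_isSymm {A : Mat3} (h : A.IsSymm) : symPart A = A := by
  rw [symPart, h.eq, ← two_smul ℝ A, smul_smul]; norm_num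

lemma symPart_isSymm (A : Mat3) : (symPart A).IsSymm := by
  rw [Matrix.IsSymm, symPart, Matrix.transpose_smul, Matrix.transpose_add,
    Matrix.transpose_transpose, add_comm]

lemma iota_isSymm {G : Mat2} (h : G.IsSymm) : (iota G).IsSymm := by
  have h01 : G 1 0 = G 0 1 := h.apply 0 1
  ext i j
  fin_cases i <;> fin_cases j <;> simp [iota, h01]

lemma symPart_add (A B : Mat3) : symPart (A + B) = symPart A + symPart B := by
  ext i j; simp [symPart]; ring

lemma symPart_smul (c : ℝ) (A : Mat3) : symPart (c • A) = c • symPart A := by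
  ext i j; simp [symPart]; ring

lemma iota_add (G H : Mat2) : iota (G + H) = iota G + iota H := by
  ext i j; fin_cases i <;> fin_cases j <;> simp [iota]

lemma iota_smul (c : ℝ) (G : Mat2) : iota (c • G) = c • iota G := by
  ext i j; fin_cases i <;> fin_cases j <;> simp [iota]

/-- Half the polar form. `Q x` is a quadratic form only for almost every `x`, so all algebra with
`pairing` is done pointwise through such a `b` under the integral. -/
lemma MemQClass.exists_bilin (h : MemQClass α β q) :
    ∃ b : LinearMap.BilinForm ℝ Mat3, (∀ F G, pairing q F G = b F G) ∧ (∀ F G, b F G = b G F) ∧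
      ∀ F, b F F = q F := by
  obtain ⟨⟨q', hq⟩, -⟩ := h
  refine ⟨(1 / 2 : ℝ) • q'.polarBilin, fun F G => ?_, fun F G => ?_, fun F => ?_⟩
  · simp only [pairing, ← hq, LinearMap.smul_apply, QuadraticMap.polarBilin_apply_apply,
      QuadraticMap.polar, smul_eq_mul]
    ring
  · simp only [LinearMap.smul_apply, QuadraticMap.polarBilin_apply_apply,
      QuadraticMap.polar_comm]
  · simp only [LinearMap.smul_apply, QuadraticMap.polarBilin_apply_apply, QuadraticMap.polar_self,
      smul_eq_mul, ← hq]
    simp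

lemma MemQClass.nonneg (hα : 0 ≤ α) (h : MemQClass α β q) (F : Mat3) : 0 ≤ q F :=
  (mul_nonneg hα (frob_self_nonneg _)).trans (h.2 F).1

/-- Nonnegativity of `q (F + G)` and `q (F - G)`. -/
lemma MemQClass.abs_pairing_le (hα : 0 ≤ α) (h : MemQClass α β q) (F G : Mat3) :
    |pairing q F G| ≤ (q F + q G) / 2 := by
  obtain ⟨b, hb, hs, hd⟩ := h.exists_bilin
  have h1 := h.nonneg hα (F + G)
  have h2 := h.nonneg hα (F - G)
  rw [← hd] at h1 h2
  simp only [map_add, map_sub, LinearMap.add_apply, LinearMap.sub_apply, hd] at h1 h2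
  rw [hs G F] at h1 h2
  rw [hb, abs_le]
  constructor <;> linarith

/-- Fields which are square integrable on the representative volume element. -/
def SqInt (Λ : Mat2) (F : Pt → Mat3) : Prop :=
  ∀ i j, MemLp (fun x => F x i j) 2 (volume.restrict (box Λ))

lemma SqInt.add {F G : Pt → Mat3} (hF : SqInt Λ F) (hG : SqInt Λ G) :
    SqInt Λ (fun x => F x + G x) := fun i j => (hF i j).add (hG i j)

lemma SqInt.smul {F : Pt → Mat3} (c : ℝ) (hF : SqInt Λ F) : SqInt Λ (fun x => c • F x) :=
  fun i j => (hF i j).const_mul c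

lemma SqInt.congr {F G : Pt → Mat3} (hF : SqInt Λ F) (h : F =ᵐ[volume.restrict (box Λ)] G) :
    SqInt Λ G := fun i j => (hF i j).ae_eq (by filter_upwards [h] with x hx; rw [hx])

lemma SqInt.integrable_frob {F : Pt → Mat3} (hF : SqInt Λ F) :
    IntegrableOn (fun x => frob (F x) (F x)) (box Λ) :=
  integrable_finsetSum _ fun i _ => integrable_finsetSum _ fun j _ =>
    (hF i j).integrable_mul (hF i j)

variable {Q : Pt → Mat3 → ℝ}

lemma AdmissibleForm.ae_box (hQ : AdmissibleForm α β Λ Q) :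
    ∀ᵐ x ∂(volume.restrict (box Λ)), MemQClass α β (Q x) :=
  ae_restrict_of_ae_restrict_of_subset box_subset_strip hQ.memClass

lemma AdmissibleForm.aemeasurable (hQ : AdmissibleForm α β Λ Q) (G : Mat3) :
    AEMeasurable (fun x => Q x G) (volume.restrict (box Λ)) := by
  have h1 : AEMeasurable (fun x => Q x G) (volume.restrict strip) := by
    refine aemeasurable_restrict_of_measurable_subtype measurableSet_strip ?_
    exact hQ.borel.comp (measurable_id.prodMk
      (measurable_const : Measurable fun _ : strip => fun i j => G i j))
  exact h1.mono_measure (Measure.restrict_mono box_subset_strip le_rfl)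

lemma linearMap_eq_sum_single {V : Type*} [AddCommGroup V] [Module ℝ V] (f : Mat3 →ₗ[ℝ] V)
    (A : Mat3) : f A = ∑ i, ∑ j, A i j • f (Matrix.single i j 1) := by
  conv_lhs => rw [Matrix.matrix_eq_sum_single A]
  rw [map_sum]
  refine Finset.sum_congr rfl fun i _ => ?_
  rw [map_sum]
  refine Finset.sum_congr rfl fun j _ => ?_
  rw [← map_smul, Matrix.smul_single, smul_eq_mul, mul_one]

/-- Measurability of `x ↦ Q x G` for fixed `G` suffices: almost everywhere, bilinearity expands the
pairing in matrix units, with the entries of the fields as coefficients. -/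
lemma AdmissibleForm.aestronglyMeasurable_pairing (hQ : AdmissibleForm α β Λ Q)
    {F G : Pt → Mat3} (hF : SqInt Λ F) (hG : SqInt Λ G) :
    AEStronglyMeasurable (fun x => pairing (Q x) (F x) (G x)) (volume.restrict (box Λ)) := by
  have h1 : AEStronglyMeasurable (fun x => ∑ i, ∑ j, ∑ k, ∑ l,
      F x i j * (G x k l * pairing (Q x) (Matrix.single i j 1) (Matrix.single k l 1)))
      (volume.restrict (box Λ)) := by
    refine Finset.aestronglyMeasurable_fun_sum _ fun i _ =>
      Finset.aestronglyMeasurable_fun_sum _ fun j _ =>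
      Finset.aestronglyMeasurable_fun_sum _ fun k _ =>
      Finset.aestronglyMeasurable_fun_sum _ fun l _ => ?_
    refine (hF i j).1.mul ((hG k l).1.mul (AEMeasurable.aestronglyMeasurable ?_))
    exact (((hQ.aemeasurable _).sub (hQ.aemeasurable _)).sub (hQ.aemeasurable _)).div_const 2
  refine h1.congr ?_
  filter_upwards [hQ.ae_box] with x hx
  obtain ⟨b, hb, -, -⟩ := hx.exists_bilin
  simp only [hb]
  rw [linearMap_eq_sum_single b (F x)]
  simp only [LinearMap.sum_apply, LinearMap.smul_apply,
    linearMap_eq_sum_single (b _) (G x), smul_eq_mul, Finset.mul_sum]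

lemma AdmissibleForm.integrable_pairing (hα : 0 ≤ α) (hQ : AdmissibleForm α β Λ Q)
    {F G : Pt → Mat3} (hF : SqInt Λ F) (hG : SqInt Λ G) :
    IntegrableOn (fun x => pairing (Q x) (F x) (G x)) (box Λ) := by
  have iF : IntegrableOn (fun x => frob (symPart (F x)) (symPart (F x))) (box Λ) :=
    SqInt.integrable_frob (memLp_symPart hF)
  have iG : IntegrableOn (fun x => frob (symPart (G x)) (symPart (G x))) (box Λ) :=
    SqInt.integrable_frob (memLp_symPart hG)
  refine (((iF.const_mul β).add (iG.const_mul β)).div_const 2).mono'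
    (hQ.aestronglyMeasurable_pairing hF hG) ?_
  filter_upwards [hQ.ae_box] with x hx
  rw [Real.norm_eq_abs]
  refine (hx.abs_pairing_le hα _ _).trans ?_
  have h1 := (hx.2 (F x)).2
  have h2 := (hx.2 (G x)).2
  simp only [Pi.add_apply]
  linarith

/-- The bilinear form `∫_{□_Λ} 𝕃 F : G`. -/
def energy (Λ : Mat2) (Q : Pt → Mat3 → ℝ) (F G : Pt → Mat3) : ℝ :=
  ∫ x in box Λ, pairing (Q x) (F x) (G x)

lemma energy_congr {F F' G G' : Pt → Mat3} (hF : F =ᵐ[volume.restrict (box Λ)] F')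
    (hG : G =ᵐ[volume.restrict (box Λ)] G') : energy Λ Q F G = energy Λ Q F' G' := by
  refine integral_congr_ae ?_
  filter_upwards [hF, hG] with x h1 h2
  rw [h1, h2]

lemma energy_comm (hQ : AdmissibleForm α β Λ Q) (F G : Pt → Mat3) :
    energy Λ Q F G = energy Λ Q G F := by
  refine integral_congr_ae ?_
  filter_upwards [hQ.ae_box] with x hx
  obtain ⟨b, hb, hs, -⟩ := hx.exists_bilin
  rw [hb, hb, hs]

lemma energy_add_left (hα : 0 ≤ α) (hQ : AdmissibleForm α β Λ Q) {F F' G : Pt → Mat3}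
    (hF : SqInt Λ F) (hF' : SqInt Λ F') (hG : SqInt Λ G) :
    energy Λ Q (fun x => F x + F' x) G = energy Λ Q F G + energy Λ Q F' G := by
  rw [energy, energy, energy,
    ← integral_add (hQ.integrable_pairing hα hF hG) (hQ.integrable_pairing hα hF' hG)]
  refine integral_congr_ae ?_
  filter_upwards [hQ.ae_box] with x hx
  obtain ⟨b, hb, -, -⟩ := hx.exists_bilin
  simp only [hb, map_add, LinearMap.add_apply]

lemma energy_smul_left (hQ : AdmissibleForm α β Λ Q) (c : ℝ) (F G : Pt → Mat3) :
    energy Λ Q (fun x => c • F x) G = c * energy Λ Q F G := by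
  rw [energy, energy, ← integral_const_mul]
  refine integral_congr_ae ?_
  filter_upwards [hQ.ae_box] with x hx
  obtain ⟨b, hb, -, -⟩ := hx.exists_bilin
  simp only [hb, map_smul, LinearMap.smul_apply, smul_eq_mul]

lemma energy_sub_left (hα : 0 ≤ α) (hQ : AdmissibleForm α β Λ Q) {F F' G : Pt → Mat3}
    (hF : SqInt Λ F) (hF' : SqInt Λ F') (hG : SqInt Λ G) :
    energy Λ Q (fun x => F x - F' x) G = energy Λ Q F G - energy Λ Q F' G := by
  rw [energy, energy, energy,
    ← integral_sub (hQ.integrable_pairing hα hF hG) (hQ.integrable_pairing hα hF' hG)]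
  refine integral_congr_ae ?_
  filter_upwards [hQ.ae_box] with x hx
  obtain ⟨b, hb, -, -⟩ := hx.exists_bilin
  simp only [hb, map_sub, LinearMap.sub_apply]

lemma energy_add_right (hα : 0 ≤ α) (hQ : AdmissibleForm α β Λ Q) {F G G' : Pt → Mat3}
    (hF : SqInt Λ F) (hG : SqInt Λ G) (hG' : SqInt Λ G') :
    energy Λ Q F (fun x => G x + G' x) = energy Λ Q F G + energy Λ Q F G' := by
  rw [energy_comm hQ, energy_add_left hα hQ hG hG' hF, energy_comm hQ G, energy_comm hQ G']

lemma energy_smul_right (hQ : AdmissibleForm α β Λ Q) (c : ℝ) (F G : Pt → Mat3) :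
    energy Λ Q F (fun x => c • G x) = c * energy Λ Q F G := by
  rw [energy_comm hQ, energy_smul_left hQ, energy_comm hQ]

lemma energy_sum_left (hα : 0 ≤ α) (hQ : AdmissibleForm α β Λ Q) {ι : Type*} (s : Finset ι)
    {F : ι → Pt → Mat3} {G : Pt → Mat3} (hF : ∀ i, SqInt Λ (F i)) (hG : SqInt Λ G) :
    energy Λ Q (fun x => ∑ i ∈ s, F i x) G = ∑ i ∈ s, energy Λ Q (F i) G := by
  simp only [energy]
  rw [← integral_finsetSum _ fun i _ => hQ.integrable_pairing hα (hF i) hG]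
  refine integral_congr_ae ?_
  filter_upwards [hQ.ae_box] with x hx
  obtain ⟨b, hb, -, -⟩ := hx.exists_bilin
  simp only [hb, map_sum, LinearMap.sum_apply]

lemma energy_self (hQ : AdmissibleForm α β Λ Q) (F : Pt → Mat3) :
    energy Λ Q F F = ∫ x in box Λ, Q x (F x) := by
  refine integral_congr_ae ?_
  filter_upwards [hQ.ae_box] with x hx
  obtain ⟨b, hb, -, hd⟩ := hx.exists_bilin
  rw [hb, hd]

lemma energy_self_nonneg (hα : 0 ≤ α) (hQ : AdmissibleForm α β Λ Q) (F : Pt → Mat3) :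
    0 ≤ energy Λ Q F F := by
  rw [energy_self hQ]
  refine integral_nonneg_of_ae ?_
  filter_upwards [hQ.ae_box] with x hx using hx.nonneg hα _

/-- The bounds on `Q` see only `symPart`, which does nothing to a symmetric field. -/
lemma le_energy_self (hα : 0 ≤ α) (hQ : AdmissibleForm α β Λ Q) {F : Pt → Mat3}
    (hF : SqInt Λ F) (hs : ∀ᵐ x ∂(volume.restrict (box Λ)), (F x).IsSymm) :
    α * ∫ x in box Λ, frob (F x) (F x) ≤ energy Λ Q F F := by
  rw [← integral_const_mul]
  refine integral_mono_ae (hF.integrable_frob.const_mul α) (hQ.integrable_pairing hα hF hF) ?_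
  filter_upwards [hQ.ae_box, hs] with x hx hsx
  obtain ⟨b, hb, -, hd⟩ := hx.exists_bilin
  have := (hx.2 (F x)).1
  rw [symPart_of_isSymm hsx] at this
  simp only [hb, hd]
  exact this

lemma energy_self_le (hα : 0 ≤ α) (hQ : AdmissibleForm α β Λ Q) {F : Pt → Mat3}
    (hF : SqInt Λ F) (hs : ∀ᵐ x ∂(volume.restrict (box Λ)), (F x).IsSymm) :
    energy Λ Q F F ≤ β * ∫ x in box Λ, frob (F x) (F x) := by
  rw [← integral_const_mul]
  refine integral_mono_ae (hQ.integrable_pairing hα hF hF) (hF.integrable_frob.const_mul β) ?_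
  filter_upwards [hQ.ae_box, hs] with x hx hsx
  obtain ⟨b, hb, -, hd⟩ := hx.exists_bilin
  have := (hx.2 (F x)).2
  rw [symPart_of_isSymm hsx] at this
  simp only [hb, hd]
  exact this

lemma innerH_eq (F G : Pt → Mat3) : innerH Λ Q F G = |Λ.det|⁻¹ * energy Λ Q F G := by
  rw [innerH, setAverage_eq, volume_real_box, smul_eq_mul, energy]

/-! ### Strains -/

variable {γ : ℝ}

lemma SqInt.of_continuous {F : Pt → Mat3} (hΛ : IsUnit Λ.det) (hF : ∀ i j, Continuous fun x => F x i j) :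
    SqInt Λ F := by
  intro i j
  obtain ⟨R, hR⟩ := isBounded_cell Λ
  obtain ⟨C, hC⟩ := ((isCompact_Icc (a := (-(1 / 2) : ℝ)) (b := 1 / 2)).prod
    (isCompact_closedBall (0 : Fin 2 → ℝ) R)).exists_bound_of_continuousOn (hF i j).continuousOn
  refine MemLp.of_bound (hF i j).aestronglyMeasurable C ?_
  filter_upwards [ae_restrict_mem (measurableSet_box hΛ)] with x hx
  exact hC x ⟨Ioo_subset_Icc_self hx.1, by simpa using hR _ hx.2⟩

lemma sqInt_iota (hΛ : IsUnit Λ.det) (G M : Mat2) :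
    SqInt Λ (fun x => iota (x.1 • G + M)) := by
  refine SqInt.of_continuous hΛ fun i j => ?_
  fin_cases i <;> fin_cases j <;> simp [iota] <;> fun_prop

lemma sqInt_symGrad {φ : Pt → Fin 3 → ℝ} (h : φ ∈ H1per Λ) :
    SqInt Λ (fun x => symPart (scaledGrad γ φ x)) :=
  memLp_symPart fun i j => H1per.memLp_scaledGrad h i j

lemma sqInt_strain (hΛ : IsUnit Λ.det) (G M : Mat2) {φ : Pt → Fin 3 → ℝ} (h : φ ∈ H1per Λ) :
    SqInt Λ (strain γ G M φ) :=
  (sqInt_iota hΛ G M).add (sqInt_symGrad h)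

lemma strain_isSymm {G M : Mat2} (hG : G.IsSymm) (hM : M.IsSymm) (φ : Pt → Fin 3 → ℝ) (x : Pt) :
    (strain γ G M φ x).IsSymm :=
  (iota_isSymm ((hG.smul _).add hM)).add (symPart_isSymm _)

lemma integral_box_fst (hΛ : IsUnit Λ.det) {b : ℝ → ℝ} (hb : Continuous b) {C : ℝ}
    (hC : ∀ᵐ t ∂(volume.restrict thick), ‖b t‖ ≤ C) :
    ∫ x in box Λ, b x.1 = |Λ.det| * ∫ t in thick, b t := by
  have h := setIntegral_box_coef hΛ (f := fun _ => 1) (w := fun _ => 1) (integrable_const 1)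
    continuous_const hb hC
  have e : ∀ t, coef Λ (fun _ => 1) (fun _ => 1) t = 1 := fun t => by
    have hne : |Λ.det| ≠ 0 := abs_ne_zero.2 hΛ.ne_zero
    simp only [coef, mul_one]
    rw [setIntegral_const, Measure.real, volume_cell, ENNReal.toReal_ofReal (abs_nonneg _)]
    simp [inv_mul_cancel₀ hne]
  simpa only [e, one_mul, mul_one] using h

lemma bounded_affine (a b : ℝ) : ∀ᵐ t ∂(volume.restrict thick), ‖a * t + b‖ ≤ |a| + |b| := by
  filter_upwards [ae_restrict_mem measurableSet_thick] with t ht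
  have h1 : |t| ≤ 1 := abs_le.2 ⟨by linarith [ht.1], by linarith [ht.2]⟩
  rw [Real.norm_eq_abs]
  refine (abs_add_le _ _).trans ?_
  rw [abs_mul]
  nlinarith [abs_nonneg a]

/-- The squared norm of a strain splits off the part which is affine in `x₃`. -/
lemma integral_frob_strain (hΛ : IsUnit Λ.det) (G M : Mat2) {φ : Pt → Fin 3 → ℝ}
    (h : φ ∈ H1per Λ) :
    ∫ x in box Λ, frob (strain γ G M φ x) (strain γ G M φ x) =
      |Λ.det| * (frob G G / 12 + frob M M) +
      ∫ x in box Λ, frob (symPart (scaledGrad γ φ x)) (symPart (scaledGrad γ φ x)) := by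
  have hg := fun i j => H1per.memLp_scaledGrad (γ := γ) h i j
  -- The cross terms between the affine part and the gradient contain only in-plane derivatives of
  -- in-plane components, each multiplied by a function of `x₃`.
  have hz : ∀ i (a : Fin 2) (c d : ℝ), ∫ x in box Λ,
      scaledGrad γ φ x i a.castSucc * (c * x.1 + d) = 0 := fun i a c d =>
    integral_inplane_mul hΛ h i a (b := fun t => c * t + d) (by fun_prop) (bounded_affine c d)
  have hzi : ∀ i (a : Fin 2) (c d : ℝ), IntegrableOn (fun x =>
      scaledGrad γ φ x i a.castSucc * (c * x.1 + d)) (box Λ) := fun i a c d => by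
    refine Integrable.mul_bdd (c := |c| + |d|) ((hg i a.castSucc).integrable (by norm_num))
      (by fun_prop) ?_
    rw [restrict_box]
    exact Measure.quasiMeasurePreserving_fst.ae (bounded_affine c d)
  have hpt : ∀ x : Pt, frob (strain γ G M φ x) (strain γ G M φ x) =
      frob (symPart (scaledGrad γ φ x)) (symPart (scaledGrad γ φ x)) +
      ((∑ a : Fin 2, ∑ b : Fin 2,
        (scaledGrad γ φ x a.castSucc b.castSucc * (G a b * x.1 + M a b) +
        scaledGrad γ φ x b.castSucc a.castSucc * (G a b * x.1 + M a b))) +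
      (frob G G * (x.1 * x.1) + (2 * frob G M * x.1 + frob M M))) := by
    intro x
    simp only [frob, strain, symPart, iota, Fin.sum_univ_three, Fin.sum_univ_two, Matrix.add_apply,
      Matrix.smul_apply, Matrix.transpose_apply, smul_eq_mul]
    simp
    ring
  have hadd : ∀ a b : Fin 2, IntegrableOn (fun x =>
      scaledGrad γ φ x a.castSucc b.castSucc * (G a b * x.1 + M a b) +
        scaledGrad γ φ x b.castSucc a.castSucc * (G a b * x.1 + M a b)) (box Λ) := fun a b =>
    (hzi _ _ _ _).add (hzi _ _ _ _)
  have i1 := (sqInt_symGrad (γ := γ) h).integrable_frob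
  have i2 : IntegrableOn (fun x => ∑ a : Fin 2, ∑ b : Fin 2,
      (scaledGrad γ φ x a.castSucc b.castSucc * (G a b * x.1 + M a b) +
        scaledGrad γ φ x b.castSucc a.castSucc * (G a b * x.1 + M a b))) (box Λ) :=
    integrable_finsetSum _ fun a _ => integrable_finsetSum _ fun b _ => hadd a b
  have hC : ∀ᵐ t ∂(volume.restrict thick),
      ‖frob G G * (t * t) + (2 * frob G M * t + frob M M)‖ ≤
        |frob G G| + (|2 * frob G M| + |frob M M|) := by
    filter_upwards [ae_restrict_mem measurableSet_thick, bounded_affine (2 * frob G M) (frob M M)]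
      with t ht h1
    have h2 : |t * t| ≤ 1 := by
      rw [abs_mul]
      have : |t| ≤ 1 := abs_le.2 ⟨by linarith [ht.1], by linarith [ht.2]⟩
      nlinarith [abs_nonneg t]
    refine (norm_add_le _ _).trans (add_le_add ?_ h1)
    rw [Real.norm_eq_abs, abs_mul]
    nlinarith [abs_nonneg (frob G G)]
  have i3 : IntegrableOn (fun x : Pt => frob G G * (x.1 * x.1) +
      (2 * frob G M * x.1 + frob M M)) (box Λ) := by
    refine Measure.integrableOn_of_bounded (M := |frob G G| + (|2 * frob G M| + |frob M M|))
      (by rw [volume_box]; exact ENNReal.ofReal_ne_top) (by fun_prop) ?_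
    rw [restrict_box]
    exact Measure.quasiMeasurePreserving_fst.ae hC
  simp only [hpt]
  have i23 : IntegrableOn (fun x : Pt => (∑ a : Fin 2, ∑ b : Fin 2,
        (scaledGrad γ φ x a.castSucc b.castSucc * (G a b * x.1 + M a b) +
        scaledGrad γ φ x b.castSucc a.castSucc * (G a b * x.1 + M a b))) +
      (frob G G * (x.1 * x.1) + (2 * frob G M * x.1 + frob M M))) (box Λ) := i2.add i3
  rw [integral_add i1 i23, integral_add i2 i3, add_comm]
  congr 1
  rw [integral_finsetSum _ fun a _ => integrable_finsetSum _ fun b _ => hadd a b]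
  have e1 : ∀ a : Fin 2, ∫ x in box Λ, ∑ b : Fin 2,
      (scaledGrad γ φ x a.castSucc b.castSucc * (G a b * x.1 + M a b) +
        scaledGrad γ φ x b.castSucc a.castSucc * (G a b * x.1 + M a b)) = 0 := fun a => by
    rw [integral_finsetSum _ fun b _ => hadd a b]
    refine Finset.sum_eq_zero fun b _ => ?_
    rw [integral_add (hzi _ _ _ _) (hzi _ _ _ _), hz, hz, add_zero]
  simp only [e1, Finset.sum_const_zero, zero_add]
  rw [integral_box_fst hΛ (b := fun t => frob G G * (t * t) + (2 * frob G M * t + frob M M))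
    (by fun_prop) hC, setIntegral_thick]
  congr 1
  -- Over the symmetric interval the term with `frob G M` integrates to zero, and `∫ t² = 1/12`
  -- gives the weight of `frob G G`.
  have e2 : ∀ t : ℝ, HasDerivAt (fun t => frob G G * t ^ 3 / 3 + frob G M * t ^ 2 + frob M M * t)
      (frob G G * (t * t) + (2 * frob G M * t + frob M M)) t := fun t => by
    have := ((((hasDerivAt_pow 3 t).const_mul (frob G G)).div_const 3).add
      ((hasDerivAt_pow 2 t).const_mul (frob G M))).add ((hasDerivAt_id t).const_mul (frob M M))
    convert! this using 1
    push_cast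
    simp
    ring
  rw [intervalIntegral.integral_eq_sub_of_hasDerivAt (fun t _ => e2 t)
    (Continuous.intervalIntegrable (by fun_prop) _ _)]
  ring

end

section

/-! ### Existence of correctors -/

variable {Λ : Mat2} {α β γ : ℝ} {Q : Pt → Mat3 → ℝ} {φ : Pt → Fin 3 → ℝ}

/-- The Lax–Milgram theorem for bilinear maps given without continuity structure. -/
lemma exists_forall_eq_of_coercive {V : Type*} [NormedAddCommGroup V] [InnerProductSpace ℝ V]
    [CompleteSpace V] (b : V →ₗ[ℝ] V →ₗ[ℝ] ℝ) (l : V →ₗ[ℝ] ℝ) {K K' c : ℝ}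
    (hb : ∀ v w, |b v w| ≤ K * ‖v‖ * ‖w‖) (hl : ∀ w, |l w| ≤ K' * ‖w‖) (hc : 0 < c)
    (hco : ∀ v, c * ‖v‖ * ‖v‖ ≤ b v v) : ∃ v, ∀ w, b v w = l w := by
  have hB : IsCoercive (b.mkContinuous₂ K hb) := ⟨c, hc, hco⟩
  refine ⟨hB.continuousLinearEquivOfBilin.symm
    ((InnerProductSpace.toDual ℝ V).symm (l.mkContinuous K' hl)), fun w => ?_⟩
  have h := hB.continuousLinearEquivOfBilin_apply (hB.continuousLinearEquivOfBilin.symm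
    ((InnerProductSpace.toDual ℝ V).symm (l.mkContinuous K' hl))) w
  rw [ContinuousLinearEquiv.apply_symm_apply, InnerProductSpace.toDual_symm_apply] at h
  exact h.symm

/-- Cauchy–Schwarz for a semidefinite form: the energy of `F + tG` is a nonnegative polynomial in
`t`, so its discriminant is nonpositive. -/
lemma abs_energy_le_sqrt (hα : 0 ≤ α) (hQ : AdmissibleForm α β Λ Q) {F G : Pt → Mat3}
    (hF : SqInt Λ F) (hG : SqInt Λ G) :
    |energy Λ Q F G| ≤ √(energy Λ Q F F) * √(energy Λ Q G G) := by
  have h : ∀ t : ℝ, 0 ≤ energy Λ Q G G * (t * t) + 2 * energy Λ Q F G * t + energy Λ Q F F := by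
    intro t
    have h1 := energy_self_nonneg hα hQ (fun x => F x + t • G x)
    rw [energy_add_left hα hQ hF (hG.smul t) (hF.add (hG.smul t)), energy_smul_left hQ,
      energy_add_right hα hQ hF hF (hG.smul t), energy_add_right hα hQ hG hF (hG.smul t),
      energy_smul_right hQ, energy_smul_right hQ, energy_comm hQ G F] at h1
    linarith
  have hd := discrim_le_zero h
  rw [discrim] at hd
  rw [← Real.sqrt_mul (energy_self_nonneg hα hQ F)]
  refine Real.abs_le_sqrt ?_
  nlinarith

lemma frob_symPart_le (A : Mat3) : frob (symPart A) (symPart A) ≤ frob A A := by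
  simp only [frob, symPart, Fin.sum_univ_three, Matrix.add_apply, Matrix.smul_apply,
    Matrix.transpose_apply, smul_eq_mul]
  nlinarith [sq_nonneg (A 0 1 - A 1 0), sq_nonneg (A 0 2 - A 2 0), sq_nonneg (A 1 2 - A 2 1)]

lemma hasWeakDeriv_const (v : Pt) (c : ℝ) : HasWeakDeriv v (fun _ => c) (fun _ => 0) where
  locInt := locallyIntegrableOn_const c
  locInt_deriv := locallyIntegrableOn_zero
  integral_eq ψ hψ hs hss := by
    have hd := continuous_fderiv_apply_const hψ v
    have hds := hasCompactSupport_fderiv_apply hs v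
    have : (volume : Measure Pt).IsAddHaarMeasure :=
      inferInstanceAs ((volume : Measure ℝ).prod (volume : Measure (Fin 2 → ℝ))).IsAddHaarMeasure
    have h := integral_mul_fderiv_eq_neg_fderiv_mul_of_integrable (μ := (volume : Measure Pt))
      (f := fun _ => c) (g := ψ) (v := v) (by simp)
      ((hd.integrable_of_hasCompactSupport hds).const_mul c)
      ((hψ.continuous.integrable_of_hasCompactSupport hs).const_mul c) (by simp)
      (fun x _ => (hψ.differentiable (by simp)).differentiableAt)
    rw [setIntegral_eq_integral_of_forall_compl_eq_zero, h]
    · simp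
    · intro x hx
      rw [image_eq_zero_of_notMem_tsupport fun h' => hx (hss (tsupport_fderiv_apply_subset ψ v h')),
        mul_zero]

lemma const_mem_H1per (hΛ : IsUnit Λ.det) (c : Fin 3 → ℝ) : (fun _ => c) ∈ H1per Λ :=
  mem_H1per hΛ (g := fun _ _ _ => 0)
    (fun _ => fun _ => Filter.Eventually.of_forall fun _ => rfl)
    (fun _ => memLp_const _) (fun _ _ => MemLp.zero) (fun _ _ => hasWeakDeriv_const _ _)

lemma scaledGrad_const (c : Fin 3 → ℝ) :
    scaledGrad γ (fun _ => c) =ᵐ[volume.restrict strip] fun _ => 0 := by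
  filter_upwards [scaledGrad_ae_eq (γ := γ) (φ := fun _ => c) (g := fun _ _ _ => 0)
    fun _ _ => hasWeakDeriv_const _ _] with x hx
  rw [hx]; ext i j; simp

/-- Subtracting the mean does not change the scaled gradient. -/
lemma exists_mean_zero (hΛ : IsUnit Λ.det) (γ : ℝ) (h : φ ∈ H1per Λ) :
    ∃ φ' ∈ H1per Λ, (∀ i, ∫ x in box Λ, φ' x i = 0) ∧
      scaledGrad γ φ' =ᵐ[volume.restrict strip] scaledGrad γ φ := by
  set c : Fin 3 → ℝ := fun i => -(⨍ x in box Λ, φ x i) with hc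
  have hcm := const_mem_H1per hΛ c
  refine ⟨φ + fun _ => c, H1per.add_mem hΛ h hcm, fun i => ?_, ?_⟩
  · have hne : |Λ.det| ≠ 0 := abs_ne_zero.2 hΛ.ne_zero
    simp only [Pi.add_apply]
    rw [integral_add ((H1per.memLp h i).integrable (by norm_num)) (integrable_const _),
      setIntegral_const, volume_real_box, hc]
    simp only [setAverage_eq, volume_real_box, smul_eq_mul]
    field_simp
    ring
  · filter_upwards [scaledGrad_add (γ := γ) h hcm, scaledGrad_const (γ := γ) c] with x h1 h2
    rw [h1, h2, add_zero]

lemma strain_eq (G M : Mat2) (φ : Pt → Fin 3 → ℝ) (x : Pt) :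
    strain γ G M φ x = iota (x.1 • G) + (iota M + symPart (scaledGrad γ φ x)) := by
  rw [strain, iota_add, add_assoc]

lemma strain_zero (M : Mat2) (φ : Pt → Fin 3 → ℝ) (x : Pt) :
    strain γ 0 M φ x = iota M + symPart (scaledGrad γ φ x) := by
  rw [strain, smul_zero, zero_add]

lemma strain_add {G G' M M' : Mat2} {φ' : Pt → Fin 3 → ℝ} (h : φ ∈ H1per Λ) (h' : φ' ∈ H1per Λ) :
    strain γ (G + G') (M + M') (φ + φ') =ᵐ[volume.restrict strip]
      fun x => strain γ G M φ x + strain γ G' M' φ' x := by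
  filter_upwards [scaledGrad_add (γ := γ) h h'] with x hx
  simp only [strain, hx, symPart_add, smul_add, iota_add]
  abel

lemma strain_smul {G M : Mat2} (c : ℝ) (h : φ ∈ H1per Λ) :
    strain γ (c • G) (c • M) (c • φ) =ᵐ[volume.restrict strip] fun x => c • strain γ G M φ x := by
  filter_upwards [scaledGrad_smul (γ := γ) c h] with x hx
  simp only [strain, hx, symPart_smul, smul_add, iota_add, iota_smul, smul_comm x.1 c]

lemma ae_box_of_strip {p : Pt → Prop} (h : ∀ᵐ x ∂(volume.restrict strip), p x) :
    ∀ᵐ x ∂(volume.restrict (box Λ)), p x :=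
  ae_restrict_of_ae_restrict_of_subset box_subset_strip h

end

/-! ### The Hilbert space of pairs of matrices and displacements -/

section

variable {Λ : Mat2} {α β γ : ℝ} {Q : Pt → Mat3 → ℝ} {φ : Pt → Fin 3 → ℝ}

/-- The Hilbert space whose elements `(M, (u, g))` collect a matrix, the three components of a
displacement and the nine entries of its scaled gradient. -/
abbrev CorrSpace (Λ : Mat2) : Type :=
  WithLp 2 (EuclideanSpace ℝ (Fin 2 × Fin 2) ×
    PiLp 2 (fun _ : Fin 3 ⊕ Fin 3 × Fin 3 => Lp ℝ 2 ((volume : Measure Pt).restrict (box Λ))))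

/-- The projection of `CorrSpace Λ` onto the component with index `s`. -/
def sndCoord (Λ : Mat2) (s : Fin 3 ⊕ Fin 3 × Fin 3) :
    CorrSpace Λ →L[ℝ] Lp ℝ 2 ((volume : Measure Pt).restrict (box Λ)) :=
  (PiLp.proj 2 _ s).comp (WithLp.sndL 2 ℝ _ _)

/-- `w` is the element of `CorrSpace Λ` belonging to the pair `(M, φ)`. -/
structure Represents (γ : ℝ) (Λ : Mat2) (w : CorrSpace Λ) (M : Mat2) (φ : Pt → Fin 3 → ℝ) :
    Prop where
  coeff : ∀ a b, w.fst (a, b) = M a b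
  symm : M.IsSymm
  mem : φ ∈ H1per Λ
  mean_zero : ∀ i, ∫ x in box Λ, φ x i = 0
  val : ∀ i, sndCoord Λ (Sum.inl i) w =ᵐ[volume.restrict (box Λ)] fun x => φ x i
  grad : ∀ i j, sndCoord Λ (Sum.inr (i, j)) w =ᵐ[volume.restrict (box Λ)]
    fun x => scaledGrad γ φ x i j

lemma exists_represents {M : Mat2} (hM : M.IsSymm) (h : φ ∈ H1per Λ)
    (h0 : ∀ i, ∫ x in box Λ, φ x i = 0) : ∃ w, Represents γ Λ w M φ := by
  refine ⟨WithLp.toLp 2 (WithLp.toLp 2 fun p => M p.1 p.2, WithLp.toLp 2 fun s =>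
    Sum.elim (fun i => (H1per.memLp h i).toLp _)
      (fun p => (H1per.memLp_scaledGrad (γ := γ) h p.1 p.2).toLp _) s), ?_, hM, h, h0, ?_, ?_⟩
  · intro a b; rfl
  · intro i; exact (H1per.memLp h i).coeFn_toLp
  · intro i j; exact (H1per.memLp_scaledGrad (γ := γ) h i j).coeFn_toLp

/-- The elements of `CorrSpace Λ` which come from a symmetric matrix and a displacement with mean
zero. -/
def corrSubmodule (γ : ℝ) (hΛ : IsUnit Λ.det) : Submodule ℝ (CorrSpace Λ) where
  carrier := {w | ∃ M φ, Represents γ Λ w M φ}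
  zero_mem' := by
    refine ⟨0, 0, fun _ _ => rfl, Matrix.transpose_zero, zero_mem_H1per hΛ, fun i => by simp,
      fun i => Lp.coeFn_zero _ _ _, fun i j => (Lp.coeFn_zero _ _ _).trans ?_⟩
    filter_upwards [ae_box_of_strip (scaledGrad_zero (γ := γ))] with x hx
    rw [hx]; rfl
  add_mem' := by
    rintro w w' ⟨M, φ, h⟩ ⟨M', φ', h'⟩
    refine ⟨M + M', φ + φ', fun a b => ?_, h.symm.add h'.symm, H1per.add_mem hΛ h.mem h'.mem,
      fun i => ?_, fun i => ?_, fun i j => ?_⟩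
    · rw [Matrix.add_apply, ← h.coeff, ← h'.coeff]; rfl
    · simp only [Pi.add_apply]
      rw [integral_add ((H1per.memLp h.mem i).integrable (by norm_num))
        ((H1per.memLp h'.mem i).integrable (by norm_num)), h.mean_zero, h'.mean_zero, add_zero]
    · rw [map_add]
      filter_upwards [Lp.coeFn_add (sndCoord Λ (Sum.inl i) w) (sndCoord Λ (Sum.inl i) w'),
        h.val i, h'.val i] with x h0 h1 h2
      rw [h0, Pi.add_apply, h1, h2]; rfl
    · rw [map_add]
      filter_upwards [Lp.coeFn_add (sndCoord Λ (Sum.inr (i, j)) w)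
        (sndCoord Λ (Sum.inr (i, j)) w'), h.grad i j, h'.grad i j,
        ae_box_of_strip (scaledGrad_add (γ := γ) h.mem h'.mem)] with x h0 h1 h2 h3
      rw [h0, Pi.add_apply, h1, h2, h3]; rfl
  smul_mem' := by
    rintro c w ⟨M, φ, h⟩
    refine ⟨c • M, c • φ, fun a b => ?_, h.symm.smul c, H1per.smul_mem hΛ c h.mem,
      fun i => ?_, fun i => ?_, fun i j => ?_⟩
    · rw [Matrix.smul_apply, ← h.coeff]; rfl
    · simp only [Pi.smul_apply, smul_eq_mul]
      rw [integral_const_mul, h.mean_zero, mul_zero]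
    · rw [map_smul]
      filter_upwards [Lp.coeFn_smul c (sndCoord Λ (Sum.inl i) w), h.val i] with x h0 h1
      rw [h0, Pi.smul_apply, h1]; rfl
    · rw [map_smul]
      filter_upwards [Lp.coeFn_smul c (sndCoord Λ (Sum.inr (i, j)) w), h.grad i j,
        ae_box_of_strip (scaledGrad_smul (γ := γ) c h.mem)] with x h0 h1 h2
      rw [h0, Pi.smul_apply, h1, h2]; rfl

lemma exists_clm_integral_mul {η : Pt → ℝ} (hη : MemLp η 2 (volume.restrict (box Λ))) :
    ∃ T : Lp ℝ 2 ((volume : Measure Pt).restrict (box Λ)) →L[ℝ] ℝ,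
      ∀ f, T f = ∫ x in box Λ, f x * η x := by
  refine ⟨innerSL ℝ hη.toLp, fun f => ?_⟩
  rw [innerSL_apply_apply, L2.inner_def]
  refine integral_congr_ae ?_
  filter_upwards [hη.coeFn_toLp] with x hx
  rw [hx]; rfl

/-- After unfolding, integration against `ζ` over the layer is an `L²` pairing on the box with a
finite sum of translates of `ζ`. The tested weak derivative identity thereby becomes a closed
condition. -/
lemma exists_clm_strip (hΛ : IsUnit Λ.det) {ζ : Pt → ℝ} (hc : Continuous ζ)
    (hs : HasCompactSupport ζ) :
    ∃ T : Lp ℝ 2 ((volume : Measure Pt).restrict (box Λ)) →L[ℝ] ℝ,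
      ∀ (f : Lp ℝ 2 ((volume : Measure Pt).restrict (box Λ))) (F : Pt → ℝ), LatticePeriodic Λ F →
        f =ᵐ[volume.restrict (box Λ)] F → ∫ x in strip, F x * ζ x = T f := by
  obtain ⟨S, hS⟩ := exists_latIdx_of_hasCompactSupport (Λ := Λ) hs
  obtain ⟨C, hC⟩ := hs.exists_bound_of_continuous hc
  obtain ⟨T, hT⟩ := exists_clm_integral_mul (Λ := Λ) (η := fun x => ∑ k ∈ S, ζ (shift Λ k x)) <|
    memLp_finsetSum _ fun k _ => MemLp.of_bound
      (hc.comp (continuous_shift k)).aestronglyMeasurable C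
      (Filter.Eventually.of_forall fun x => hC _)
  refine ⟨T, fun f F hF hfF => ?_⟩
  have hi : IntegrableOn F (box Λ) := ((Lp.memLp f).integrable (by norm_num)).congr hfF
  rw [hF.setIntegral_strip_mul hΛ hi hc hs hS, hT]
  refine integral_congr_ae ?_
  filter_upwards [hfF] with x hx
  rw [hx]

lemma ae_eq_perExt (hΛ : IsUnit Λ.det) (f : Pt → ℝ) :
    f =ᵐ[volume.restrict (box Λ)] perExt Λ f := by
  filter_upwards [ae_restrict_mem (measurableSet_box hΛ)] with x hx
  rw [perExt_of_mem_box hΛ f hx]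

/-- Symmetry, vanishing mean and each tested derivative identity are zero sets of continuous
functionals, so they persist at a limit point `w`. The periodic extensions of the components of `w`
then supply the displacement and its weak derivatives. -/
lemma isClosed_corrSubmodule (hΛ : IsUnit Λ.det) (hγ : 0 < γ) :
    IsClosed (corrSubmodule γ hΛ : Set (CorrSpace Λ)) := by
  refine isClosed_of_closure_subset fun w hw => ?_
  have key : ∀ T : CorrSpace Λ → ℝ, Continuous T →
      (∀ w' M φ, Represents γ Λ w' M φ → T w' = 0) → T w = 0 := fun T hT h0 =>
    closure_minimal (t := {w' | T w' = 0}) (by rintro w' ⟨M, φ, h⟩; exact h0 w' M φ h)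
      (isClosed_eq hT continuous_const) hw
  set σ : Fin 3 → ℝ := fun j => if j = 2 then 1 / γ else 1 with hσ
  have hσ0 : ∀ j, σ j ≠ 0 := fun j => by
    simp only [hσ]; split_ifs <;> positivity
  have hloc : ∀ f : Lp ℝ 2 ((volume : Measure Pt).restrict (box Λ)),
      LocallyIntegrableOn (perExt Λ f) strip := fun f =>
    (latticePeriodic_perExt hΛ f).locallyIntegrableOn hΛ
      (((Lp.memLp f).integrable (by norm_num)).congr (ae_eq_perExt hΛ f))
  have hL : ∀ f : Lp ℝ 2 ((volume : Measure Pt).restrict (box Λ)),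
      MemLp (perExt Λ f) 2 (volume.restrict (box Λ)) := fun f =>
    (Lp.memLp f).ae_eq (ae_eq_perExt hΛ f)
  -- `w` stores scaled derivatives, so the factor `σ j` is divided out.
  have hder : ∀ i j, HasWeakDeriv (dir j) (perExt Λ (sndCoord Λ (Sum.inl i) w))
      (fun x => (σ j)⁻¹ * perExt Λ (sndCoord Λ (Sum.inr (i, j)) w) x) := fun i j => by
    refine ⟨hloc _, (hloc _).smul (σ j)⁻¹, fun ψ hψ hs hss => ?_⟩
    obtain ⟨T, hT⟩ := exists_clm_strip hΛ (continuous_fderiv_apply_const hψ (dir j))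
      (hasCompactSupport_fderiv_apply hs (dir j))
    obtain ⟨T', hT'⟩ := exists_clm_strip hΛ hψ.continuous hs
    have h1 := key (fun w' => T (sndCoord Λ (Sum.inl i) w') +
      (σ j)⁻¹ * T' (sndCoord Λ (Sum.inr (i, j)) w')) (by fun_prop) fun w' M φ h => by
        have hg := H1per.hasWeakDeriv h.mem i j
        have e := hg.integral_eq ψ hψ hs hss
        have hp := H1per.periodic_weakDeriv h.mem i j
        rw [← hT _ _ (H1per.periodic h.mem i) (h.val i), e,
          ← hT' _ _ (hp.comp (σ j * ·)) (h.grad i j)]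
        simp only [mul_assoc]
        rw [integral_const_mul, inv_mul_cancel_left₀ (hσ0 j), neg_add_cancel]
    simp only [mul_assoc]
    rw [integral_const_mul, hT _ _ (latticePeriodic_perExt hΛ _) (ae_eq_perExt hΛ _),
      hT' _ _ (latticePeriodic_perExt hΛ _) (ae_eq_perExt hΛ _)]
    linarith
  refine ⟨Matrix.of fun a b => w.fst (a, b),
    fun x i => perExt Λ (sndCoord Λ (Sum.inl i) w) x, fun _ _ => rfl, ?_, ?_, fun i => ?_,
    fun i => ae_eq_perExt hΛ _, fun i j => ?_⟩
  · ext a b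
    have := key (fun w' => w'.fst (b, a) - w'.fst (a, b)) (by fun_prop) fun w' M φ h => by
      rw [h.coeff, h.coeff, h.symm.apply, sub_self]
    exact sub_eq_zero.1 this
  · exact mem_H1per hΛ (fun i => latticePeriodic_perExt hΛ _) (fun i => hL _)
      (fun i j => (hL _).const_mul _) hder
  · obtain ⟨T, hT⟩ := exists_clm_integral_mul (Λ := Λ) (η := fun _ => 1) (memLp_const 1)
    have := key (fun w' => T (sndCoord Λ (Sum.inl i) w')) (by fun_prop) fun w' M φ h => by
      rw [hT, ← h.mean_zero i]
      refine integral_congr_ae ?_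
      filter_upwards [h.val i] with x hx
      rw [mul_one]; exact hx
    rw [hT] at this
    rw [← this]
    refine integral_congr_ae ?_
    filter_upwards [ae_eq_perExt hΛ (sndCoord Λ (Sum.inl i) w)] with x hx
    rw [← hx, mul_one]
  · filter_upwards [ae_box_of_strip (scaledGrad_ae_eq (γ := γ) hder),
      ae_eq_perExt hΛ (sndCoord Λ (Sum.inr (i, j)) w)] with x h1 h2
    rw [h1, Matrix.of_apply]
    rw [show (if j = 2 then 1 / γ else 1) = σ j from rfl, mul_inv_cancel_left₀ (hσ0 j), ← h2]

end

/-! ### Coercivity and solution of the corrector problem -/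

section

variable {Λ : Mat2} {α β γ CΛ : ℝ} {Q : Pt → Mat3 → ℝ} {φ φ' : Pt → Fin 3 → ℝ} {G M M' : Mat2}

lemma kornConst_pos (γ CΛ : ℝ) : 0 < kornConst γ CΛ := by
  have := modeConst_nonneg γ (1 / √CΛ)
  unfold kornConst; positivity

/-- The field `ι(M) + sym g` belonging to an element of `CorrSpace Λ`. -/
def corrField (w : CorrSpace Λ) (x : Pt) : Mat3 :=
  iota (Matrix.of fun a b => w.fst (a, b)) +
    symPart (Matrix.of fun i j => sndCoord Λ (Sum.inr (i, j)) w x)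

lemma sqInt_corrField (hΛ : IsUnit Λ.det) (w : CorrSpace Λ) : SqInt Λ (corrField w) := by
  have h1 := SqInt.of_continuous (F := fun _ => iota (Matrix.of fun a b => w.fst (a, b))) hΛ
    fun i j => continuous_const
  exact h1.add (memLp_symPart fun i j => Lp.memLp (sndCoord Λ (Sum.inr (i, j)) w))

lemma corrField_add (w w' : CorrSpace Λ) : corrField (w + w') =ᵐ[volume.restrict (box Λ)]
    fun x => corrField w x + corrField w' x := by
  have h : ∀ᵐ x ∂(volume.restrict (box Λ)), ∀ i j, sndCoord Λ (Sum.inr (i, j)) (w + w') x =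
      sndCoord Λ (Sum.inr (i, j)) w x + sndCoord Λ (Sum.inr (i, j)) w' x := by
    refine ae_all_iff.2 fun i => ae_all_iff.2 fun j => ?_
    rw [map_add]
    exact Lp.coeFn_add _ _
  filter_upwards [h] with x hx
  have e1 : (Matrix.of fun a b => (w + w').fst (a, b) : Mat2) =
      Matrix.of (fun a b => w.fst (a, b)) + Matrix.of (fun a b => w'.fst (a, b)) := by
    ext a b; rfl
  have e2 : (Matrix.of fun i j => sndCoord Λ (Sum.inr (i, j)) (w + w') x : Mat3) =
      Matrix.of (fun i j => sndCoord Λ (Sum.inr (i, j)) w x) +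
      Matrix.of (fun i j => sndCoord Λ (Sum.inr (i, j)) w' x) := by
    ext i j; exact hx i j
  rw [corrField, e1, e2, iota_add, symPart_add, corrField, corrField]
  abel

lemma corrField_smul (c : ℝ) (w : CorrSpace Λ) : corrField (c • w) =ᵐ[volume.restrict (box Λ)]
    fun x => c • corrField w x := by
  have h : ∀ᵐ x ∂(volume.restrict (box Λ)), ∀ i j, sndCoord Λ (Sum.inr (i, j)) (c • w) x =
      c * sndCoord Λ (Sum.inr (i, j)) w x := by
    refine ae_all_iff.2 fun i => ae_all_iff.2 fun j => ?_
    rw [map_smul]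
    exact Lp.coeFn_smul _ _
  filter_upwards [h] with x hx
  have e1 : (Matrix.of fun a b => (c • w).fst (a, b) : Mat2) =
      c • Matrix.of (fun a b => w.fst (a, b)) := by
    ext a b; rfl
  have e2 : (Matrix.of fun i j => sndCoord Λ (Sum.inr (i, j)) (c • w) x : Mat3) =
      c • Matrix.of (fun i j => sndCoord Λ (Sum.inr (i, j)) w x) := by
    ext i j; exact hx i j
  rw [corrField, e1, e2, iota_smul, symPart_smul, corrField, smul_add]

lemma Represents.corrField_ae {w : CorrSpace Λ} (h : Represents γ Λ w M φ) :
    corrField w =ᵐ[volume.restrict (box Λ)] strain γ 0 M φ := by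
  filter_upwards [ae_all_iff.2 fun i => ae_all_iff.2 fun j => h.grad i j] with x hx
  have e1 : (Matrix.of fun a b => w.fst (a, b) : Mat2) = M := by ext a b; exact h.coeff a b
  have e2 : (Matrix.of fun i j => sndCoord Λ (Sum.inr (i, j)) w x : Mat3) = scaledGrad γ φ x := by
    ext i j; exact hx i j
  rw [corrField, e1, e2, strain_zero]

lemma norm_sq_eq_integral (f : Lp ℝ 2 ((volume : Measure Pt).restrict (box Λ))) {F : Pt → ℝ}
    (h : f =ᵐ[volume.restrict (box Λ)] F) : ‖f‖ ^ 2 = ∫ x in box Λ, F x * F x := by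
  rw [← real_inner_self_eq_norm_sq, L2.inner_def]
  refine integral_congr_ae ?_
  filter_upwards [h] with x hx
  rw [hx]; rfl

lemma Represents.norm_sq {w : CorrSpace Λ} (h : Represents γ Λ w M φ) :
    ‖w‖ ^ 2 = frob M M + (∑ i, ∫ x in box Λ, φ x i * φ x i) +
      ∫ x in box Λ, frob (scaledGrad γ φ x) (scaledGrad γ φ x) := by
  have hg := fun i j => H1per.memLp_scaledGrad (γ := γ) h.mem i j
  have e : ∫ x in box Λ, frob (scaledGrad γ φ x) (scaledGrad γ φ x) =
      ∑ i, ∑ j, ∫ x in box Λ, scaledGrad γ φ x i j * scaledGrad γ φ x i j := by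
    have hi : ∀ i j, IntegrableOn (fun x => scaledGrad γ φ x i j * scaledGrad γ φ x i j) (box Λ) :=
      fun i j => (hg i j).integrable_mul (hg i j)
    refine (integral_finsetSum _ fun i _ => integrable_finsetSum _ fun j _ => hi i j).trans ?_
    exact Finset.sum_congr rfl fun i _ => integral_finsetSum _ fun j _ => hi i j
  rw [WithLp.prod_norm_sq_eq_of_L2, EuclideanSpace.norm_sq_eq, PiLp.norm_sq_eq_of_L2,
    Fintype.sum_sum_type, Fintype.sum_prod_type, Fintype.sum_prod_type, add_assoc, e]
  congr 1
  · simp only [frob, Real.norm_eq_abs, h.coeff, sq, abs_mul_abs_self]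
  · congr 1
    · exact Finset.sum_congr rfl fun i _ => norm_sq_eq_integral _ (h.val i)
    · exact Finset.sum_congr rfl fun i _ => Finset.sum_congr rfl fun j _ =>
        norm_sq_eq_integral _ (h.grad i j)

/-- The energy of a strain controls its affine part and the gradient of its displacement. -/
lemma le_energy_strain (hα : 0 < α) (hγ : 0 < γ) (hC : 0 < CΛ) (hΛ : IsUnit Λ.det)
    (hub : ∀ ξ : Fin 2 → ℝ, ξ ⬝ᵥ ((Λᵀ * Λ) *ᵥ ξ) ≤ CΛ * (ξ ⬝ᵥ ξ)) (hQ : AdmissibleForm α β Λ Q)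
    (hG : G.IsSymm) (hM : M.IsSymm) (h : φ ∈ H1per Λ) :
    α * (|Λ.det| * (frob G G / 12 + frob M M) + (kornConst γ CΛ)⁻¹ *
      ∫ x in box Λ, frob (scaledGrad γ φ x) (scaledGrad γ φ x)) ≤
      energy Λ Q (strain γ G M φ) (strain γ G M φ) := by
  refine le_trans (mul_le_mul_of_nonneg_left ?_ hα.le) (le_energy_self hα.le hQ
    (sqInt_strain hΛ G M h) (Filter.Eventually.of_forall fun x => strain_isSymm hG hM φ x))
  rw [integral_frob_strain hΛ G M h]
  gcongr
  rw [inv_mul_le_iff₀ (kornConst_pos γ CΛ)]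
  exact korn hΛ hγ hC hub h

lemma energy_strain_le (hα : 0 < α) (hαβ : α ≤ β) (hΛ : IsUnit Λ.det)
    (hQ : AdmissibleForm α β Λ Q) (hG : G.IsSymm) (hM : M.IsSymm) (h : φ ∈ H1per Λ) :
    energy Λ Q (strain γ G M φ) (strain γ G M φ) ≤ β * (|Λ.det| * (frob G G / 12 + frob M M) +
      ∫ x in box Λ, frob (scaledGrad γ φ x) (scaledGrad γ φ x)) := by
  refine (energy_self_le hα.le hQ (sqInt_strain hΛ G M h)
    (Filter.Eventually.of_forall fun x => strain_isSymm hG hM φ x)).trans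
    (mul_le_mul_of_nonneg_left ?_ (hα.le.trans hαβ))
  rw [integral_frob_strain hΛ G M h]
  refine add_le_add_right (integral_mono (sqInt_symGrad h).integrable_frob
    (SqInt.integrable_frob fun i j => H1per.memLp_scaledGrad h i j) fun x => frob_symPart_le _) _

lemma Represents.energy_corrField {w : CorrSpace Λ} (h : Represents γ Λ w M φ) :
    energy Λ Q (corrField w) (corrField w) = energy Λ Q (strain γ 0 M φ) (strain γ 0 M φ) :=
  energy_congr h.corrField_ae h.corrField_ae

lemma integral_frob_scaledGrad_nonneg (φ : Pt → Fin 3 → ℝ) :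
    0 ≤ ∫ x in box Λ, frob (scaledGrad γ φ x) (scaledGrad γ φ x) :=
  integral_nonneg fun _ => frob_self_nonneg _

lemma frob_zero : frob (0 : Mat2) 0 = 0 := by simp [frob]

lemma Represents.energy_le (hα : 0 < α) (hαβ : α ≤ β) (hΛ : IsUnit Λ.det)
    (hQ : AdmissibleForm α β Λ Q) {w : CorrSpace Λ} (h : Represents γ Λ w M φ) :
    energy Λ Q (corrField w) (corrField w) ≤ (β * (|Λ.det| + 1)) * ‖w‖ ^ 2 := by
  have hβ : 0 < β := hα.trans_le hαβ
  have hdet : 0 < |Λ.det| := abs_pos.2 hΛ.ne_zero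
  rw [h.energy_corrField, h.norm_sq]
  refine (energy_strain_le hα hαβ hΛ hQ Matrix.transpose_zero h.symm h.mem).trans ?_
  rw [mul_assoc]
  refine mul_le_mul_of_nonneg_left ?_ hβ.le
  have h1 : 0 ≤ ∑ i, ∫ x in box Λ, φ x i * φ x i :=
    Finset.sum_nonneg fun i _ => integral_nonneg fun x => mul_self_nonneg _
  have h2 := integral_frob_scaledGrad_nonneg (Λ := Λ) (γ := γ) φ
  rw [frob_zero]
  nlinarith [frob_self_nonneg M, mul_nonneg hdet.le h1, mul_nonneg hdet.le h2]

/-- The energy bound with `G = 0` controls `M` and the gradient; Poincaré, used once for each of the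
three components, controls `φ`. The norm on `CorrSpace` is not averaged, so `c` involves `|det Λ|`.
This is harmless because only existence is drawn from it. -/
lemma exists_le_energy_corrField (hα : 0 < α) (hγ : 0 < γ) (hC : 0 < CΛ) (hΛ : IsUnit Λ.det)
    (hub : ∀ ξ : Fin 2 → ℝ, ξ ⬝ᵥ ((Λᵀ * Λ) *ᵥ ξ) ≤ CΛ * (ξ ⬝ᵥ ξ)) (hQ : AdmissibleForm α β Λ Q) :
    ∃ c, 0 < c ∧ ∀ (w : CorrSpace Λ) M φ, Represents γ Λ w M φ →
      c * ‖w‖ * ‖w‖ ≤ energy Λ Q (corrField w) (corrField w) := by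
  have hdet : 0 < |Λ.det| := abs_pos.2 hΛ.ne_zero
  have hK := kornConst_pos γ CΛ
  have hP : 0 < 3 * (CΛ + γ ^ 2) + 1 := by positivity
  refine ⟨min (α * |Λ.det|) (α * (kornConst γ CΛ)⁻¹ / (3 * (CΛ + γ ^ 2) + 1)),
    lt_min (by positivity) (by positivity), ?_⟩
  intro w M φ h
  rw [h.energy_corrField, mul_assoc, ← sq, h.norm_sq]
  refine le_trans ?_ (le_energy_strain hα hγ hC hΛ hub hQ Matrix.transpose_zero h.symm h.mem)
  have h1 : ∑ i, ∫ x in box Λ, φ x i * φ x i ≤ ∑ _i : Fin 3, (CΛ + γ ^ 2) *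
      ∫ x in box Λ, frob (scaledGrad γ φ x) (scaledGrad γ φ x) :=
    Finset.sum_le_sum fun i _ => by
      simpa only [sq] using poincare hΛ hγ hC hub h.mem i (h.mean_zero i)
  rw [Fin.sum_const, nsmul_eq_mul] at h1
  rw [frob_zero]
  set D := ∫ x in box Λ, frob (scaledGrad γ φ x) (scaledGrad γ φ x) with hD
  set c := min (α * |Λ.det|) (α * (kornConst γ CΛ)⁻¹ / (3 * (CΛ + γ ^ 2) + 1)) with hc
  have hc0 : 0 ≤ c := le_min (by positivity) (by positivity)
  calc c * (frob M M + (∑ i, ∫ x in box Λ, φ x i * φ x i) + D)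
      ≤ c * (frob M M + (3 * (CΛ + γ ^ 2) + 1) * D) := by
        refine mul_le_mul_of_nonneg_left ?_ hc0
        push_cast at h1
        linarith
    _ = c * frob M M + c * ((3 * (CΛ + γ ^ 2) + 1) * D) := by ring
    _ ≤ (α * |Λ.det|) * frob M M + (α * (kornConst γ CΛ)⁻¹ / (3 * (CΛ + γ ^ 2) + 1)) *
        ((3 * (CΛ + γ ^ 2) + 1) * D) := by
        have := integral_frob_scaledGrad_nonneg (Λ := Λ) (γ := γ) φ
        have := frob_self_nonneg M
        gcongr
        · exact min_le_left _ _
        · exact min_le_right _ _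
    _ = α * (|Λ.det| * (0 / 12 + frob M M) + (kornConst γ CΛ)⁻¹ * D) := by
        field_simp
        ring

/-- The bilinear form of the corrector problem. -/
def corrForm (hα : 0 < α) (hΛ : IsUnit Λ.det) (hQ : AdmissibleForm α β Λ Q) :
    CorrSpace Λ →ₗ[ℝ] CorrSpace Λ →ₗ[ℝ] ℝ :=
  have hS := sqInt_corrField hΛ
  LinearMap.mk₂ ℝ (fun v w => energy Λ Q (corrField v) (corrField w))
    (fun v v' w => by
      rw [energy_congr (corrField_add _ _) (Filter.EventuallyEq.refl _ _),
        energy_add_left hα.le hQ (hS _) (hS _) (hS _)])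
    (fun c v w => by
      rw [energy_congr (corrField_smul _ _) (Filter.EventuallyEq.refl _ _),
        energy_smul_left hQ, smul_eq_mul])
    (fun v w w' => by
      rw [energy_congr (Filter.EventuallyEq.refl _ _) (corrField_add _ _),
        energy_add_right hα.le hQ (hS _) (hS _) (hS _)])
    (fun c v w => by
      rw [energy_congr (Filter.EventuallyEq.refl _ _) (corrField_smul _ _),
        energy_smul_right hQ, smul_eq_mul])

/-- The energy against a fixed field, as a linear functional. -/
def corrFunctional (hα : 0 < α) (hΛ : IsUnit Λ.det) (hQ : AdmissibleForm α β Λ Q) {F : Pt → Mat3}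
    (hF : SqInt Λ F) : CorrSpace Λ →ₗ[ℝ] ℝ where
  toFun w := energy Λ Q F (corrField w)
  map_add' w w' := by
    rw [energy_congr (Filter.EventuallyEq.refl _ _) (corrField_add _ _),
      energy_add_right hα.le hQ hF (sqInt_corrField hΛ _) (sqInt_corrField hΛ _)]
  map_smul' c w := by
    rw [energy_congr (Filter.EventuallyEq.refl _ _) (corrField_smul _ _),
      energy_smul_right hQ, RingHom.id_apply, smul_eq_mul]

/-- Lax–Milgram on the closed subspace `corrSubmodule`, with minus the energy against `ι(x₃G)` as
right-hand side. -/
lemma exists_isCorrector (hα : 0 < α) (hαβ : α ≤ β) (hγ : 0 < γ) (hC : 0 < CΛ)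
    (hΛ : IsUnit Λ.det)
    (hub : ∀ ξ : Fin 2 → ℝ, ξ ⬝ᵥ ((Λᵀ * Λ) *ᵥ ξ) ≤ CΛ * (ξ ⬝ᵥ ξ)) (hQ : AdmissibleForm α β Λ Q)
    (G : Mat2) : ∃ M φ, IsCorrector γ Λ Q G M φ := by
  have hβ : 0 < β := hα.trans_le hαβ
  have hcomplete : CompleteSpace (corrSubmodule γ hΛ) :=
    (isClosed_corrSubmodule hΛ hγ).completeSpace_coe
  have hS := sqInt_corrField hΛ
  have hx3 : SqInt Λ (fun x => iota (x.1 • G)) := by simpa using sqInt_iota hΛ G 0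
  obtain ⟨c, hc, hco⟩ := exists_le_energy_corrField hα hγ hC hΛ hub hQ
  have hsqrt : ∀ w ∈ corrSubmodule γ hΛ, √(energy Λ Q (corrField w) (corrField w)) ≤
      √(β * (|Λ.det| + 1)) * ‖w‖ := by
    rintro w ⟨M, φ, h⟩
    refine (Real.sqrt_le_sqrt (h.energy_le hα hαβ hΛ hQ)).trans_eq ?_
    rw [Real.sqrt_mul (by positivity), Real.sqrt_sq (norm_nonneg _)]
  obtain ⟨⟨v, M, φ, hv⟩, hsol⟩ := exists_forall_eq_of_coercive (V := corrSubmodule γ hΛ) (c := c)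
    ((corrForm hα hΛ hQ).domRestrict₁₂ (corrSubmodule γ hΛ) (corrSubmodule γ hΛ))
    ((-corrFunctional hα hΛ hQ hx3).domRestrict (corrSubmodule γ hΛ)) (K := β * (|Λ.det| + 1))
    (K' := √(energy Λ Q (fun x => iota (x.1 • G)) (fun x => iota (x.1 • G))) *
      √(β * (|Λ.det| + 1)))
    (fun v w => by
      refine (abs_energy_le_sqrt hα.le hQ (hS v) (hS w)).trans ?_
      refine (mul_le_mul (hsqrt v v.2) (hsqrt w w.2) (Real.sqrt_nonneg _)
        (by positivity)).trans_eq ?_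
      rw [mul_mul_mul_comm, Real.mul_self_sqrt (by positivity), Submodule.coe_norm,
        Submodule.coe_norm, ← mul_assoc])
    (fun w => by
      change |(-energy Λ Q (fun x => iota (x.1 • G)) (corrField w.1))| ≤ _
      rw [abs_neg]
      refine (abs_energy_le_sqrt hα.le hQ hx3 (hS w)).trans ?_
      rw [mul_assoc]
      exact mul_le_mul_of_nonneg_left (hsqrt w w.2) (Real.sqrt_nonneg _))
    hc (fun ⟨v, M, φ, h⟩ => hco v M φ h)
  refine ⟨M, φ, hv.symm, hv.mem, hv.mean_zero, fun M' φ' hM' hφ' => ?_⟩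
  -- Members of the subspace have mean zero, while `φ'` is arbitrary. Removing its mean leaves the
  -- gradient, and hence the equation, unchanged.
  obtain ⟨ψ, hψ, hψ0, hψg⟩ := exists_mean_zero hΛ γ hφ'
  obtain ⟨w, hw⟩ := exists_represents (γ := γ) hM' hψ hψ0
  have h1 : energy Λ Q (corrField v) (corrField w) =
    -energy Λ Q (fun x => iota (x.1 • G)) (corrField w) := hsol ⟨w, M', ψ, hw⟩
  have h2 : corrField w =ᵐ[volume.restrict (box Λ)]
      fun x => iota M' + symPart (scaledGrad γ φ' x) := by
    filter_upwards [hw.corrField_ae, ae_box_of_strip hψg] with x hx hx'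
    rw [hx, strain_zero, hx']
  have h3 : strain γ G M φ =ᵐ[volume.restrict (box Λ)]
      fun x => iota (x.1 • G) + corrField v x := by
    filter_upwards [hv.corrField_ae] with x hx
    rw [hx, strain_zero, strain_eq]
  change energy Λ Q (strain γ G M φ) (fun x => iota M' + symPart (scaledGrad γ φ' x)) = 0
  rw [energy_congr h3 h2.symm, energy_add_left hα.le hQ hx3 (hS v) (hS w), h1, add_neg_cancel]

end

section

/-! ### Variational properties of correctors -/

variable {Λ : Mat2} {α β γ CΛ : ℝ} {Q : Pt → Mat3 → ℝ} {φ φ' : Pt → Fin 3 → ℝ}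
  {G G' M M' : Mat2}

lemma H1per.sub_mem (hΛ : IsUnit Λ.det) (h : φ ∈ H1per Λ) (h' : φ' ∈ H1per Λ) :
    φ - φ' ∈ H1per Λ := by
  rw [sub_eq_add_neg, ← neg_one_smul ℝ φ']
  exact H1per.add_mem hΛ h (H1per.smul_mem hΛ _ h')

lemma strain_sub (hΛ : IsUnit Λ.det) (h : φ ∈ H1per Λ) (h' : φ' ∈ H1per Λ) :
    strain γ (G - G') (M - M') (φ - φ') =ᵐ[volume.restrict strip]
      fun x => strain γ G M φ x - strain γ G' M' φ' x := by
  have e : strain γ (G - G') (M - M') (φ - φ') =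
      strain γ (G + (-1 : ℝ) • G') (M + (-1 : ℝ) • M') (φ + (-1 : ℝ) • φ') := by
    simp only [neg_one_smul, ← sub_eq_add_neg]
  rw [e]
  filter_upwards [strain_add (γ := γ) (G := G) (G' := (-1 : ℝ) • G') (M := M)
    (M' := (-1 : ℝ) • M') h (H1per.smul_mem hΛ (-1) h'),
    strain_smul (γ := γ) (G := G') (M := M') (-1) h'] with x h1 h2
  rw [h1, h2, neg_one_smul, ← sub_eq_add_neg]

lemma IsCorrector.energy_eq_zero (h : IsCorrector γ Λ Q G M φ) (hM' : M'.IsSymm)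
    (hφ' : φ' ∈ H1per Λ) : energy Λ Q (strain γ G M φ) (strain γ 0 M' φ') = 0 := by
  rw [show strain γ 0 M' φ' = fun x => iota M' + symPart (scaledGrad γ φ' x) from
    funext fun x => strain_zero M' φ' x]
  exact h.equation M' φ' hM' hφ'

lemma isCorrector_iff : IsCorrector γ Λ Q G M φ ↔ M.IsSymm ∧ φ ∈ H1per Λ ∧
    (∀ i, ∫ x in box Λ, φ x i = 0) ∧ ∀ (M' : Mat2) (φ' : Pt → Fin 3 → ℝ), M'.IsSymm →
      φ' ∈ H1per Λ → energy Λ Q (strain γ G M φ) (strain γ 0 M' φ') = 0 := by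
  refine ⟨fun h => ⟨h.symm, h.mem, h.mean_zero, fun M' φ' => h.energy_eq_zero⟩,
    fun ⟨h1, h2, h3, h4⟩ => ⟨h1, h2, h3, fun M' φ' hM' hφ' => ?_⟩⟩
  rw [← h4 M' φ' hM' hφ', energy]
  simp only [strain_zero]

lemma IsCorrector.add (hα : 0 ≤ α) (hΛ : IsUnit Λ.det) (hQ : AdmissibleForm α β Λ Q)
    (h : IsCorrector γ Λ Q G M φ) (h' : IsCorrector γ Λ Q G' M' φ') :
    IsCorrector γ Λ Q (G + G') (M + M') (φ + φ') := by
  refine isCorrector_iff.2 ⟨h.symm.add h'.symm, H1per.add_mem hΛ h.mem h'.mem, fun i => ?_,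
    fun N ψ hN hψ => ?_⟩
  · simp only [Pi.add_apply]
    rw [integral_add ((H1per.memLp h.mem i).integrable (by norm_num))
      ((H1per.memLp h'.mem i).integrable (by norm_num)), h.mean_zero, h'.mean_zero, add_zero]
  · rw [energy_congr (ae_box_of_strip (strain_add h.mem h'.mem)) (Filter.EventuallyEq.refl _ _),
      energy_add_left hα hQ (sqInt_strain hΛ _ _ h.mem) (sqInt_strain hΛ _ _ h'.mem)
      (sqInt_strain hΛ _ _ hψ), h.energy_eq_zero hN hψ, h'.energy_eq_zero hN hψ, add_zero]

lemma IsCorrector.smul (hΛ : IsUnit Λ.det) (hQ : AdmissibleForm α β Λ Q) (c : ℝ)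
    (h : IsCorrector γ Λ Q G M φ) : IsCorrector γ Λ Q (c • G) (c • M) (c • φ) := by
  refine isCorrector_iff.2 ⟨h.symm.smul c, H1per.smul_mem hΛ c h.mem, fun i => ?_,
    fun N ψ hN hψ => ?_⟩
  · simp only [Pi.smul_apply, smul_eq_mul]
    rw [integral_const_mul, h.mean_zero, mul_zero]
  · rw [energy_congr (ae_box_of_strip (strain_smul c h.mem)) (Filter.EventuallyEq.refl _ _),
      energy_smul_left hQ, h.energy_eq_zero hN hψ, mul_zero]

/-- The corrector minimizes the energy among all strains with the same matrix `G`. -/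
lemma IsCorrector.energy_le (hα : 0 ≤ α) (hΛ : IsUnit Λ.det) (hQ : AdmissibleForm α β Λ Q)
    (h : IsCorrector γ Λ Q G M φ) (hM' : M'.IsSymm) (hφ' : φ' ∈ H1per Λ) :
    energy Λ Q (strain γ G M φ) (strain γ G M φ) ≤
      energy Λ Q (strain γ G M' φ') (strain γ G M' φ') := by
  have hd := H1per.sub_mem hΛ hφ' h.mem
  have h1 := sqInt_strain (γ := γ) hΛ G M h.mem
  have h2 := sqInt_strain (γ := γ) hΛ 0 (M' - M) hd
  have e : strain γ G M' φ' =ᵐ[volume.restrict (box Λ)]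
      fun x => strain γ G M φ x + strain γ 0 (M' - M) (φ' - φ) x := by
    filter_upwards [ae_box_of_strip (strain_sub (γ := γ) (G := G) (G' := G) (M := M') (M' := M)
      hΛ hφ' h.mem)] with x hx
    rw [sub_self] at hx
    rw [hx, add_sub_cancel]
  rw [energy_congr e e, energy_add_left hα hQ h1 h2 (h1.add h2), energy_add_right hα hQ h1 h1 h2,
    energy_add_right hα hQ h2 h1 h2, energy_comm hQ (strain γ 0 _ _) (strain γ G M φ),
    h.energy_eq_zero (hM'.sub h.symm) hd]
  linarith [energy_self_nonneg hα hQ (strain γ 0 (M' - M) (φ' - φ))]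

/-- The competitor `M = 0`, `φ = 0` has strain `ι(x₃G)`, of squared norm `|det Λ| |G|²/12`. -/
lemma IsCorrector.energy_self_le (hα : 0 < α) (hαβ : α ≤ β) (hΛ : IsUnit Λ.det)
    (hQ : AdmissibleForm α β Λ Q) (h : IsCorrector γ Λ Q G M φ) (hG : G.IsSymm) :
    energy Λ Q (strain γ G M φ) (strain γ G M φ) ≤ β * (|Λ.det| * (frob G G / 12)) := by
  refine (h.energy_le hα.le hΛ hQ Matrix.transpose_zero (zero_mem_H1per hΛ)).trans ?_
  refine (energy_strain_le hα hαβ hΛ hQ hG Matrix.transpose_zero (zero_mem_H1per hΛ)).trans_eq ?_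
  have e : ∫ x in box Λ, frob (scaledGrad γ 0 x) (scaledGrad γ 0 x) = 0 := by
    rw [integral_congr_ae (g := fun _ => 0), integral_zero]
    filter_upwards [ae_box_of_strip (scaledGrad_zero (γ := γ))] with x hx
    rw [hx]; simp [frob]
  rw [e, frob_zero, add_zero, add_zero]

/-- Coercivity is compared with the energy of the zero competitor. Dividing by `|det Λ|` leaves a
constant depending only on `α`, `β`, `γ`, `CΛ`, and `1 ≤ kornConst` lets the same constant serve `M`
and the gradient. -/
lemma IsCorrector.bound (hα : 0 < α) (hαβ : α ≤ β) (hγ : 0 < γ) (hC : 0 < CΛ) (hΛ : IsUnit Λ.det)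
    (hub : ∀ ξ : Fin 2 → ℝ, ξ ⬝ᵥ ((Λᵀ * Λ) *ᵥ ξ) ≤ CΛ * (ξ ⬝ᵥ ξ)) (hQ : AdmissibleForm α β Λ Q)
    (h : IsCorrector γ Λ Q G M φ) (hG : G.IsSymm) :
    frob M M + ⨍ x in box Λ, frob (scaledGrad γ φ x) (scaledGrad γ φ x) ≤
      β * kornConst γ CΛ / (12 * α) * frob G G := by
  have hdet : 0 < |Λ.det| := abs_pos.2 hΛ.ne_zero
  have hK : 1 ≤ kornConst γ CΛ := by
    have := modeConst_nonneg γ (1 / √CΛ)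
    unfold kornConst; linarith
  have h1 := (le_energy_strain hα hγ hC hΛ hub hQ hG h.symm h.mem).trans
    (h.energy_self_le hα hαβ hΛ hQ hG)
  rw [setAverage_eq, volume_real_box, smul_eq_mul]
  set D := ∫ x in box Λ, frob (scaledGrad γ φ x) (scaledGrad γ φ x) with hD
  set K := kornConst γ CΛ with hKdef
  have hK0 : 0 < K := one_pos.trans_le hK
  have hM := frob_self_nonneg M
  have hG0 := frob_self_nonneg G
  have h2 : α * (|Λ.det| * frob M M + K⁻¹ * D) ≤ β * (|Λ.det| * (frob G G / 12)) := by
    have : 0 ≤ α * (|Λ.det| * (frob G G / 12)) := by positivity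
    linarith
  have h3 : |Λ.det| * frob M M + D ≤ K * (|Λ.det| * frob M M + K⁻¹ * D) := by
    rw [mul_add, mul_inv_cancel_left₀ hK0.ne']
    nlinarith [mul_nonneg hdet.le hM]
  have h4 : |Λ.det| * frob M M + K⁻¹ * D ≤ β * (|Λ.det| * (frob G G / 12)) / α := by
    rw [le_div_iff₀ hα]; linarith
  calc frob M M + |Λ.det|⁻¹ * D = |Λ.det|⁻¹ * (|Λ.det| * frob M M + D) := by field_simp
    _ ≤ |Λ.det|⁻¹ * (K * (β * (|Λ.det| * (frob G G / 12)) / α)) := by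
      gcongr
      exact h3.trans (mul_le_mul_of_nonneg_left h4 hK0.le)
    _ = β * K / (12 * α) * frob G G := by field_simp

lemma eq_zero_of_frob_self_eq_zero {n : ℕ} {A : Matrix (Fin n) (Fin n) ℝ} (h : frob A A = 0) :
    A = 0 := by
  ext i j
  have h1 := (Finset.sum_eq_zero_iff_of_nonneg
    fun _ _ => Finset.sum_nonneg fun _ _ => mul_self_nonneg _).1 h i (Finset.mem_univ i)
  exact mul_self_eq_zero.1 ((Finset.sum_eq_zero_iff_of_nonneg
    fun _ _ => mul_self_nonneg _).1 h1 j (Finset.mem_univ j))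

/-- The difference of two correctors is itself an admissible test field, so its energy is zero.
Coercivity annihilates `M' - M` and the gradient, Poincaré annihilates `φ' - φ` on the box, and
periodicity extends this to the layer. -/
lemma IsCorrector.unique (hα : 0 < α) (hγ : 0 < γ) (hC : 0 < CΛ) (hΛ : IsUnit Λ.det)
    (hub : ∀ ξ : Fin 2 → ℝ, ξ ⬝ᵥ ((Λᵀ * Λ) *ᵥ ξ) ≤ CΛ * (ξ ⬝ᵥ ξ)) (hQ : AdmissibleForm α β Λ Q)
    (h : IsCorrector γ Λ Q G M φ) (h' : IsCorrector γ Λ Q G M' φ') :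
    M' = M ∧ φ' =ᵐ[volume.restrict strip] φ := by
  have hdet : 0 < |Λ.det| := abs_pos.2 hΛ.ne_zero
  have hd := H1per.sub_mem hΛ h'.mem h.mem
  have e : strain γ 0 (M' - M) (φ' - φ) =ᵐ[volume.restrict (box Λ)]
      fun x => strain γ G M' φ' x - strain γ G M φ x := by
    have := strain_sub (γ := γ) (G := G) (G' := G) (M := M') (M' := M) hΛ h'.mem h.mem
    rw [sub_self] at this
    exact ae_box_of_strip this
  have h0 : energy Λ Q (strain γ 0 (M' - M) (φ' - φ)) (strain γ 0 (M' - M) (φ' - φ)) = 0 := by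
    rw [energy_congr e (Filter.EventuallyEq.refl _ _), energy_sub_left hα.le hQ
      (sqInt_strain hΛ _ _ h'.mem) (sqInt_strain hΛ _ _ h.mem) (sqInt_strain hΛ _ _ hd),
      h'.energy_eq_zero (h'.symm.sub h.symm) hd, h.energy_eq_zero (h'.symm.sub h.symm) hd, sub_zero]
  have h1 := le_energy_strain hα hγ hC hΛ hub hQ Matrix.transpose_zero (h'.symm.sub h.symm) hd
  rw [h0, frob_zero, zero_div, zero_add] at h1
  have hD := integral_frob_scaledGrad_nonneg (Λ := Λ) (γ := γ) (φ' - φ)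
  have hM := frob_self_nonneg (M' - M)
  have hK := kornConst_pos γ CΛ
  have h2 : |Λ.det| * frob (M' - M) (M' - M) + (kornConst γ CΛ)⁻¹ *
      ∫ x in box Λ, frob (scaledGrad γ (φ' - φ) x) (scaledGrad γ (φ' - φ) x) ≤ 0 :=
    nonpos_of_mul_nonpos_right h1 hα
  have h3 : 0 ≤ |Λ.det| * frob (M' - M) (M' - M) := by positivity
  have h4 := mul_nonneg (inv_nonneg.2 hK.le) hD
  have hM0 : frob (M' - M) (M' - M) = 0 :=
    (mul_eq_zero.1 (le_antisymm (by linarith) h3)).resolve_left hdet.ne'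
  have hD0 : ∫ x in box Λ, frob (scaledGrad γ (φ' - φ) x) (scaledGrad γ (φ' - φ) x) = 0 :=
    (mul_eq_zero.1 (le_antisymm (by linarith) h4)).resolve_left (inv_ne_zero hK.ne')
  refine ⟨sub_eq_zero.1 (eq_zero_of_frob_self_eq_zero hM0), ?_⟩
  refine LatticePeriodic.ae_eq_of_box hΛ h'.mem.1 h.mem.1 ?_
  have h5 : ∀ i, ∀ᵐ x ∂(volume.restrict (box Λ)), φ' x i = φ x i := fun i => by
    have hm : ∫ x in box Λ, (φ' - φ) x i = 0 := by
      simp only [Pi.sub_apply]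
      rw [integral_sub ((H1per.memLp h'.mem i).integrable (by norm_num))
        ((H1per.memLp h.mem i).integrable (by norm_num)), h.mean_zero, h'.mean_zero, sub_zero]
    have hp := poincare hΛ hγ hC hub hd i hm
    rw [hD0, mul_zero] at hp
    have hz := (integral_eq_zero_iff_of_nonneg (fun x => sq_nonneg ((φ' - φ) x i))
      (H1per.memLp hd i).integrable_sq).1
      (le_antisymm hp (integral_nonneg fun x => sq_nonneg _))
    filter_upwards [hz] with x hx
    exact sub_eq_zero.1 (pow_eq_zero_iff two_ne_zero |>.1 hx)
  filter_upwards [ae_all_iff.2 h5] with x hx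
  exact funext hx

end

section

/-! ### Representation of the homogenized form and of the effective prestrain -/

variable {Λ : Mat2} {α β γ CΛ : ℝ} {Q : Pt → Mat3 → ℝ} {B : Pt → Mat3} {Gb M : Fin 3 → Mat2}
  {φ : Fin 3 → Pt → Fin 3 → ℝ}

/-- The strain of the linear combination of correctors with coefficients `c`. -/
def combStrain (γ : ℝ) (Gb M : Fin 3 → Mat2) (φ : Fin 3 → Pt → Fin 3 → ℝ) (c : Fin 3 → ℝ) :
    Pt → Mat3 :=
  strain γ (∑ i, c i • Gb i) (∑ i, c i • M i) (∑ i, c i • φ i)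

lemma isCorrector_sum (hα : 0 ≤ α) (hΛ : IsUnit Λ.det) (hQ : AdmissibleForm α β Λ Q)
    (h : ∀ i, IsCorrector γ Λ Q (Gb i) (M i) (φ i)) (c : Fin 3 → ℝ) :
    IsCorrector γ Λ Q (∑ i, c i • Gb i) (∑ i, c i • M i) (∑ i, c i • φ i) := by
  simp only [Fin.sum_univ_three]
  exact (((h 0).smul hΛ hQ _).add hα hΛ hQ ((h 1).smul hΛ hQ _)).add hα hΛ hQ
    ((h 2).smul hΛ hQ _)

lemma combStrain_ae (hΛ : IsUnit Λ.det) (h : ∀ i, φ i ∈ H1per Λ) (c : Fin 3 → ℝ) :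
    combStrain γ Gb M φ c =ᵐ[volume.restrict (box Λ)]
      fun x => ∑ i, c i • strain γ (Gb i) (M i) (φ i) x := by
  have hs := fun i => H1per.smul_mem hΛ (c i) (h i)
  refine ae_box_of_strip ?_
  simp only [combStrain, Fin.sum_univ_three]
  filter_upwards [strain_add (γ := γ) (G := c 0 • Gb 0 + c 1 • Gb 1) (G' := c 2 • Gb 2)
      (M := c 0 • M 0 + c 1 • M 1) (M' := c 2 • M 2) (H1per.add_mem hΛ (hs 0) (hs 1)) (hs 2),
    strain_add (γ := γ) (G := c 0 • Gb 0) (G' := c 1 • Gb 1) (M := c 0 • M 0) (M' := c 1 • M 1)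
      (hs 0) (hs 1),
    ae_all_iff.2 fun i => strain_smul (γ := γ) (G := Gb i) (M := M i) (c i) (h i)]
    with x h1 h2 h3
  rw [h1, h2, h3, h3, h3]

lemma energy_combStrain_left (hα : 0 ≤ α) (hΛ : IsUnit Λ.det) (hQ : AdmissibleForm α β Λ Q)
    (h : ∀ i, φ i ∈ H1per Λ) (c : Fin 3 → ℝ) {F : Pt → Mat3} (hF : SqInt Λ F) :
    energy Λ Q (combStrain γ Gb M φ c) F =
      ∑ i, c i * energy Λ Q (strain γ (Gb i) (M i) (φ i)) F := by
  rw [energy_congr (combStrain_ae hΛ h c) (Filter.EventuallyEq.refl _ _),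
    energy_sum_left hα hQ _ (fun i => (sqInt_strain hΛ _ _ (h i)).smul (c i)) hF]
  simp only [energy_smul_left hQ]

lemma sqInt_combStrain (hΛ : IsUnit Λ.det) (h : ∀ i, φ i ∈ H1per Λ) (c : Fin 3 → ℝ) :
    SqInt Λ (combStrain γ Gb M φ c) := by
  intro i j
  have := memLp_finsetSum (Finset.univ : Finset (Fin 3)) fun k _ =>
    (sqInt_strain (γ := γ) hΛ (Gb k) (M k) (h k) i j).const_mul (c k)
  refine this.ae_eq ?_
  filter_upwards [combStrain_ae (γ := γ) (Gb := Gb) (M := M) hΛ h c] with x hx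
  rw [hx, Matrix.sum_apply]
  rfl

lemma sqInt_x3 (hΛ : IsUnit Λ.det) (G : Mat2) : SqInt Λ (fun x => iota (x.1 • G)) := by
  simpa using sqInt_iota hΛ G 0

/-- Orthogonality to relaxation fields allows `M'` and `φ'` to be inserted or dropped in the second
argument. This turns the one-sided definition of `Qhat` into a Gram matrix. -/
lemma IsCorrector.energy_strain (hα : 0 ≤ α) (hΛ : IsUnit Λ.det) (hQ : AdmissibleForm α β Λ Q)
    {G M G' M' : Mat2} {φ φ' : Pt → Fin 3 → ℝ} (h : IsCorrector γ Λ Q G M φ) (hM' : M'.IsSymm)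
    (hφ' : φ' ∈ H1per Λ) :
    energy Λ Q (strain γ G M φ) (strain γ G' M' φ') =
      energy Λ Q (strain γ G M φ) (fun x => iota (x.1 • G')) := by
  rw [show strain γ G' M' φ' = fun x => iota (x.1 • G') + strain γ 0 M' φ' x from
    funext fun x => by rw [strain_eq, strain_zero],
    energy_add_right hα hQ (sqInt_strain hΛ _ _ h.mem) (sqInt_x3 hΛ G') (sqInt_strain hΛ _ _ hφ'),
    h.energy_eq_zero hM' hφ', add_zero]

lemma Qhat_apply (hα : 0 ≤ α) (hΛ : IsUnit Λ.det) (hQ : AdmissibleForm α β Λ Q)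
    (h : ∀ i, IsCorrector γ Λ Q (Gb i) (M i) (φ i)) (i k : Fin 3) :
    Qhat γ Λ Q Gb M φ i k = |Λ.det|⁻¹ * energy Λ Q (strain γ (Gb i) (M i) (φ i))
      (strain γ (Gb k) (M k) (φ k)) := by
  rw [(h i).energy_strain hα hΛ hQ (h k).symm (h k).mem, ← innerH_eq]
  rfl

lemma Qhat_isSymm (hα : 0 ≤ α) (hΛ : IsUnit Λ.det) (hQ : AdmissibleForm α β Λ Q)
    (h : ∀ i, IsCorrector γ Λ Q (Gb i) (M i) (φ i)) : (Qhat γ Λ Q Gb M φ).IsSymm := by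
  ext i k
  rw [Matrix.transpose_apply, Qhat_apply hα hΛ hQ h, Qhat_apply hα hΛ hQ h, energy_comm hQ]

lemma innerH_combStrain (hα : 0 ≤ α) (hΛ : IsUnit Λ.det) (hQ : AdmissibleForm α β Λ Q)
    (h : ∀ i, IsCorrector γ Λ Q (Gb i) (M i) (φ i)) (c d : Fin 3 → ℝ) :
    innerH Λ Q (combStrain γ Gb M φ c) (combStrain γ Gb M φ d) =
      d ⬝ᵥ (Qhat γ Λ Q Gb M φ *ᵥ c) := by
  have hm := fun i => (h i).mem
  have hs := fun i => sqInt_strain (γ := γ) hΛ (Gb i) (M i) (hm i)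
  rw [innerH_eq, energy_comm hQ, energy_combStrain_left hα hΛ hQ hm d
    (sqInt_combStrain hΛ hm c), Finset.mul_sum, dotProduct]
  refine Finset.sum_congr rfl fun i _ => ?_
  rw [energy_comm hQ, energy_combStrain_left hα hΛ hQ hm c (hs i), Matrix.mulVec, dotProduct,
    mul_left_comm, Finset.mul_sum]
  congr 1
  refine Finset.sum_congr rfl fun j _ => ?_
  rw [Qhat_apply hα hΛ hQ h, energy_comm hQ]
  ring

lemma frob_sum_smul (hGb : IsSymOrthonormalBasis Gb) (c : Fin 3 → ℝ) :
    frob (∑ i, c i • Gb i) (∑ i, c i • Gb i) = c ⬝ᵥ c := by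
  have e : frob (∑ i, c i • Gb i) (∑ i, c i • Gb i) =
      ∑ i, ∑ j, c i * (c j * frob (Gb i) (Gb j)) := by
    simp only [frob, Fin.sum_univ_three, Fin.sum_univ_two, Matrix.add_apply, Matrix.smul_apply,
      smul_eq_mul]
    ring
  rw [e]
  simp [hGb.orthonormal, dotProduct]

lemma isSymm_sum_smul (hGb : IsSymOrthonormalBasis Gb) (c : Fin 3 → ℝ) :
    (∑ i, c i • Gb i).IsSymm := by
  simp only [Fin.sum_univ_three]
  exact (((hGb.symm 0).smul _).add ((hGb.symm 1).smul _)).add ((hGb.symm 2).smul _)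

/-- From below, the affine part of the strain alone contributes `|G|²/12`; from above, the corrector
is no worse than the zero competitor. Orthonormality of the basis identifies `|∑ ξᵢ Gᵢ|²` with `ξ ·
ξ`. -/
lemma Qhat_bounds (hα : 0 < α) (hαβ : α ≤ β) (hΛ : IsUnit Λ.det) (hQ : AdmissibleForm α β Λ Q)
    (hGb : IsSymOrthonormalBasis Gb) (h : ∀ i, IsCorrector γ Λ Q (Gb i) (M i) (φ i))
    (ξ : Fin 3 → ℝ) :
    α / 12 * (ξ ⬝ᵥ ξ) ≤ ξ ⬝ᵥ (Qhat γ Λ Q Gb M φ *ᵥ ξ) ∧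
      ξ ⬝ᵥ (Qhat γ Λ Q Gb M φ *ᵥ ξ) ≤ β / 12 * (ξ ⬝ᵥ ξ) := by
  have hdet : 0 < |Λ.det| := abs_pos.2 hΛ.ne_zero
  have hs := isCorrector_sum hα.le hΛ hQ h ξ
  have hG := isSymm_sum_smul hGb ξ
  rw [← innerH_combStrain hα.le hΛ hQ h, innerH_eq, ← frob_sum_smul hGb ξ]
  set G := ∑ i, ξ i • Gb i with hGdef
  constructor
  · have h1 := le_energy_self hα.le hQ (sqInt_strain (γ := γ) hΛ G _ hs.mem)
      (Filter.Eventually.of_forall fun x => strain_isSymm hG hs.symm _ x)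
    rw [integral_frob_strain hΛ G _ hs.mem] at h1
    have h2 : 0 ≤ ∫ x in box Λ, frob (symPart (scaledGrad γ (∑ i, ξ i • φ i) x))
        (symPart (scaledGrad γ (∑ i, ξ i • φ i) x)) :=
      integral_nonneg fun _ => frob_self_nonneg _
    have h3 : |Λ.det| * (frob G G / 12) ≤ |Λ.det| * (frob G G / 12 + frob (∑ i, ξ i • M i)
        (∑ i, ξ i • M i)) := by
      gcongr
      exact le_add_of_nonneg_right (frob_self_nonneg _)
    rw [le_inv_mul_iff₀ hdet]
    refine le_trans ?_ h1
    calc |Λ.det| * (α / 12 * frob G G) = α * (|Λ.det| * (frob G G / 12)) := by ring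
      _ ≤ _ := mul_le_mul_of_nonneg_left (by linarith) hα.le
  · rw [inv_mul_le_iff₀ hdet]
    refine (hs.energy_self_le hα hαβ hΛ hQ hG).trans_eq ?_
    ring

lemma Qhat_posDef (hα : 0 < α) (hαβ : α ≤ β) (hΛ : IsUnit Λ.det) (hQ : AdmissibleForm α β Λ Q)
    (hGb : IsSymOrthonormalBasis Gb) (h : ∀ i, IsCorrector γ Λ Q (Gb i) (M i) (φ i)) :
    (Qhat γ Λ Q Gb M φ).PosDef := by
  refine Matrix.PosDef.of_dotProduct_mulVec_pos ?_ fun ξ hξ => ?_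
  · rw [Matrix.IsHermitian, Matrix.conjTranspose_eq_transpose_of_trivial]
    exact Qhat_isSymm hα.le hΛ hQ h
  · rw [star_trivial]
    refine lt_of_lt_of_le ?_ (Qhat_bounds hα hαβ hΛ hQ hGb h ξ).1
    have : 0 < ξ ⬝ᵥ ξ := by
      refine lt_of_le_of_ne (Finset.sum_nonneg fun _ _ => mul_self_nonneg _) fun h0 => hξ ?_
      exact dotProduct_self_eq_zero.1 h0.symm
    positivity

/-- The infimum is attained at the linear combination of the correctors, whose averaged energy is
the Gram form. -/
lemma Qhom_eq (hα : 0 < α) (hΛ : IsUnit Λ.det) (hQ : AdmissibleForm α β Λ Q)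
    (h : ∀ i, IsCorrector γ Λ Q (Gb i) (M i) (φ i)) (c : Fin 3 → ℝ) :
    Qhom γ Λ Q (∑ i, c i • Gb i) = ∑ i, ∑ j, Qhat γ Λ Q Gb M φ i j * c i * c j := by
  have hs := isCorrector_sum hα.le hΛ hQ h c
  have hav : ∀ (M' : Mat2) (φ' : Pt → Fin 3 → ℝ),
      ⨍ x in box Λ, Q x (strain γ (∑ i, c i • Gb i) M' φ' x) = |Λ.det|⁻¹ *
        energy Λ Q (strain γ (∑ i, c i • Gb i) M' φ') (strain γ (∑ i, c i • Gb i) M' φ') :=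
    fun M' φ' => by rw [setAverage_eq, volume_real_box, smul_eq_mul, energy_self hQ]
  have hleast : IsLeast {e | ∃ (M' : Mat2) (φ' : Pt → Fin 3 → ℝ), M'.IsSymm ∧ φ' ∈ H1per Λ ∧
      e = ⨍ x in box Λ, Q x (strain γ (∑ i, c i • Gb i) M' φ' x)}
      (innerH Λ Q (combStrain γ Gb M φ c) (combStrain γ Gb M φ c)) := by
    refine ⟨⟨_, _, hs.symm, hs.mem, ?_⟩, ?_⟩
    · rw [hav, innerH_eq]; rfl
    · rintro e ⟨M', φ', hM', hφ', rfl⟩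
      rw [hav, innerH_eq]
      exact mul_le_mul_of_nonneg_left (hs.energy_le hα.le hΛ hQ hM' hφ') (by positivity)
  rw [Qhom, hleast.csInf_eq, innerH_combStrain hα.le hΛ hQ h]
  simp only [dotProduct, Matrix.mulVec, Finset.mul_sum]
  exact Finset.sum_congr rfl fun i _ => Finset.sum_congr rfl fun j _ => by ring

/-- Orthogonality to `HRel` is exactly the corrector equation. -/
lemma combStrain_mem_HRelPerp (hGb : IsSymOrthonormalBasis Gb) (hα : 0 ≤ α) (hΛ : IsUnit Λ.det)
    (hQ : AdmissibleForm α β Λ Q) (h : ∀ i, IsCorrector γ Λ Q (Gb i) (M i) (φ i))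
    (c : Fin 3 → ℝ) : combStrain γ Gb M φ c ∈ HRelPerp γ Λ Q := by
  have hs := isCorrector_sum hα hΛ hQ h c
  refine ⟨⟨_, _, isSymm_sum_smul hGb c, ⟨_, _, hs.symm, hs.mem, Filter.EventuallyEq.refl _ _⟩,
    Filter.Eventually.of_forall fun x => strain_eq _ _ _ x⟩, ?_⟩
  rintro χ ⟨M', φ', hM', hφ', hχ⟩
  have e : χ =ᵐ[volume.restrict (box Λ)] strain γ 0 M' φ' := by
    filter_upwards [ae_box_of_strip hχ] with x hx
    rw [hx, strain_zero]
  rw [innerH_eq, energy_congr (Filter.EventuallyEq.refl _ _) e, combStrain,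
    hs.energy_eq_zero hM' hφ', mul_zero]

/-- The space `𝐇^{γ,⊥}_{rel,Λ}` is spanned by the strains of the correctors. -/
lemma exists_ae_eq_combStrain (hGb : IsSymOrthonormalBasis Gb) (hα : 0 < α) (hΛ : IsUnit Λ.det)
    (hQ : AdmissibleForm α β Λ Q) (h : ∀ i, IsCorrector γ Λ Q (Gb i) (M i) (φ i))
    {P : Pt → Mat3} (hP : P ∈ HRelPerp γ Λ Q) :
    ∃ c, P =ᵐ[volume.restrict (box Λ)] combStrain γ Gb M φ c := by
  obtain ⟨⟨G, χ, hG, ⟨M', φ', hM', hφ', hχ⟩, hPχ⟩, hperp⟩ := hP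
  obtain ⟨c, rfl⟩ := hGb.span G hG
  have hs := isCorrector_sum hα.le hΛ hQ h c
  have hd := H1per.sub_mem hΛ hφ' hs.mem
  have hMd := hM'.sub hs.symm
  have hdet : 0 < |Λ.det| := abs_pos.2 hΛ.ne_zero
  -- `d` is the difference of `P` and the corrector strain with the same `G`. It lies in `HRel`, to
  -- which both are orthogonal, so its energy is zero.
  set d := strain γ 0 (M' - ∑ i, c i • M i) (φ' - ∑ i, c i • φ i) with hdef
  have hdI : SqInt Λ d := sqInt_strain hΛ _ _ hd
  have eP : P =ᵐ[volume.restrict (box Λ)] strain γ (∑ i, c i • Gb i) M' φ' := by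
    filter_upwards [ae_box_of_strip hPχ, ae_box_of_strip hχ] with x h1 h2
    rw [h1, h2, strain_eq]
  have ed : d =ᵐ[volume.restrict (box Λ)] fun x =>
      strain γ (∑ i, c i • Gb i) M' φ' x - combStrain γ Gb M φ c x := by
    have := strain_sub (γ := γ) (G := ∑ i, c i • Gb i) (G' := ∑ i, c i • Gb i) (M := M')
      (M' := ∑ i, c i • M i) hΛ hφ' hs.mem
    rw [sub_self] at this
    exact ae_box_of_strip this
  have h1 : energy Λ Q (strain γ (∑ i, c i • Gb i) M' φ') d = 0 := by
    have := hperp d ⟨_, _, hMd, hd, Filter.Eventually.of_forall fun x => strain_zero _ _ x⟩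
    rw [innerH_eq, energy_congr eP (Filter.EventuallyEq.refl _ _)] at this
    exact (mul_eq_zero.1 this).resolve_left (inv_ne_zero hdet.ne')
  have h2 : energy Λ Q d d = 0 := by
    rw [energy_congr ed (Filter.EventuallyEq.refl _ _), energy_sub_left hα.le hQ
      (sqInt_strain hΛ _ _ hφ') (sqInt_combStrain hΛ (fun i => (h i).mem) c) hdI, h1, combStrain,
      hs.energy_eq_zero hMd hd, sub_zero]
  have h3 := le_energy_self hα.le hQ hdI
    (Filter.Eventually.of_forall fun x => strain_isSymm Matrix.transpose_zero hMd _ x)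
  rw [h2] at h3
  have h4 := (integral_eq_zero_iff_of_nonneg (fun x => frob_self_nonneg (d x))
    hdI.integrable_frob).1 (le_antisymm (nonpos_of_mul_nonpos_right h3 hα)
      (integral_nonneg fun x => frob_self_nonneg _))
  refine ⟨c, ?_⟩
  filter_upwards [eP, ed, h4] with x hx1 hx2 hx3
  rw [hx1, ← sub_eq_zero, ← hx2]
  exact eq_zero_of_frob_self_eq_zero hx3

lemma x3_mem_HSpace (hΛ : IsUnit Λ.det) {G : Mat2} (hG : G.IsSymm) :
    (fun x : Pt => iota (x.1 • G)) ∈ HSpace Λ :=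
  ⟨fun _ => Filter.Eventually.of_forall fun _ => rfl,
    Filter.Eventually.of_forall fun _ => iota_isSymm (hG.smul _), sqInt_x3 hΛ G⟩

lemma AdmissiblePrestrain.symPart_mem_HSpace (hB : AdmissiblePrestrain Λ B) :
    (fun x => symPart (B x)) ∈ HSpace Λ :=
  ⟨hB.periodic.comp symPart, Filter.Eventually.of_forall fun _ => symPart_isSymm _,
    memLp_symPart hB.sqIntegrable⟩

/-- `ι(x₃G)` and its corrector strain differ by a relaxation field, so they have the same products
with all corrector strains: the second is the projection of the first. -/
lemma innerH_x3_combStrain (hα : 0 ≤ α) (hΛ : IsUnit Λ.det) (hQ : AdmissibleForm α β Λ Q)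
    (h : ∀ i, IsCorrector γ Λ Q (Gb i) (M i) (φ i)) (c d : Fin 3 → ℝ) :
    innerH Λ Q (fun x => iota (x.1 • ∑ i, c i • Gb i)) (combStrain γ Gb M φ d) =
      d ⬝ᵥ (Qhat γ Λ Q Gb M φ *ᵥ c) := by
  have hc := isCorrector_sum hα hΛ hQ h c
  rw [← innerH_combStrain hα hΛ hQ h, innerH_eq, innerH_eq, energy_comm hQ,
    energy_comm hQ (combStrain γ Gb M φ c), combStrain, combStrain,
    (isCorrector_sum hα hΛ hQ h d).energy_strain hα hΛ hQ hc.symm hc.mem]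

lemma innerH_prestrain_combStrain (hα : 0 ≤ α) (hΛ : IsUnit Λ.det) (hQ : AdmissibleForm α β Λ Q)
    (h : ∀ i, IsCorrector γ Λ Q (Gb i) (M i) (φ i)) (hB : AdmissiblePrestrain Λ B)
    (d : Fin 3 → ℝ) :
    innerH Λ Q (fun x => symPart (B x)) (combStrain γ Gb M φ d) =
      d ⬝ᵥ Bhat γ Λ Q B Gb M φ := by
  have e : (fun x => symPart (B x)) =ᵐ[volume.restrict (box Λ)] B := by
    filter_upwards [ae_restrict_mem (measurableSet_box hΛ)] with x hx
    exact symPart_of_isSymm (hB.symm x (box_subset_strip hx))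
  rw [innerH_eq, energy_congr e (Filter.EventuallyEq.refl _ _), energy_comm hQ,
    energy_combStrain_left hα hΛ hQ (fun i => (h i).mem) d hB.sqIntegrable, Finset.mul_sum,
    dotProduct]
  refine Finset.sum_congr rfl fun i _ => ?_
  rw [mul_left_comm, ← innerH_eq]
  rfl

lemma innerH_sub_left (hα : 0 ≤ α) (hQ : AdmissibleForm α β Λ Q) {F F' G : Pt → Mat3}
    (hF : SqInt Λ F) (hF' : SqInt Λ F') (hG : SqInt Λ G) :
    innerH Λ Q (fun x => F x - F' x) G = innerH Λ Q F G - innerH Λ Q F' G := by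
  rw [innerH_eq, innerH_eq, innerH_eq, energy_sub_left hα hQ hF hF' hG, mul_sub]

/-- A linear combination of the basis is an effective prestrain if and only if its coefficients
solve the linear system with matrix `Q̂` and right-hand side `B̂`. -/
lemma isEffPrestrain_sum_iff (hα : 0 < α) (hΛ : IsUnit Λ.det) (hQ : AdmissibleForm α β Λ Q)
    (hGb : IsSymOrthonormalBasis Gb) (h : ∀ i, IsCorrector γ Λ Q (Gb i) (M i) (φ i))
    (hB : AdmissiblePrestrain Λ B) (c : Fin 3 → ℝ) :
    IsEffPrestrain γ Λ Q B (∑ i, c i • Gb i) ↔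
      Qhat γ Λ Q Gb M φ *ᵥ c = Bhat γ Λ Q B Gb M φ := by
  have hI := sqInt_combStrain (γ := γ) (Gb := Gb) (M := M) hΛ fun i => (h i).mem
  have hx3 := sqInt_x3 hΛ (∑ i, c i • Gb i)
  have hBI : SqInt Λ fun x => symPart (B x) := memLp_symPart hB.sqIntegrable
  constructor
  -- A common projection forces both fields to have equal products with every corrector strain;
  -- these products are the entries of `Q̂ c` and `B̂`.
  · rintro ⟨-, P, ⟨-, hP, hP1⟩, -, -, hP2⟩
    obtain ⟨p, hp⟩ := exists_ae_eq_combStrain hGb hα hΛ hQ h hP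
    have hPI : SqInt Λ P := (hI p).congr hp.symm
    have key : ∀ d, d ⬝ᵥ (Qhat γ Λ Q Gb M φ *ᵥ c) = d ⬝ᵥ Bhat γ Λ Q B Gb M φ := fun d => by
      have hd := combStrain_mem_HRelPerp hGb hα.le hΛ hQ h d
      have h1 := (innerH_sub_left hα.le hQ hx3 hPI (hI d)).symm.trans (hP1 _ hd)
      have h2 := (innerH_sub_left hα.le hQ hBI hPI (hI d)).symm.trans (hP2 _ hd)
      rw [sub_eq_zero, innerH_x3_combStrain hα.le hΛ hQ h] at h1
      rw [sub_eq_zero, innerH_prestrain_combStrain hα.le hΛ hQ h hB] at h2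
      rw [h1, h2]
    exact funext fun i => by simpa using key (Pi.single i 1)
  -- The corrector strain with coefficients `c` serves as the common projection.
  · intro hc
    have hP := combStrain_mem_HRelPerp hGb hα.le hΛ hQ h c
    refine ⟨isSymm_sum_smul hGb c, combStrain γ Gb M φ c,
      ⟨x3_mem_HSpace hΛ (isSymm_sum_smul hGb c), hP, fun χ hχ => ?_⟩,
      ⟨hB.symPart_mem_HSpace, hP, fun χ hχ => ?_⟩⟩
    all_goals
      obtain ⟨d, hd⟩ := exists_ae_eq_combStrain hGb hα hΛ hQ h hχ
      rw [innerH_eq, energy_congr (Filter.EventuallyEq.refl _ _) hd, ← innerH_eq]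
    · refine (innerH_sub_left hα.le hQ hx3 (hI c) (hI d)).trans ?_
      rw [innerH_x3_combStrain hα.le hΛ hQ h]
      exact sub_eq_zero.2 (innerH_combStrain hα.le hΛ hQ h c d).symm
    · refine (innerH_sub_left hα.le hQ hBI (hI c) (hI d)).trans ?_
      rw [innerH_prestrain_combStrain hα.le hΛ hQ h hB, ← hc]
      exact sub_eq_zero.2 (innerH_combStrain hα.le hΛ hQ h c d).symm

/-- `Qhat` is positive definite, hence invertible, and every symmetric matrix is a combination of
the basis. The linear system therefore singles out one matrix, which the choice in `effPrestrain`
must return. -/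
lemma effPrestrain_eq (hα : 0 < α) (hαβ : α ≤ β) (hΛ : IsUnit Λ.det)
    (hQ : AdmissibleForm α β Λ Q) (hGb : IsSymOrthonormalBasis Gb)
    (h : ∀ i, IsCorrector γ Λ Q (Gb i) (M i) (φ i)) (hB : AdmissiblePrestrain Λ B) :
    (∃! G : Mat2, IsEffPrestrain γ Λ Q B G) ∧ effPrestrain γ Λ Q B =
      ∑ i, ((Qhat γ Λ Q Gb M φ)⁻¹ *ᵥ Bhat γ Λ Q B Gb M φ) i • Gb i := by
  have hu : IsUnit (Qhat γ Λ Q Gb M φ).det :=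
    (Qhat_posDef hα hαβ hΛ hQ hGb h).det_pos.ne'.isUnit
  have hsol : IsEffPrestrain γ Λ Q B
      (∑ i, ((Qhat γ Λ Q Gb M φ)⁻¹ *ᵥ Bhat γ Λ Q B Gb M φ) i • Gb i) := by
    rw [isEffPrestrain_sum_iff hα hΛ hQ hGb h hB, Matrix.mulVec_mulVec,
      Matrix.mul_nonsing_inv _ hu, Matrix.one_mulVec]
  have huniq : ∀ G, IsEffPrestrain γ Λ Q B G →
      G = ∑ i, ((Qhat γ Λ Q Gb M φ)⁻¹ *ᵥ Bhat γ Λ Q B Gb M φ) i • Gb i := fun G hG => by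
    obtain ⟨c, rfl⟩ := hGb.span G hG.1
    rw [← (isEffPrestrain_sum_iff hα hΛ hQ hGb h hB c).1 hG, Matrix.mulVec_mulVec,
      Matrix.nonsing_inv_mul _ hu, Matrix.one_mulVec]
  have hex : ∃ G, IsEffPrestrain γ Λ Q B G := ⟨_, hsol⟩
  refine ⟨⟨_, hsol, huniq⟩, ?_⟩
  rw [effPrestrain, dif_pos hex]
  exact huniq _ hex.choose_spec

end

end

end PlateHom

theorem mainTheorem7 (α β γ CΛ : ℝ) (hα : 0 < α) (hαβ : α ≤ β) (hγ : 0 < γ) (hCΛ : 0 < CΛ) :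
    ∃ C : ℝ, ∀ Λ : Mat2, IsUnit Λ.det →
      (∀ ξ : Fin 2 → ℝ, 1 / CΛ * (ξ ⬝ᵥ ξ) ≤ ξ ⬝ᵥ ((Λᵀ * Λ) *ᵥ ξ) ∧
        ξ ⬝ᵥ ((Λᵀ * Λ) *ᵥ ξ) ≤ CΛ * (ξ ⬝ᵥ ξ)) →
      ∀ Q : Pt → Mat3 → ℝ, AdmissibleForm α β Λ Q →
        -- existence, uniqueness and a priori bound for the correctors
        (∀ G : Mat2, G.IsSymm → ∃ (M : Mat2) (φ : Pt → Fin 3 → ℝ),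
          IsCorrector γ Λ Q G M φ ∧
          (∀ (M' : Mat2) (φ' : Pt → Fin 3 → ℝ), IsCorrector γ Λ Q G M' φ' →
            M' = M ∧ φ' =ᵐ[volume.restrict strip] φ) ∧
          frob M M + ⨍ x in box Λ, frob (scaledGrad γ φ x) (scaledGrad γ φ x) ≤
            C * frob G G) ∧
        -- representation via the correctors of an orthonormal basis
        ∀ (Gb : Fin 3 → Mat2) (M : Fin 3 → Mat2) (φ : Fin 3 → Pt → Fin 3 → ℝ),
          IsSymOrthonormalBasis Gb →
          (∀ i, IsCorrector γ Λ Q (Gb i) (M i) (φ i)) →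
          ((Qhat γ Λ Q Gb M φ).IsSymm ∧ (Qhat γ Λ Q Gb M φ).PosDef ∧
            (∀ ξ : Fin 3 → ℝ,
              α / 12 * (ξ ⬝ᵥ ξ) ≤ ξ ⬝ᵥ (Qhat γ Λ Q Gb M φ *ᵥ ξ) ∧
              ξ ⬝ᵥ (Qhat γ Λ Q Gb M φ *ᵥ ξ) ≤ β / 12 * (ξ ⬝ᵥ ξ)) ∧
            (∀ (G : Mat2) (c : Fin 3 → ℝ), G.IsSymm → G = ∑ i, c i • Gb i →
              Qhom γ Λ Q G = ∑ i, ∑ j, Qhat γ Λ Q Gb M φ i j * c i * c j)) ∧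
          ∀ B : Pt → Mat3, AdmissiblePrestrain Λ B →
            (∃! G : Mat2, IsEffPrestrain γ Λ Q B G) ∧
            effPrestrain γ Λ Q B =
              ∑ i, ((Qhat γ Λ Q Gb M φ)⁻¹ *ᵥ Bhat γ Λ Q B Gb M φ) i • Gb i := by
  refine ⟨β * kornConst γ CΛ / (12 * α), fun Λ hΛ hb Q hQ => ⟨fun G hG => ?_,
    fun Gb M φ hGb h => ⟨⟨Qhat_isSymm hα.le hΛ hQ h, Qhat_posDef hα hαβ hΛ hQ hGb h,
      Qhat_bounds hα hαβ hΛ hQ hGb h, fun G c _ hc => ?_⟩,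
      fun B hB => effPrestrain_eq hα hαβ hΛ hQ hGb h hB⟩⟩⟩
  · obtain ⟨M, φ, h⟩ := exists_isCorrector hα hαβ hγ hCΛ hΛ (fun ξ => (hb ξ).2) hQ G
    exact ⟨M, φ, h, fun M' φ' h' => h.unique hα hγ hCΛ hΛ (fun ξ => (hb ξ).2) hQ h',
      h.bound hα hαβ hγ hCΛ hΛ (fun ξ => (hb ξ).2) hQ hG⟩
  · rw [hc, Qhom_eq hα hΛ hQ h]
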